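/- **Model.** Algorithms are deterministic one-tape Turing machines with an arbitrary finite tape alphabet of $n\ge 2$ symbols besides the blank; a machine with $n$ symbols receives its input and delivers its output, which are non-negative integers, written in the $n$-ary number system ($0$ is written as the one-digit word "0"). The size of the tape used in the computation $A(x)$ is the number of cells that belong to the input word, terminate it (one blank cell), or are visited by the head. The space $p_A(x)$ is this size reduced by $1$ if $A(x)$ halts, and $p_A(x)=\infty$ if it does not. An algorithm $A$ computes a total function $F$ if $A(x)=F(x)$ for every $x$ on which $A$ halts. A function $F$ is computable in space $p:\mathbb N\to\mathbb N\cup\{\infty\}$ if $p=p_A$ for some algorithm $A$ that computes $F$. A function $p:\mathbb N\to\mathbb N\cup\{\infty\}$, viewed as a partial function that is undefined where it is $\infty$, is *simple* if it is itself computable within space $p(x)$, i.e. there is an algorithm $A$ that halts exactly on those $x$ with $p(x)<\infty$, and on these outputs $p(x)$ with $p_A(x)\le p(x)$. Finally, $p\succ G$ means that there is a constant $C$ such that $G(x)\le C\,p(x)$ for all $x$. **Theorem 2.** For every total recursive function $F:\mathbb N\to\mathbb N$ there is a total recursive function $G:\mathbb N\to\mathbb N$ such that $F$ is computable in exactly those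 spaces $p$ which are simple and satisfy $p\succ G$; that is, for every $p:\mathbb N\to\mathbb N\cup\{\infty\}$, $F$ is computable in space $p$ if and only if $p$ is simple and $p\succ G$. -/

import Mathlib

namespace TuringSpace

open Turing

/-- A one-tape Turing machine with an arbitrary finite tape alphabet. The tape is infinite in both
directions; a cell is either blank (`none`) or holds one of the `base` symbols of the alphabet,
which serve as the digits of the `base`-ary number system. -/
structure Algorithm where
  /-- the number of symbols of the alphabet -/
  base : ℕ
  two_le_base : 2 ≤ base
  /-- the finite set of states, with `default` as the starting state -/
  State : Type
  [inhabitedState : Inhabited State]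
  [finiteState : Finite State]
  /-- the transition table: depending on the state and the scanned symbol, either halt, or change
  the state and move one cell left, move one cell right, or overwrite the scanned cell -/
  table : TM0.Machine (Option (Fin base)) State

attribute [instance] Algorithm.inhabitedState Algorithm.finiteState

/-- The `b`-ary numeral of `x`, without superfluous zeros, the units digit being listed first.
The numeral of `0` is the one-digit word `0`. -/
def numeral (b : ℕ) (hb : 2 ≤ b) (x : ℕ) : List (Fin b) :=
  if x = 0 then [⟨0, by omega⟩]
  else (Nat.digits b x).pmap (fun d hd => ⟨d, hd⟩) (fun _ hd => Nat.digits_lt_base hb hd)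

/-- The digits standing at the beginning of `l`, up to the first blank. -/
def leadingDigits {b : ℕ} (l : List (Option (Fin b))) : List ℕ :=
  ((l.takeWhile Option.isSome).reduceOption).map Fin.val

theorem leadingDigits_append_blanks {b : ℕ} (l : List (Option (Fin b))) (k : ℕ) :
    leadingDigits (l ++ List.replicate k none) = leadingDigits l := by
  unfold leadingDigits
  congr 2
  induction l with
  | nil => cases k <;> simp [List.replicate_succ]
  | cons a l ih => cases a <;> simp [ih]

/-- The number denoted by the word that begins at the first cell of a half-tape and extends up to
the first blank (units digit first). -/
def readNumber {b : ℕ} (l : ListBlank (Option (Fin b))) : ℕ :=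
  l.liftOn (fun w => Nat.ofDigits b (leadingDigits w)) (by
    rintro w _ ⟨k, rfl⟩
    exact congrArg (Nat.ofDigits b) (leadingDigits_append_blanks w k).symm)

namespace Algorithm

variable (A : Algorithm)

/-- Configurations: a state together with a tape and the head on it. -/
abbrev Config : Type := TM0.Cfg (Option (Fin A.base)) A.State

/-- The input word for `x`. -/
def input (x : ℕ) : List (Option (Fin A.base)) :=
  (numeral A.base A.two_le_base x).map some

/-- The partial function computed by the algorithm. At the start the input word stands on an
otherwise blank tape, with the head on its units digit; if the machine halts, the output is the
number whose word begins at the head. -/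
def eval (x : ℕ) : Part ℕ :=
  (TM0.eval A.table (A.input x)).map readNumber

/-- The displacement of the head in the step made from the configuration `c`. -/
def shift (c : A.Config) : ℤ :=
  match A.table c.q c.Tape.head with
  | some (_, TM0.Stmt.move Dir.left) => -1
  | some (_, TM0.Stmt.move Dir.right) => 1
  | _ => 0

/-- The configuration on input `x` after `t` steps, together with the position of the head relative
to its initial position; `none` if the machine has halted before. -/
def after (x : ℕ) : ℕ → Option (A.Config × ℤ)
  | 0 => some (TM0.init (A.input x), 0)
  | t + 1 => (after x t).bind fun s =>
      (TM0.step A.table s.1).map fun c => (c, s.2 + A.shift s.1)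

/-- The cells used in the computation on input `x`: the cells `0, …, l - 1` of the input word, of
length `l`, the blank cell `l` that terminates it, and all cells visited by the head. -/
def usedCells (x : ℕ) : Set ℤ :=
  Set.Icc 0 ((A.input x).length : ℤ) ∪ {z | ∃ t c, A.after x t = some (c, z)}

open Classical in
/-- The space of the algorithm on input `x`: the size of the used tape, reduced by one, and `∞` if
the machine does not halt. -/
noncomputable def space (x : ℕ) : ℕ∞ :=
  if (A.eval x).Dom then (A.usedCells x).encard - 1 else ⊤

/-- The algorithm computes the partial function `F`, that is, it does so everywhere in the
intersection of its domain and the domain of `F`. -/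
def Computes (F : ℕ →. ℕ) : Prop :=
  ∀ x, ∀ y ∈ A.eval x, ∀ z ∈ F x, y = z

end Algorithm

/-- `F` is computable in space `p`: `p` is the space of an algorithm that computes `F`. The value
`∞` of `p` stands for "undefined". -/
def ComputableInSpace (F : ℕ →. ℕ) (p : ℕ → ℕ∞) : Prop :=
  ∃ A : Algorithm, A.Computes F ∧ A.space = p

/-- A partial function `p` (with `∞` for "undefined") is simple if it is itself computable within
space `p`: some algorithm with the same domain outputs `p x` on input `x`, in space at most
`p x`. -/
def IsSimple (p : ℕ → ℕ∞) : Prop :=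
  ∃ A : Algorithm, (∀ x (y : ℕ), y ∈ A.eval x ↔ p x = y) ∧ ∀ x, A.space x ≤ p x

/-- `f ≺ g`: the inequality `f ≤ g` within a constant factor. -/
def Prec (f g : ℕ → ℕ∞) : Prop :=
  ∃ C : ℕ, ∀ x, f x ≤ (C : ℕ∞) * g x

end TuringSpace

/-! A machine working in space `p` runs through configurations whose codes are at most exponential
in `p`. Conversely, functions built by primitive recursion with polynomially bounded intermediate
values (`LinSpace`), applied to numbers of size `2 ^ O(p)`, need only space `O(p)`. A larger tape
alphabet absorbs the constant factor, and unused cells can be visited on purpose, so that the space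
becomes exactly `p x`. For this the machine only has to find out `p x` without exceeding it, which
is what simplicity provides.

Two results make this precise. `exists_simulation` arithmetizes Turing machines: configurations
become numbers below `K ^ p`, while start, step, halting test, output and used space become
`LinSpace` functions of them. `exists_algorithm` goes the other way: a loop whose ingredients are in
`LinSpace` is carried out by an algorithm whose space is a prescribed number, computed by the loop
itself. Together they show that the space of an algorithm is simple (`isSimple_space`), and that for
simple `p` and `Q` in `LinSpace` the value `Q x (2 ^ (C * p x))` is computable in space exactly `p
x` (`exists_algorithm_of_isSimple`).

The function `G` comes from one universal predictor. Let `Fs x N` be a `LinSpace` approximation that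
is `0` or `F x + 1`, and not `0` for large `N` (`exists_approximation`). At stage `N`, `predict`
takes the value of `F` at `x` if the approximation has found it; otherwise it trusts the first
machine that gives a value when simulated up to `N` and has not yet been seen to contradict the
approximation. If machine `e` computes `F`, then the finitely many earlier machines that ever err
are refuted from some stage on, and from then on the prediction is right whenever `N` suffices to
simulate `e` on `x` (`predict_eq`).

Let `G x` be the least `s` such that the predictions at all stages `2 ^ s'` with `s' ≥ s` are right.
It is computable, because the predictions are certainly right once the approximation has found `F
x`. Since an algorithm with space `p` is simulated at stage `2 ^ (C * p)`, the space of every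
algorithm for `F` dominates `G` (`exists_threshold`). Conversely, if `p` is simple and `G ≤ C * p`,
the prediction at stage `2 ^ (C * p x)` is right, and it is available in space `p x`. -/

open Turing

/-! ### Polynomially bounded primitive recursion -/

namespace TuringSpace

/-- The environment `σ` with the value `a` put in front. -/
def push (a : ℕ) (σ : ℕ → ℕ) : ℕ → ℕ
  | 0 => a
  | i + 1 => σ i

@[simp] theorem push_zero (a : ℕ) (σ : ℕ → ℕ) : push a σ 0 = a := rfl
@[simp] theorem push_succ (a : ℕ) (σ : ℕ → ℕ) (i : ℕ) : push a σ (i + 1) = σ i := rfl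
@[simp] theorem push_one (a : ℕ) (σ : ℕ → ℕ) : push a σ 1 = σ 0 := rfl
@[simp] theorem push_two (a : ℕ) (σ : ℕ → ℕ) : push a σ 2 = σ 1 := rfl
@[simp] theorem push_three (a : ℕ) (σ : ℕ → ℕ) : push a σ 3 = σ 2 := rfl

theorem push_le {a M : ℕ} {σ : ℕ → ℕ} (ha : a ≤ M) (h : ∀ j, σ j ≤ M) : ∀ j, push a σ j ≤ M
  | 0 => ha
  | j + 1 => h j

/-- Primitive recursion over environments. -/
def primRec (i s : (ℕ → ℕ) → ℕ) (σ : ℕ → ℕ) (t : ℕ) : ℕ :=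
  Nat.rec (i σ) (fun y IH => s (push IH (push y σ))) t

@[simp] theorem primRec_zero (i s : (ℕ → ℕ) → ℕ) (σ : ℕ → ℕ) : primRec i s σ 0 = i σ := rfl

@[simp] theorem primRec_succ (i s : (ℕ → ℕ) → ℕ) (σ : ℕ → ℕ) (t : ℕ) :
    primRec i s σ (t + 1) = s (push (primRec i s σ t) (push t σ)) := rfl

/-- The functions of an environment that are definable by polynomially bounded primitive recursion;
on numerals these are the functions computable in linear space. -/
inductive LinSpace : ((ℕ → ℕ) → ℕ) → Prop
  | zero : LinSpace fun _ => 0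
  | var (i : ℕ) : LinSpace fun σ => σ i
  | succ {f} : LinSpace f → LinSpace fun σ => f σ + 1
  | ren {f} (ρ : ℕ → ℕ) : LinSpace f → LinSpace fun σ => f fun i => σ (ρ i)
  | bind {f g} : LinSpace f → LinSpace g → LinSpace fun σ => f (push (g σ) σ)
  | prec {n i s} (c : ℕ) : LinSpace n → LinSpace i → LinSpace s →
      (∀ σ M, (∀ j, σ j ≤ M) → ∀ t ≤ n σ, primRec i s σ t ≤ (M + 2) ^ c) →
      LinSpace fun σ => primRec i s σ (n σ)

namespace LinSpace

variable {f g h n i s : (ℕ → ℕ) → ℕ}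

/-- Polynomial bounds compose: adding `2` to a number `X ≥ 1` costs at most the factor `4 ≤ (M + 2)
^ 2`. -/
theorem pow_add_two_le {M c d e : ℕ} (h : (c + 2) * d ≤ e) : ((M + 2) ^ c + 2) ^ d ≤ (M + 2) ^ e := by
  have h1 : (M + 2) ^ c + 2 ≤ (M + 2) ^ (c + 2) := by
    have : 1 ≤ (M + 2) ^ c := Nat.one_le_pow _ _ (by omega)
    have h4 : 2 ^ 2 ≤ (M + 2) ^ 2 := Nat.pow_le_pow_left (by omega) 2
    rw [pow_add]; nlinarith
  calc ((M + 2) ^ c + 2) ^ d ≤ ((M + 2) ^ (c + 2)) ^ d := Nat.pow_le_pow_left h1 _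
    _ = (M + 2) ^ ((c + 2) * d) := by rw [pow_mul]
    _ ≤ _ := Nat.pow_le_pow_right (by omega) h

theorem le_pow {M c : ℕ} (hc : 1 ≤ c) : M ≤ (M + 2) ^ c :=
  le_trans (by omega) (Nat.le_self_pow (by omega : c ≠ 0) (M + 2))

/-- Values are polynomial in a common bound of all variables, so their numerals are longer only by a
constant factor. Composition multiplies exponents, and recursion carries its bound along as a side
condition. -/
theorem exists_bound (hf : LinSpace f) : ∃ c, ∀ σ M, (∀ j, σ j ≤ M) → f σ ≤ (M + 2) ^ c := by
  induction hf with
  | zero => exact ⟨0, fun _ _ _ => by simp⟩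
  | var i => exact ⟨1, fun σ M h => le_trans (h i) (le_pow le_rfl)⟩
  | succ _ ih =>
    obtain ⟨c, hc⟩ := ih
    refine ⟨c + 1, fun σ M h => ?_⟩
    have h1 := hc σ M h
    have : 1 ≤ (M + 2) ^ c := Nat.one_le_pow _ _ (by omega)
    rw [pow_succ]; nlinarith
  | ren ρ _ ih =>
    obtain ⟨c, hc⟩ := ih
    exact ⟨c, fun σ M h => hc _ M fun j => h _⟩
  | bind _ _ ih1 ih2 =>
    obtain ⟨c, hc⟩ := ih1
    obtain ⟨d, hd⟩ := ih2
    refine ⟨(d + 1 + 2) * c, fun σ M h => ?_⟩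
    refine le_trans (hc _ ((M + 2) ^ (d + 1)) (push_le ?_ fun j => ?_)) (pow_add_two_le le_rfl)
    · exact le_trans (hd σ M h) (Nat.pow_le_pow_right (by omega) (by omega))
    · exact le_trans (h j) (le_pow (by omega))
  | prec c _ _ _ hb _ _ _ => exact ⟨c, fun σ M h => hb σ M h _ le_rfl⟩

theorem of_eq (hf : LinSpace f) (h : ∀ σ, f σ = g σ) : LinSpace g := funext h ▸ hf

/-- Replaces the explicit exponent in the side condition of `prec` by a majorant that is already
known to be in `LinSpace`. -/
theorem prec_of_le (hn : LinSpace n) (hi : LinSpace i) (hs : LinSpace s) {b : (ℕ → ℕ) → ℕ}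
    (hb : LinSpace b) (h : ∀ σ, ∀ t ≤ n σ, primRec i s σ t ≤ b σ) :
    LinSpace fun σ => primRec i s σ (n σ) := by
  obtain ⟨c, hc⟩ := hb.exists_bound
  exact prec c hn hi hs fun σ M hM t ht => (h σ t ht).trans (hc σ M hM)

theorem weaken (hf : LinSpace f) : LinSpace fun σ => f fun i => σ (i + 1) := hf.ren _

theorem const : ∀ k : ℕ, LinSpace fun _ => k
  | 0 => zero
  | k + 1 => (const k).succ

theorem comp₁ {F : ℕ → ℕ} (hF : LinSpace fun σ => F (σ 0)) (hf : LinSpace f) :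
    LinSpace fun σ => F (f σ) := hF.bind hf

/-- The last argument is bound outermost and becomes variable `0` for the others, which must
therefore be weakened. -/
theorem comp₂ {F : ℕ → ℕ → ℕ} (hF : LinSpace fun σ => F (σ 0) (σ 1)) (hf : LinSpace f)
    (hg : LinSpace g) : LinSpace fun σ => F (f σ) (g σ) :=
  (hF.bind hf.weaken).bind hg

theorem comp₃ {F : ℕ → ℕ → ℕ → ℕ} (hF : LinSpace fun σ => F (σ 0) (σ 1) (σ 2)) (hf : LinSpace f)
    (hg : LinSpace g) (hh : LinSpace h) : LinSpace fun σ => F (f σ) (g σ) (h σ) :=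
  ((hF.bind hf.weaken.weaken).bind hg.weaken).bind hh

theorem add (hf : LinSpace f) (hg : LinSpace g) : LinSpace fun σ => f σ + g σ := by
  have key : ∀ (σ : ℕ → ℕ) t, primRec (fun σ => σ 0) (fun σ => σ 0 + 1) σ t = σ 0 + t := by
    intro σ t
    induction t with
    | zero => rfl
    | succ t ih => simp [ih, add_assoc]
  refine comp₂ (F := fun a b => a + b) ?_ hf hg
  refine (prec 2 (var 1) (var 0) (var 0).succ fun σ M hM t ht => ?_).of_eq fun σ => key σ _
  rw [key]
  have := hM 0; have := hM 1
  nlinarith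

theorem pred (hf : LinSpace f) : LinSpace fun σ => f σ - 1 := by
  have key : ∀ (σ : ℕ → ℕ) t, primRec (fun _ => 0) (fun σ => σ 1) σ t = t - 1 := by
    intro σ t
    cases t <;> simp
  refine comp₁ (F := fun a => a - 1) ?_ hf
  refine (prec 1 (var 0) zero (var 1) fun σ M hM t ht => ?_).of_eq fun σ => key σ _
  rw [key]
  have := hM 0
  rw [pow_one]; omega

theorem sub (hf : LinSpace f) (hg : LinSpace g) : LinSpace fun σ => f σ - g σ := by
  have key : ∀ (σ : ℕ → ℕ) t, primRec (fun σ => σ 0) (fun σ => σ 0 - 1) σ t = σ 0 - t := by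
    intro σ t
    induction t with
    | zero => rfl
    | succ t ih => simp [ih, Nat.sub_sub]
  refine comp₂ (F := fun a b => a - b) ?_ hf hg
  refine (prec 1 (var 1) (var 0) (var 0).pred fun σ M hM t ht => ?_).of_eq fun σ => key σ _
  rw [key]
  have := hM 0
  rw [pow_one]; omega

theorem mul (hf : LinSpace f) (hg : LinSpace g) : LinSpace fun σ => f σ * g σ := by
  have key : ∀ (σ : ℕ → ℕ) t, primRec (fun _ => 0) (fun σ => σ 0 + σ 2) σ t = σ 0 * t := by
    intro σ t
    induction t with
    | zero => rfl
    | succ t ih => simp [ih, mul_add]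
  refine comp₂ (F := fun a b => a * b) ?_ hf hg
  refine (prec 2 (var 1) zero ((var 0).add (var 2)) fun σ M hM t ht => ?_).of_eq fun σ => key σ _
  rw [key]
  have := hM 0; have := hM 1
  nlinarith [Nat.mul_le_mul (hM 0) (ht.trans (hM 1))]

/-- A case distinction is a recursion on the tested number whose step ignores the accumulator. Two
values stand in front of the environment in the step, so the third argument has index `4` there. -/
theorem ite_zero (hf : LinSpace f) (hg : LinSpace g) (hh : LinSpace h) :
    LinSpace fun σ => if f σ = 0 then g σ else h σ := by
  have key : ∀ (σ : ℕ → ℕ) t, primRec (fun σ => σ 1) (fun σ => σ 4) σ t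
      = if t = 0 then σ 1 else σ 2 := by
    intro σ t
    cases t <;> simp [primRec]
  refine comp₃ (F := fun a b c => if a = 0 then b else c) ?_ hf hg hh
  refine (prec 1 (var 0) (var 1) (var 4) fun σ M hM t ht => ?_).of_eq fun σ => key σ _
  rw [key]
  have := hM 1; have := hM 2
  rw [pow_one]; split_ifs <;> omega

theorem ite_le {a b : (ℕ → ℕ) → ℕ} (ha : LinSpace a) (hb : LinSpace b) (hg : LinSpace g)
    (hh : LinSpace h) : LinSpace fun σ => if a σ ≤ b σ then g σ else h σ :=
  (ite_zero (ha.sub hb) hg hh).of_eq fun σ => by simp [Nat.sub_eq_zero_iff_le]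

theorem ite_lt {a b : (ℕ → ℕ) → ℕ} (ha : LinSpace a) (hb : LinSpace b) (hg : LinSpace g)
    (hh : LinSpace h) : LinSpace fun σ => if a σ < b σ then g σ else h σ :=
  (ite_le ha.succ hb hg hh).of_eq fun σ => by simp

theorem ite_eq {a b : (ℕ → ℕ) → ℕ} (ha : LinSpace a) (hb : LinSpace b) (hg : LinSpace g)
    (hh : LinSpace h) : LinSpace fun σ => if a σ = b σ then g σ else h σ :=
  (ite_le ha hb (ite_le hb ha hg hh) hh).of_eq fun σ => by
    split_ifs <;> first | rfl | omega

theorem mod (hf : LinSpace f) (hg : LinSpace g) : LinSpace fun σ => f σ % g σ := by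
  have key : ∀ (σ : ℕ → ℕ) t, primRec (fun _ => 0)
      (fun σ => if σ 0 + 1 = σ 3 then 0 else σ 0 + 1) σ t = t % σ 1 := by
    intro σ t
    induction t with
    | zero => simp
    | succ t ih =>
      rw [primRec_succ]
      simp only [push_zero, push_three, push_two, ih]
      rw [Nat.add_mod]
      -- Modulus `0` never resets the counter, in accordance with `t % 0 = t`, and modulus `1`
      -- always does.
      rcases Nat.lt_or_ge (σ 1) 2 with h1 | h1
      · interval_cases hv : σ 1 <;> simp [Nat.mod_one]
      · rw [Nat.mod_eq_of_lt h1]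
        have := Nat.mod_lt t (by omega : 0 < σ 1)
        rcases eq_or_lt_of_le (show t % σ 1 + 1 ≤ σ 1 by omega) with h2 | h2
        · simp [h2]
        · rw [if_neg (by omega), Nat.mod_eq_of_lt h2]
  refine comp₂ (F := fun a b => a % b) ?_ hf hg
  refine (prec_of_le (var 0) zero (ite_eq (var 0).succ (var 3) zero (var 0).succ) (var 0)
    fun σ t ht => ?_).of_eq fun σ => key σ _
  rw [key]
  exact (Nat.mod_le _ _).trans ht

theorem div (hf : LinSpace f) (hg : LinSpace g) : LinSpace fun σ => f σ / g σ := by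
  have key : ∀ (σ : ℕ → ℕ) t, primRec (fun _ => 0)
      (fun σ => if (σ 1 + 1) % σ 3 = 0 then σ 0 + 1 else σ 0) σ t = t / σ 1 := by
    intro σ t
    induction t with
    | zero => simp
    | succ t ih =>
      rw [primRec_succ]
      simp only [push_zero, push_three, push_two, push_one, ih, Nat.succ_div, Nat.dvd_iff_mod_eq_zero]
      split_ifs <;> rfl
  refine comp₂ (F := fun a b => a / b) ?_ hf hg
  refine (prec_of_le (var 0) zero (ite_zero ((var 1).succ.mod (var 3)) (var 0).succ (var 0)) (var 0)
    fun σ t ht => ?_).of_eq fun σ => key σ _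
  rw [key]
  exact (Nat.div_le_self _ _).trans ht

/-- Needed for unpairing. The root of `y + 1` is that of `y`, or one more if the next square has
been reached. -/
theorem sqrt (hf : LinSpace f) : LinSpace fun σ => Nat.sqrt (f σ) := by
  have key : ∀ (σ : ℕ → ℕ) t, primRec (fun _ => 0)
      (fun σ => if (σ 0 + 1) * (σ 0 + 1) ≤ σ 1 + 1 then σ 0 + 1 else σ 0) σ t = Nat.sqrt t := by
    intro σ t
    induction t with
    | zero => simp
    | succ t ih =>
      rw [primRec_succ]
      simp only [push_zero, push_one, ih]
      have h1 := Nat.sqrt_le t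
      have h2 := Nat.lt_succ_sqrt t
      rw [Nat.succ_eq_add_one] at h2
      refine Nat.eq_sqrt.2 ?_
      split_ifs with h <;> constructor <;> nlinarith
  refine comp₁ (F := fun a => Nat.sqrt a) ?_ hf
  refine (prec_of_le (var 0) zero (ite_le ((var 0).succ.mul (var 0).succ) (var 1).succ
    (var 0).succ (var 0)) (var 0) fun σ t ht => ?_).of_eq fun σ => key σ _
  rw [key]
  exact (Nat.sqrt_le_self _).trans ht

theorem pair (hf : LinSpace f) (hg : LinSpace g) : LinSpace fun σ => Nat.pair (f σ) (g σ) :=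
  ite_lt hf hg ((hg.mul hg).add hf) (((hf.mul hf).add hf).add hg)

theorem fst (hf : LinSpace f) : LinSpace fun σ => (f σ).unpair.1 := by
  refine (ite_lt (hf.sub (hf.sqrt.mul hf.sqrt)) hf.sqrt (hf.sub (hf.sqrt.mul hf.sqrt))
    hf.sqrt).of_eq fun σ => ?_
  unfold Nat.unpair
  by_cases h : f σ - (f σ).sqrt * (f σ).sqrt < (f σ).sqrt <;> simp [h]

theorem snd (hf : LinSpace f) : LinSpace fun σ => (f σ).unpair.2 := by
  refine (ite_lt (hf.sub (hf.sqrt.mul hf.sqrt)) hf.sqrt hf.sqrt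
    ((hf.sub (hf.sqrt.mul hf.sqrt)).sub hf.sqrt)).of_eq fun σ => ?_
  unfold Nat.unpair
  by_cases h : f σ - (f σ).sqrt * (f σ).sqrt < (f σ).sqrt <;> simp [h]

/-- Recursion whose step does not see the recursion variable; the renaming in the proof skips index
`1`, where it stands. -/
theorem iterate (hn : LinSpace n) (hi : LinSpace i) (hs : LinSpace s) {b : (ℕ → ℕ) → ℕ}
    (hb : LinSpace b) (h : ∀ σ, ∀ t ≤ n σ, (fun a => s (push a σ))^[t] (i σ) ≤ b σ) :
    LinSpace fun σ => (fun a => s (push a σ))^[n σ] (i σ) := by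
  have key : ∀ σ t, primRec i (fun σ => s fun j => σ (match j with | 0 => 0 | j + 1 => j + 2)) σ t
      = (fun a => s (push a σ))^[t] (i σ) := by
    intro σ t
    induction t with
    | zero => rfl
    | succ t ih =>
      rw [Function.iterate_succ_apply', ← ih, primRec_succ]
      congr 1
      funext j
      cases j <;> rfl
  exact (prec_of_le hn hi (hs.ren _) hb fun σ t ht => (key σ t).trans_le (h σ t ht)).of_eq
    fun σ => key σ _

end LinSpace

/-- The first non-zero value among `F 0, …, F (n - 1)`, or `0` if there is none. -/
def firstValue (F : ℕ → ℕ) (n : ℕ) : ℕ :=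
  Nat.rec 0 (fun y IH => if IH = 0 then F y else IH) n

theorem firstValue_succ (F : ℕ → ℕ) (n : ℕ) :
    firstValue F (n + 1) = if firstValue F n = 0 then F n else firstValue F n := rfl

theorem firstValue_eq_zero {F : ℕ → ℕ} {n : ℕ} : firstValue F n = 0 ↔ ∀ y < n, F y = 0 := by
  induction n with
  | zero => simp [firstValue]
  | succ n ih =>
    rw [firstValue_succ, Nat.forall_lt_succ_right, ← ih]
    split_ifs with h <;> simp [h]

theorem firstValue_eq {F : ℕ → ℕ} {n y : ℕ} (hy : y < n) (h : F y ≠ 0) (h' : ∀ z < y, F z = 0) :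
    firstValue F n = F y := by
  induction n with
  | zero => omega
  | succ n ih =>
    rw [firstValue_succ]
    rcases Nat.lt_succ_iff_lt_or_eq.1 hy with h1 | rfl
    · rw [ih h1, if_neg h]
    · rw [if_pos (firstValue_eq_zero.2 h')]

theorem exists_firstValue {F : ℕ → ℕ} {n : ℕ} (h : firstValue F n ≠ 0) :
    ∃ y < n, F y = firstValue F n ∧ ∀ z < y, F z = 0 := by
  induction n with
  | zero => simp [firstValue] at h
  | succ n ih =>
    rw [firstValue_succ] at h ⊢
    split_ifs with h1
    · exact ⟨n, by omega, rfl, firstValue_eq_zero.1 h1⟩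
    · obtain ⟨y, hy, h2⟩ := ih h1
      exact ⟨y, by omega, h2⟩

/-- Bounded search stays polynomial because its result is `0` or one of the values of `F` at
arguments below `n`; the exponent is that of this composition. -/
theorem LinSpace.firstValue {n : (ℕ → ℕ) → ℕ} (hn : LinSpace n) {F : (ℕ → ℕ) → ℕ → ℕ}
    (hF : LinSpace fun σ => F (fun i => σ (i + 1)) (σ 0)) :
    LinSpace fun σ => TuringSpace.firstValue (F σ) (n σ) := by
  have key : ∀ σ t, primRec (fun _ => 0)
      (fun σ => if σ 0 = 0 then F (fun i => σ (i + 2)) (σ 1) else σ 0) σ t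
      = TuringSpace.firstValue (F σ) t := by
    intro σ t
    induction t with
    | zero => rfl
    | succ t ih => rw [primRec_succ, firstValue_succ, ← ih]; rfl
  obtain ⟨c, hc⟩ := hF.exists_bound
  obtain ⟨d, hd⟩ := hn.exists_bound
  refine (LinSpace.prec ((d + 1 + 2) * c) hn zero (ite_zero (var 0) (hF.ren (· + 1)) (var 0))
    fun σ M hM t ht => ?_).of_eq fun σ => key σ _
  rw [show (fun σ : ℕ → ℕ => if σ 0 = 0 then F (fun i => σ (i + 1 + 1)) (σ (0 + 1)) else σ 0)
    = (fun σ => if σ 0 = 0 then F (fun i => σ (i + 2)) (σ 1) else σ 0) from rfl, key]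
  by_cases h : TuringSpace.firstValue (F σ) t = 0
  · simp [h]
  · obtain ⟨y, hy, h1, -⟩ := exists_firstValue h
    rw [← h1]
    refine le_trans (hc (push y σ) ((M + 2) ^ (d + 1)) (push_le ?_ fun j => ?_)) (pow_add_two_le le_rfl)
    · exact le_trans (by omega) ((hd σ M hM).trans (Nat.pow_le_pow_right (by omega) (by omega)))
    · exact le_trans (hM j) (le_pow (by omega))

/-- This is used for the computability of `G`. Environments are infinite sequences without a
`Primcodable` structure, so they are presented as a family of primitive recursive coordinates. -/
theorem LinSpace.primrec {f : (ℕ → ℕ) → ℕ} (hf : LinSpace f) {α : Type} [Primcodable α]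
    {g : ℕ → α → ℕ} (hg : ∀ i, Primrec (g i)) : Primrec fun a => f fun i => g i a := by
  induction hf generalizing α with
  | zero => exact Primrec.const 0
  | var i => exact hg i
  | succ _ ih => exact Primrec.succ.comp (ih hg)
  | ren ρ _ ih => exact ih fun i => hg (ρ i)
  | @bind f g' _ _ ih1 ih2 =>
    have h : ∀ i, Primrec fun a => push (g' fun i => g i a) (fun i => g i a) i := by
      intro i
      cases i with
      | zero => exact ih2 hg
      | succ i => exact hg i
    exact ih1 h
  | @prec n i s c _ _ _ _ ihn ihi ihs =>
    have h : ∀ j, Primrec fun p : α × ℕ × ℕ =>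
        push p.2.2 (push p.2.1 fun i => g i p.1) j := by
      intro j
      match j with
      | 0 => exact Primrec.snd.comp Primrec.snd
      | 1 => exact Primrec.fst.comp Primrec.snd
      | j + 2 => exact (hg j).comp Primrec.fst
    exact Primrec.nat_rec' (ihn hg) (ihi hg) (h := fun a p => s (push p.2 (push p.1 fun i => g i a)))
      (ihs h)

end TuringSpace

/-! ### Counter programs, and compilation of `LinSpace` functions to them -/

namespace TuringSpace

/-- Programs of a machine whose tape holds an area with several tracks, each track containing a
number, followed by a raw numeral. The tracks are numbered; track `0` counts the cells of the
area. -/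
inductive Prog : Type
  /-- do nothing -/
  | skip
  /-- increase a track -/
  | inc (t : ℕ)
  /-- decrease a track -/
  | dec (t : ℕ)
  /-- sequential composition -/
  | seq (p q : Prog)
  /-- repeat while a track is not zero -/
  | loop (t : ℕ) (p : Prog)
  /-- test whether the number on a track has more than one digit -/
  | ifBig (t : ℕ) (p q : Prog)
  /-- count the raw numeral down to zero, and erase it -/
  | loopRaw (p : Prog)
  /-- append a zero to the raw numeral -/
  | append
  /-- increase the raw numeral -/
  | incRaw
  /-- enlarge the area by one cell -/
  | grow
  /-- halt with the first digit of a track as the output -/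
  | finishDigit (t : ℕ)
  /-- halt with the raw numeral as the output -/
  | finishWord

/-- `Exec V m p σ σ'`: the counter program `p`, using tracks below `m`, changes the contents of the
registers from `σ` to `σ'`, and all numbers occurring are at most `V`. Register `r` is held on
track `r + 1`. -/
inductive Exec (V m : ℕ) : Prog → (ℕ → ℕ) → (ℕ → ℕ) → Prop
  | inc {r σ} : r + 1 < m → σ r + 1 ≤ V →
      Exec V m (.inc (r + 1)) σ (Function.update σ r (σ r + 1))
  | dec {r σ k} : r + 1 < m → σ r = k + 1 →
      Exec V m (.dec (r + 1)) σ (Function.update σ r k)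
  | seq {p q σ₁ σ₂ σ₃} : Exec V m p σ₁ σ₂ → Exec V m q σ₂ σ₃ → Exec V m (.seq p q) σ₁ σ₃
  | loop_zero {r p σ} : r + 1 < m → σ r = 0 → Exec V m (.loop (r + 1) p) σ σ
  | loop_succ {r p σ₁ σ₂ σ₃} : r + 1 < m → σ₁ r ≠ 0 → Exec V m p σ₁ σ₂ →
      Exec V m (.loop (r + 1) p) σ₂ σ₃ → Exec V m (.loop (r + 1) p) σ₁ σ₃

namespace Exec

variable {V m : ℕ} {p q : Prog} {σ τ : ℕ → ℕ}

theorem mono_tracks {m' : ℕ} (h : Exec V m p σ τ) (hm : m ≤ m') : Exec V m' p σ τ := by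
  induction h with
  | inc h1 h2 => exact .inc (by omega) h2
  | dec h1 h2 => exact .dec (by omega) h2
  | seq _ _ ih1 ih2 => exact ih1.seq ih2
  | loop_zero h1 h2 => exact .loop_zero (by omega) h2
  | loop_succ h1 h2 _ _ ih1 ih2 => exact .loop_succ (by omega) h2 ih1 ih2

theorem cast {τ' : ℕ → ℕ} (h : Exec V m p σ τ) (e : τ = τ') : Exec V m p σ τ' := e ▸ h

/-- The rule by which loops are verified: `τ k` is the register content at the `k`-th test. -/
theorem loop_of_chain {r : ℕ} (hr : r + 1 < m) (τ : ℕ → ℕ → ℕ) (n : ℕ)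
    (h : ∀ k < n, τ k r ≠ 0 ∧ Exec V m p (τ k) (τ (k + 1))) (hn : τ n r = 0) :
    Exec V m (.loop (r + 1) p) (τ 0) (τ n) := by
  induction n generalizing τ with
  | zero => exact .loop_zero hr hn
  | succ n ih =>
    exact .loop_succ hr (h 0 (by omega)).1 (h 0 (by omega)).2
      (ih (fun k => τ (k + 1)) (fun k hk => h (k + 1) (by omega)) hn)

end Exec

/-- The program that sets a register to zero. -/
def Prog.clear (a : ℕ) : Prog := .loop (a + 1) (.dec (a + 1))

/-- The program that adds the contents of a register to another, and clears it. -/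
def Prog.move (a b : ℕ) : Prog := .loop (a + 1) (.seq (.dec (a + 1)) (.inc (b + 1)))

/-- The program that adds the contents of a register to another. -/
def Prog.copy (a b t : ℕ) : Prog :=
  .seq (.loop (a + 1) (.seq (.dec (a + 1)) (.seq (.inc (b + 1)) (.inc (t + 1))))) (.move t a)

namespace Exec

variable {V m : ℕ} {p q : Prog} {σ : ℕ → ℕ}

theorem clear {a : ℕ} (ha : a + 1 < m) : Exec V m (.clear a) σ (Function.update σ a 0) := by
  have := loop_of_chain (V := V) (p := .dec (a + 1)) ha (fun k => Function.update σ a (σ a - k)) (σ a)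
    (fun k hk => ⟨by simp; omega, (Exec.dec (k := σ a - k - 1) ha (by simp; omega)).cast (by
      simp [Nat.sub_sub])⟩) (by simp)
  simpa [Prog.clear] using this

theorem move {a b : ℕ} (ha : a + 1 < m) (hb : b + 1 < m) (hab : a ≠ b) (hV : σ b + σ a ≤ V) :
    Exec V m (.move a b) σ (Function.update (Function.update σ b (σ b + σ a)) a 0) := by
  have := loop_of_chain (V := V) (p := .seq (.dec (a + 1)) (.inc (b + 1))) ha
    (fun k => Function.update (Function.update σ b (σ b + k)) a (σ a - k)) (σ a)
    (fun k hk => ⟨by simp; omega, (Exec.seq (Exec.dec (k := σ a - k - 1) ha (by simp; omega))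
      (Exec.inc hb (by simp [hab.symm]; omega))).cast (by
      funext r
      by_cases h1 : r = a
      · subst h1; simp [hab, Nat.sub_sub]
      by_cases h2 : r = b
      · subst h2; simp [hab.symm]; omega
      simp [h1, h2])⟩) (by simp)
  simpa [Prog.move] using this

theorem copy {a b t : ℕ} (ha : a + 1 < m) (hb : b + 1 < m) (ht : t + 1 < m) (hab : a ≠ b)
    (hat : a ≠ t) (hbt : b ≠ t) (hV : σ b + σ a ≤ V) (h0 : σ t = 0) :
    Exec V m (.copy a b t) σ (Function.update σ b (σ b + σ a)) := by
  have := loop_of_chain (V := V)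
    (p := .seq (.dec (a + 1)) (.seq (.inc (b + 1)) (.inc (t + 1)))) ha
    (fun k => Function.update (Function.update (Function.update σ b (σ b + k)) a (σ a - k)) t k) (σ a)
    (fun k hk => ⟨by simp [hat]; omega, (Exec.seq (Exec.dec (k := σ a - k - 1) ha
      (by simp [hat]; omega)) (Exec.seq (Exec.inc hb (by simp [hab.symm, hbt]; omega))
      (Exec.inc ht (by simp [hbt.symm, hat.symm]; omega)))).cast (by
      funext r
      by_cases h1 : r = a
      · subst h1; simp [hab, hat, Nat.sub_sub]
      by_cases h2 : r = b
      · subst h2; simp [hab.symm, hbt]; omega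
      by_cases h3 : r = t
      · subst h3; simp [hat.symm, hbt.symm]
      simp [h1, h2, h3])⟩) (by simp [hat])
  have e : Function.update (Function.update (Function.update σ b (σ b + 0)) a (σ a - 0)) t 0 = σ := by
    funext r
    by_cases h1 : r = t
    · subst h1; simp [h0]
    simp [h1]
  rw [e] at this
  refine (Exec.seq this (move ht ha hat.symm (by simp [hat]; omega))).cast ?_
  funext r
  by_cases h1 : r = a
  · subst h1; simp [hab, hat]
  by_cases h3 : r = t
  · subst h3; simp [hbt.symm, h0]
  by_cases h2 : r = b
  · subst h2; simp [hab.symm, hbt]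
  simp [h1, h2, h3]

end Exec

/-- Variable `i` lives in register `ρ i`, the result goes to `o`, and all registers from `s` on are
free. They are zero at the start and are cleared again, so only `o` changes and subprograms can be
nested by raising `s`. The exponent `c` accounts for every number that occurs on the way, not only
for the result. -/
theorem LinSpace.compile {f : (ℕ → ℕ) → ℕ} (hf : LinSpace f) :
    ∀ (ρ : ℕ → ℕ) (o s : ℕ), (∀ i, ρ i < s) → o < s → (∀ i, ρ i ≠ o) →
      ∃ p m c, ∀ σ M V, (∀ r ≥ s, σ r = 0) → σ o = 0 → (∀ i, σ (ρ i) ≤ M) → (M + 2) ^ c ≤ V →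
        Exec V m p σ (Function.update σ o (f fun i => σ (ρ i))) := by
  have mono : ∀ {M a b V : ℕ}, (M + 2) ^ b ≤ V → a ≤ b → (M + 2) ^ a ≤ V := fun h hab =>
    (Nat.pow_le_pow_right (by omega) hab).trans h
  induction hf with
  | zero =>
    intro ρ o s hρ ho hne
    exact ⟨.clear o, o + 2, 0, fun σ M V hs h0 hM hV => Exec.clear (by omega)⟩
  | var i =>
    intro ρ o s hρ ho hne
    refine ⟨.copy (ρ i) o s, s + 2, 1, fun σ M V hs h0 hM hV => ?_⟩
    have := hρ i
    have := hM i
    refine (Exec.copy (by omega) (by omega) (by omega) (hne i) (by omega) (by omega) ?_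
      (hs s le_rfl)).cast (by rw [h0, zero_add])
    rw [pow_one] at hV; omega
  | @succ f hf ih =>
    intro ρ o s hρ ho hne
    obtain ⟨p, m, c, h⟩ := ih ρ o s hρ ho hne
    obtain ⟨d, hd⟩ := hf.exists_bound
    refine ⟨.seq p (.inc (o + 1)), m + o + 2, c + d + 1, fun σ M V hs h0 hM hV => ?_⟩
    refine (((h σ M V hs h0 hM (mono hV (by omega))).mono_tracks (by omega)).seq
      (.inc (by omega) ?_)).cast (by simp)
    have h1 := hd (fun i => σ (ρ i)) M hM
    have h2 : (M + 2) ^ d + 1 ≤ (M + 2) ^ (d + 1) := by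
      have : 1 ≤ (M + 2) ^ d := Nat.one_le_pow _ _ (by omega)
      rw [pow_succ]; nlinarith
    have h3 := mono hV (show d + 1 ≤ c + d + 1 by omega)
    simp only [Function.update_self]
    omega
  | @ren f ρ' hf ih =>
    intro ρ o s hρ ho hne
    obtain ⟨p, m, c, h⟩ := ih (fun i => ρ (ρ' i)) o s (fun i => hρ _) ho fun i => hne _
    exact ⟨p, m, c, fun σ M V hs h0 hM hV => h σ M V hs h0 (fun i => hM _) hV⟩
  | @bind f g hf hg ihf ihg =>
    intro ρ o s hρ ho hne
    obtain ⟨p, m, c, h⟩ := ihg ρ s (s + 1) (fun i => (hρ i).trans (by omega)) (by omega)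
      fun i => (hρ i).ne
    obtain ⟨p', m', c', h'⟩ := ihf (push s ρ) o (s + 1)
      (by rintro (_ | i); exacts [Nat.lt_succ_self s, (hρ i).trans (by omega)]) (by omega)
      (by rintro (_ | i); exacts [fun e => absurd (show s = o from e) (by omega), hne i])
    obtain ⟨d, hd⟩ := hg.exists_bound
    -- Register `s` holds the inner value, which is at most `(M + 2) ^ (d + 1)`. This is the bound
    -- on variables under which the outer function runs, hence the product of exponents.
    refine ⟨.seq p (.seq p' (.clear s)), m + m' + s + 2, c + (d + 1 + 2) * c',
      fun σ M V hs h0 hM hV => ?_⟩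
    have h1 := h σ M V (fun r hr => hs r (by omega)) (hs s le_rfl) hM (mono hV (by omega))
    set τ := Function.update σ s (g fun i => σ (ρ i)) with hτ
    have e : (fun i => τ (push s ρ i)) = push (g fun i => σ (ρ i)) fun i => σ (ρ i) := by
      funext i
      cases i with
      | zero => simp [hτ]
      | succ i => simp [hτ, (hρ i).ne]
    have h2 := h' τ ((M + 2) ^ (d + 1)) V (fun r hr => by
        rw [hτ, Function.update_of_ne (by omega)]; exact hs r (by omega))
      (by rw [hτ, Function.update_of_ne (by omega)]; exact h0)
      (fun i => by
        rw [show τ (push s ρ i) = _ from congrFun e i]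
        refine push_le ((hd _ M hM).trans (Nat.pow_le_pow_right (by omega) (by omega))) (fun j => ?_) i
        exact (hM j).trans (LinSpace.le_pow (by omega)))
      ((LinSpace.pow_add_two_le le_rfl).trans (mono hV (by omega)))
    rw [e] at h2
    refine ((h1.mono_tracks (by omega)).seq ((h2.mono_tracks (by omega)).seq
      (Exec.clear (by omega)))).cast ?_
    funext r
    by_cases h1 : r = s
    · subst h1; simp [(show r ≠ o by omega), hs r le_rfl]
    by_cases h2 : r = o
    · subst h2; simp [h1]
    simp [h1, h2, hτ]
  | @prec n i s' c hn hi hs' hb ihn ihi ihs =>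
    intro ρ o s hρ ho hne
    obtain ⟨pn, mn, cn, hpn⟩ := ihn ρ s (s + 1) (fun i => (hρ i).trans (by omega)) (by omega)
      fun i => (hρ i).ne
    obtain ⟨pi, mi, ci, hpi⟩ := ihi ρ (s + 2) (s + 3) (fun i => (hρ i).trans (by omega)) (by omega)
      fun i => ((hρ i).trans (by omega)).ne
    obtain ⟨ps, ms, cs, hps⟩ := ihs (push (s + 2) (push (s + 1) ρ)) (s + 3) (s + 4)
      (by
        rintro (_ | _ | i)
        exacts [show s + 2 < s + 4 by omega, show s + 1 < s + 4 by omega, (hρ i).trans (by omega)])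
      (by omega)
      (by
        rintro (_ | _ | i)
        exacts [show s + 2 ≠ s + 3 by omega, show s + 1 ≠ s + 3 by omega,
          ((hρ i).trans (by omega)).ne])
    obtain ⟨d, hd⟩ := hn.exists_bound
    refine ⟨.seq pn (.seq pi (.seq (.loop (s + 1) (.seq (.dec (s + 1)) (.seq ps (.seq (.clear (s + 2))
      (.seq (.move (s + 3) (s + 2)) (.inc (s + 1 + 1))))))) (.seq (.move (s + 2) o) (.clear (s + 1))))),
      mn + mi + ms + s + 5, cn + ci + (c + d + 1 + 2) * cs + c + d, fun σ M V hs h0 hM hV => ?_⟩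
    set N := n fun i => σ (ρ i) with hN
    set v := fun k => primRec i s' (fun i => σ (ρ i)) k with hv
    have hNM : N ≤ (M + 2) ^ d := hd _ M hM
    have hvM : ∀ k ≤ N, v k ≤ (M + 2) ^ c := fun k hk => hb _ M hM k hk
    have hdV := mono hV (show d ≤ cn + ci + (c + d + 1 + 2) * cs + c + d by omega)
    have hcV := mono hV (show c ≤ cn + ci + (c + d + 1 + 2) * cs + c + d by omega)
    -- Before pass `k`, register `s` counts the remaining passes, `s + 1` holds the recursion
    -- variable and `s + 2` the accumulator. The step writes its result to `s + 3`, from where it is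
    -- moved back.
    let τ : ℕ → ℕ → ℕ := fun k => Function.update (Function.update (Function.update σ s (N - k))
      (s + 1) k) (s + 2) (v k)
    have τ0 : ∀ k, τ k s = N - k := fun k => by simp [τ]
    have τ1 : ∀ k, τ k (s + 1) = k := fun k => by simp [τ]
    have τ2 : ∀ k, τ k (s + 2) = v k := fun k => by simp [τ]
    have τr : ∀ k r, r < s ∨ s + 2 < r → τ k r = σ r := fun k r hr => by
      simp only [τ]
      rw [Function.update_of_ne (by omega), Function.update_of_ne (by omega),
        Function.update_of_ne (by omega)]
    have h1 := hpn σ M V (fun r hr => hs r (by omega)) (hs s le_rfl) hM (mono hV (by omega))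
    have h2 := hpi (Function.update σ s N) M V (fun r hr => by
        rw [Function.update_of_ne (by omega)]; exact hs r (by omega))
      (by rw [Function.update_of_ne (by omega)]; exact hs _ (by omega))
      (fun i => by rw [Function.update_of_ne (hρ i).ne]; exact hM i) (mono hV (by omega))
    have e2 : Function.update (Function.update σ s N) (s + 2)
        (i fun j => Function.update σ s N (ρ j)) = τ 0 := by
      have : (fun j => Function.update σ s N (ρ j)) = fun j => σ (ρ j) := by
        funext j; rw [Function.update_of_ne (hρ j).ne]
      rw [this]
      funext r
      by_cases h1 : r = s + 2
      · subst h1; simp [τ2, hv]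
      by_cases h2 : r = s + 1
      · subst h2; simp [τ1, hs]
      by_cases h3 : r = s
      · subst h3; simp [τ0]
      · rw [τr _ _ (by omega), Function.update_of_ne h1, Function.update_of_ne h3]
    rw [e2] at h2
    have h3 : ∀ k < N, Exec V (mn + mi + ms + s + 5) (.seq (.dec (s + 1)) (.seq ps (.seq (.clear (s + 2))
      (.seq (.move (s + 3) (s + 2)) (.inc (s + 1 + 1)))))) (τ k) (τ (k + 1)) := by
      intro k hk
      let τ' := Function.update (τ k) s (N - (k + 1))
      have τ'r : ∀ r, r ≠ s → τ' r = τ k r := fun r hr => Function.update_of_ne hr _ _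
      have e : (fun j => τ' (push (s + 2) (push (s + 1) ρ) j))
          = push (v k) (push k fun j => σ (ρ j)) := by
        funext j
        match j with
        | 0 => exact (τ'r (s + 2) (by omega)).trans (τ2 k)
        | 1 => exact (τ'r (s + 1) (by omega)).trans (τ1 k)
        | j + 2 => exact (τ'r _ (hρ j).ne).trans (τr _ _ (Or.inl (hρ j)))
      have hE : (M + 2) ^ d ≤ (M + 2) ^ (c + d + 1) := Nat.pow_le_pow_right (by omega) (by omega)
      have hE' : (M + 2) ^ c ≤ (M + 2) ^ (c + d + 1) := Nat.pow_le_pow_right (by omega) (by omega)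
      have := hvM k hk.le
      have h4 := hps τ' ((M + 2) ^ (c + d + 1)) V (fun r hr => by
          rw [τ'r _ (by omega), τr _ _ (by omega)]; exact hs _ (by omega))
        (by rw [τ'r _ (by omega), τr _ _ (by omega)]; exact hs _ (by omega))
        (fun j => by
          rw [show τ' (push (s + 2) (push (s + 1) ρ) j) = _ from congrFun e j]
          refine push_le (by omega) (push_le (by omega) fun j => ?_) j
          exact (hM j).trans (LinSpace.le_pow (by omega)))
        ((LinSpace.pow_add_two_le le_rfl).trans (mono hV (by omega)))
      rw [e] at h4
      change Exec V ms ps τ' (Function.update τ' (s + 3) (v (k + 1))) at h4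
      have := hvM (k + 1) hk
      refine (Exec.seq (Exec.dec (k := N - (k + 1)) (by omega) (by rw [τ0]; omega))
        ((h4.mono_tracks (by omega)).seq ((Exec.clear (by omega)).seq
        ((Exec.move (by omega) (by omega) (by omega) (by simp; omega)).seq
        (Exec.inc (by omega) ?_))))).cast ?_
      · rw [Function.update_of_ne (by omega), Function.update_of_ne (by omega),
          Function.update_of_ne (by omega), Function.update_of_ne (by omega), τ'r _ (by omega), τ1]
        omega
      · funext r
        by_cases h1 : r = s + 2
        · subst h1; simp [τ2]
        by_cases h2 : r = s + 1
        · subst h2; simp [τ1, τ'r]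
        by_cases h3 : r = s
        · subst h3; simp [τ0, τ']
        by_cases h4 : r = s + 3
        · subst h4; rw [τr _ _ (by omega), hs _ (by omega)]; simp
        rw [τr _ _ (by omega)]
        simp [h1, h2, h3, h4, τ', τr _ _ (show r < s ∨ s + 2 < r by omega)]
    have h5 := Exec.loop_of_chain (V := V) (r := s) (m := mn + mi + ms + s + 5) (by omega) τ N
      (fun k hk => ⟨by rw [τ0]; omega, h3 k hk⟩) (by rw [τ0]; omega)
    have hvN := hvM N le_rfl
    refine ((h1.mono_tracks (by omega)).seq ((h2.mono_tracks (by omega)).seq (h5.seq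
      ((Exec.move (by omega) (by omega) (by omega) ?_).seq (Exec.clear (by omega)))))).cast ?_
    · rw [τr _ _ (by omega), τ2, h0]; omega
    · funext r
      by_cases c1 : r = s + 1
      · subst c1; simp [hs, (show s + 1 ≠ o by omega)]
      by_cases c2 : r = s + 2
      · subst c2; simp [hs, (show s + 2 ≠ o by omega)]
      by_cases c3 : r = o
      · subst c3; simp [c1, c2, τ2, τr _ r (by omega), h0, hv, hN]
      by_cases c4 : r = s
      · subst c4; simp [τ0, c3, hs]
      simp [c1, c2, c3, τr _ r (show r < s ∨ s + 2 < r by omega)]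

end TuringSpace

/-! ### Head positions, used space, and machines given by quintuples -/

namespace TuringSpace

open Relation

section Tapes

variable {Γ : Type*} [Inhabited Γ] (a a' : Γ) (l r : List Γ)

theorem write_mk_cons : (Tape.mk' (ListBlank.mk l) (ListBlank.mk (a :: r))).write a'
    = Tape.mk' (ListBlank.mk l) (ListBlank.mk (a' :: r)) := by
  rw [Tape.write_mk', ListBlank.tail_mk, ListBlank.cons_mk]; rfl

theorem move_right_mk_cons : (Tape.mk' (ListBlank.mk l) (ListBlank.mk (a :: r))).move Dir.right
    = Tape.mk' (ListBlank.mk (a :: l)) (ListBlank.mk r) := by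
  rw [Tape.move_right_mk', ListBlank.tail_mk, ListBlank.head_mk, ListBlank.cons_mk]; rfl

theorem move_left_mk_cons : (Tape.mk' (ListBlank.mk (a :: l)) (ListBlank.mk r)).move Dir.left
    = Tape.mk' (ListBlank.mk l) (ListBlank.mk (a :: r)) := by
  rw [Tape.move_left_mk', ListBlank.tail_mk, ListBlank.head_mk, ListBlank.cons_mk]; rfl

end Tapes

namespace Algorithm

variable (A : Algorithm)

/-- One step of the algorithm, recording the position of the head. -/
def posStep (s : A.Config × ℤ) : Option (A.Config × ℤ) :=
  (TM0.step A.table s.1).map fun c => (c, s.2 + A.shift s.1)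

theorem after_succ (x t : ℕ) : A.after x (t + 1) = (A.after x t).bind A.posStep := rfl

variable {A} in
theorem posStep_of_right {q q' : A.State} {T T' : Tape (Option (Fin A.base))} {z : ℤ}
    (h : A.table q T.head = some (q', TM0.Stmt.move Dir.right)) (hT : T.move Dir.right = T') :
    A.posStep (⟨q, T⟩, z) = some (⟨q', T'⟩, z + 1) := by
  simp only [posStep, TM0.step, shift, h, ← hT]
  rfl

variable {A} in
theorem posStep_of_left {q q' : A.State} {T T' : Tape (Option (Fin A.base))} {z : ℤ}
    (h : A.table q T.head = some (q', TM0.Stmt.move Dir.left)) (hT : T.move Dir.left = T') :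
    A.posStep (⟨q, T⟩, z) = some (⟨q', T'⟩, z + -1) := by
  simp only [posStep, TM0.step, shift, h, ← hT]
  rfl

variable {A} in
theorem posStep_of_write {q q' : A.State} {T T' : Tape (Option (Fin A.base))}
    {a : Option (Fin A.base)} {z : ℤ} (h : A.table q T.head = some (q', TM0.Stmt.write a))
    (hT : T.write a = T') : A.posStep (⟨q, T⟩, z) = some (⟨q', T'⟩, z) := by
  simp only [posStep, TM0.step, shift, h, ← hT]
  simp

theorem posStep_eq_none {s : A.Config × ℤ} : A.posStep s = none ↔ TM0.step A.table s.1 = none := by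
  simp [posStep]

variable {A}

theorem after_ne_none_of_le {x t t' : ℕ} (h : A.after x t' ≠ none) (ht : t ≤ t') :
    A.after x t ≠ none := by
  induction ht with
  | refl => exact h
  | @step m _ ih =>
    refine ih fun h' => h ?_
    rw [Nat.succ_eq_add_one, after_succ, h']; rfl

theorem reaches_of_after {x t : ℕ} {s : A.Config × ℤ} (h : A.after x t = some s) :
    StateTransition.Reaches (TM0.step A.table) (TM0.init (A.input x)) s.1 := by
  induction t generalizing s with
  | zero =>
    obtain rfl := Option.some.inj h
    exact ReflTransGen.refl
  | succ t ih =>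
    rw [after_succ, Option.bind_eq_some_iff] at h
    obtain ⟨s', h1, h2⟩ := h
    refine (ih h1).tail ?_
    simp only [posStep, Option.map_eq_some_iff] at h2
    obtain ⟨c, h3, rfl⟩ := h2
    exact h3

theorem exists_after_of_reaches {x : ℕ} {c : A.Config}
    (h : StateTransition.Reaches (TM0.step A.table) (TM0.init (A.input x)) c) :
    ∃ t z, A.after x t = some (c, z) := by
  induction h with
  | refl => exact ⟨0, 0, rfl⟩
  | @tail c c' _ h ih =>
    obtain ⟨t, z, ht⟩ := ih
    refine ⟨t + 1, z + A.shift c, ?_⟩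
    rw [after_succ, ht]
    simp [posStep, Option.mem_def.1 h]

theorem eval_eq_of_after {x t : ℕ} {s : A.Config × ℤ} (h : A.after x t = some s)
    (h' : TM0.step A.table s.1 = none) : A.eval x = Part.some (readNumber s.1.Tape.right₀) := by
  have : s.1 ∈ StateTransition.eval (TM0.step A.table) (TM0.init (A.input x)) :=
    StateTransition.mem_eval.2 ⟨reaches_of_after h, h'⟩
  have h2 := Part.eq_some_iff.2 this
  rw [eval, TM0.eval, h2]
  simp

theorem exists_after_of_dom {x : ℕ} (h : (A.eval x).Dom) :
    ∃ t s, A.after x t = some s ∧ TM0.step A.table s.1 = none := by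
  have h1 : (StateTransition.eval (TM0.step A.table) (TM0.init (A.input x))).Dom := h
  obtain ⟨h2, h3⟩ := StateTransition.mem_eval.1 (Part.get_mem h1)
  obtain ⟨t, z, ht⟩ := exists_after_of_reaches h2
  exact ⟨t, _, ht, h3⟩

/-- Computation paths with head positions between `0` and `H`. -/
def Path (H : ℕ) : A.Config × ℤ → A.Config × ℤ → Prop :=
  ReflTransGen fun s s' => A.posStep s = some s' ∧ 0 ≤ s'.2 ∧ s'.2 ≤ H

theorem Path.exists_after {H x t : ℕ} {s s' : A.Config × ℤ} (h : Path H s s')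
    (hs : A.after x t = some s) (hb : ∀ r ≤ t, ∀ s, A.after x r = some s → 0 ≤ s.2 ∧ s.2 ≤ H) :
    ∃ t' ≥ t, A.after x t' = some s' ∧
      ∀ r ≤ t', ∀ s, A.after x r = some s → 0 ≤ s.2 ∧ s.2 ≤ H := by
  induction h with
  | refl => exact ⟨t, le_rfl, hs, hb⟩
  | @tail s₁ s₂ _ h ih =>
    obtain ⟨t', ht', h1, h2⟩ := ih
    have h3 : A.after x (t' + 1) = some s₂ := by rw [after_succ, h1]; exact h.1
    refine ⟨t' + 1, by omega, h3, fun r hr s' hs' => ?_⟩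
    rcases Nat.lt_or_eq_of_le hr with h4 | rfl
    · exact h2 r (by omega) s' hs'
    · rw [h3] at hs'
      obtain rfl := Option.some.inj hs'
      exact h.2

theorem abs_shift_le (c : A.Config) : -1 ≤ A.shift c ∧ A.shift c ≤ 1 := by
  unfold shift
  split <;> simp

/-- The positions visited up to some time form an interval. -/
theorem exists_visit {x t : ℕ} {s : A.Config × ℤ} (h : A.after x t = some s) {z : ℤ}
    (hz : 0 ≤ z ∧ z ≤ s.2 ∨ s.2 ≤ z ∧ z ≤ 0) : ∃ t' ≤ t, ∃ c, A.after x t' = some (c, z) := by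
  induction t generalizing s z with
  | zero =>
    obtain rfl := Option.some.inj h
    simp only at hz
    obtain rfl : z = 0 := by omega
    exact ⟨0, le_rfl, _, rfl⟩
  | succ t ih =>
    by_cases hz' : z = s.2
    · subst hz'; exact ⟨t + 1, le_rfl, s.1, h⟩
    rw [after_succ, Option.bind_eq_some_iff] at h
    obtain ⟨s', h1, h2⟩ := h
    simp only [posStep, Option.map_eq_some_iff] at h2
    obtain ⟨c, h3, rfl⟩ := h2
    have := abs_shift_le s'.1
    simp only at hz hz'
    obtain ⟨t', ht', h4⟩ := ih h1 (z := z) (by omega)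
    exact ⟨t', by omega, h4⟩

theorem encard_Icc_sub_one (a b : ℤ) (n : ℕ) (h : b - a = n) :
    (Set.Icc a b).encard - 1 = (n : ℕ∞) := by
  rw [← Finset.coe_Icc, Set.encard_coe_eq_coe_finsetCard, Int.card_Icc,
    show b + 1 - a = ((n + 1 : ℕ) : ℤ) by push_cast; omega, Int.toNat_natCast]
  push_cast
  exact (ENat.addLECancellable_of_ne_top (by simp)).add_tsub_cancel_right

/-- A head that stays between `0` and `H`, reaches `H` and then halts visits exactly the cells from
`0` to `H`, since positions change by at most one. The condition on the input length keeps its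
terminating blank inside this interval. -/
theorem space_eq_of_path {H x : ℕ} {s s' : A.Config × ℤ}
    (h : Path H (TM0.init (A.input x), 0) s) (hs : s.2 = H) (h' : Path H s s')
    (hs' : TM0.step A.table s'.1 = none) :
    A.eval x = Part.some (readNumber s'.1.Tape.right₀) ∧
      ((A.input x).length ≤ H → A.space x = H) := by
  have h0 : ∀ r ≤ 0, ∀ s, A.after x r = some s → 0 ≤ s.2 ∧ s.2 ≤ (H : ℤ) := by
    intro r hr s hs
    obtain rfl : r = 0 := by omega
    obtain rfl := Option.some.inj hs
    simp
  obtain ⟨t1, -, h1, hb1⟩ := h.exists_after (t := 0) rfl h0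
  obtain ⟨t2, ht2, h2, hb2⟩ := h'.exists_after h1 hb1
  have he := eval_eq_of_after h2 hs'
  refine ⟨he, fun hl => ?_⟩
  have hu : A.usedCells x = Set.Icc 0 (H : ℤ) := by
    ext z
    simp only [usedCells, Set.mem_union, Set.mem_Icc, Set.mem_ofPred_eq]
    constructor
    · rintro (h | ⟨t, c, h⟩)
      · omega
      · have : t ≤ t2 := by
          by_contra hlt
          refine after_ne_none_of_le (t := t2 + 1) (t' := t) (by rw [h]; simp) (by omega) ?_
          rw [after_succ, h2]
          exact (A.posStep_eq_none).2 hs'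
        exact hb2 t this _ h
    · intro hz
      obtain ⟨t', -, c, h⟩ := exists_visit h1 (z := z) (Or.inl ⟨hz.1, by omega⟩)
      exact Or.inr ⟨t', c, h⟩
  have hd : (A.eval x).Dom := by rw [he]; trivial
  rw [space, if_pos hd, hu, encard_Icc_sub_one 0 H H (by simp)]

/-- From every configuration with `P` another one is reached. The intermediate `s'' ≠ s` makes the
path between them nonempty, so that there are configurations with `P` at arbitrarily late times. -/
theorem not_dom_of_chain {x : ℕ} {P : A.Config × ℤ → Prop}
    (h0 : ∃ t s, A.after x t = some s ∧ P s)
    (h : ∀ s, P s → ∃ s' H, P s' ∧ Path H s s' ∧ ∃ s'' ≠ s, Path H s s'' ∧ Path H s'' s') :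
    ¬ (A.eval x).Dom := by
  intro hd
  obtain ⟨T, s, hT, hn⟩ := exists_after_of_dom hd
  have key : ∀ n, ∃ t ≥ n, ∃ s, A.after x t = some s ∧ P s := by
    have hpath : ∀ {H} {s s' : A.Config × ℤ} {t}, Path H s s' → A.after x t = some s →
        ∃ t' ≥ t, A.after x t' = some s' := by
      intro H s s' t hp ht
      induction hp with
      | refl => exact ⟨t, le_rfl, ht⟩
      | @tail s₁ s₂ _ h ih =>
        obtain ⟨t', ht', h1⟩ := ih
        exact ⟨t' + 1, by omega, by rw [after_succ, h1]; exact h.1⟩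
    intro n
    induction n with
    | zero =>
      obtain ⟨t, s, h⟩ := h0
      exact ⟨t, by omega, s, h⟩
    | succ n ih =>
      obtain ⟨t, htn, s, ht, hP⟩ := ih
      obtain ⟨s', H, hP', -, s'', hne, hp1, hp2⟩ := h s hP
      rcases ReflTransGen.cases_head hp1 with rfl | ⟨s₁, h1, hp3⟩
      · exact absurd rfl hne
      · have h2 : A.after x (t + 1) = some s₁ := by rw [after_succ, ht]; exact h1.1
        obtain ⟨t', ht', h3⟩ := hpath (hp3.trans hp2 : Path H s₁ s') h2
        exact ⟨t', by omega, s', h3, hP'⟩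
  obtain ⟨t, ht, s', hs', -⟩ := key (T + 1)
  refine after_ne_none_of_le (t := T + 1) (by rw [hs']; simp) ht ?_
  rw [after_succ, hT]
  exact (A.posStep_eq_none).2 hn

end Algorithm

section Quintuples

variable {B : ℕ} {Λ : Type}

/-- A transition table by quintuples: in every step a machine changes its state, writes a symbol,
and possibly moves. -/
abbrev Quintuples (B : ℕ) (Λ : Type) : Type :=
  Λ → Option (Fin B) → Option (Λ × Option (Fin B) × Option Dir)

/-- The algorithm with a given transition table by quintuples, on a finite closed set of states. -/
def Quintuples.algorithm (δ : Quintuples B Λ) (hB : 2 ≤ B) (S : Set Λ) (hS : S.Finite) (q₀ : Λ)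
    (h₀ : q₀ ∈ S) (hδ : ∀ q ∈ S, ∀ a q' w, δ q a = some (q', w) → q' ∈ S) : Algorithm where
  base := B
  two_le_base := hB
  -- A step of the model either writes or moves. The second component remembers the move that is
  -- still due after the writing.
  State := S × Option Dir
  inhabitedState := ⟨(⟨q₀, h₀⟩, none)⟩
  finiteState := by
    have := hS.to_subtype
    have : Finite Dir := Finite.of_injective
      (fun d : Dir => match d with | .left => true | .right => false) (by
        rintro (_ | _) (_ | _) h <;> simp_all)
    infer_instance
  table := fun q a =>
    match q.2 with
    | some d => some ((q.1, none), TM0.Stmt.move d)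
    | none =>
      match h : δ q.1 a with
      | none => none
      | some (q', a', d) => some ((⟨q', hδ q.1 q.1.2 a q' _ h⟩, d), TM0.Stmt.write a')

/-- Moves of a machine given by quintuples, between a state together with the two halves of the
tape, as long as the position of the head does not exceed `H`. -/
inductive Move (δ : Quintuples B Λ) (H : ℕ) : Λ × List (Option (Fin B)) × List (Option (Fin B)) →
    Λ × List (Option (Fin B)) × List (Option (Fin B)) → Prop
  | right {q q' a a' l r} : δ q a = some (q', a', some Dir.right) → l.length + 1 ≤ H →
      Move δ H (q, l, a :: r) (q', a' :: l, r)
  | left {q q' a a' c l r} : δ q a = some (q', a', some Dir.left) →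
      Move δ H (q, c :: l, a :: r) (q', l, c :: a' :: r)
  | stay {q q' a a' l r} : δ q a = some (q', a', none) → Move δ H (q, l, a :: r) (q', l, a' :: r)
  | blank {q l r} : Move δ H (q, l, r) (q, l, r ++ [none])
  | unblank {q l r} : Move δ H (q, l, r ++ [none]) (q, l, r)

/-- The transitive closure of `Move`. -/
abbrev Moves (δ : Quintuples B Λ) (H : ℕ) := ReflTransGen (Move δ H)

theorem mk_append_blank (l : List (Option (Fin B))) :
    ListBlank.mk (l ++ [none]) = ListBlank.mk l := by
  refine (Quotient.sound' (Or.inl ⟨1, ?_⟩)).symm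
  simp; rfl

variable (δ : Quintuples B Λ) (hB : 2 ≤ B) (S : Set Λ) (hS : S.Finite) (q₀ : Λ)
    (h₀ : q₀ ∈ S) (hδ : ∀ q ∈ S, ∀ a q' w, δ q a = some (q', w) → q' ∈ S)

/-- The configuration of the algorithm, with the position of the head, that is described by a
state and the two halves of the tape. -/
def Quintuples.config (q : S) (l r : List (Option (Fin B))) :
    (δ.algorithm hB S hS q₀ h₀ hδ).Config × ℤ :=
  (⟨(q, none), Tape.mk' (ListBlank.mk l) (ListBlank.mk r)⟩, l.length)

theorem Quintuples.table_write (q : S) {a a' : Option (Fin B)} {q' : Λ} {d : Option Dir}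
    (h : δ q a = some (q', a', d)) : (δ.algorithm hB S hS q₀ h₀ hδ).table (q, none) a
      = some ((⟨q', hδ q q.2 a q' _ h⟩, d), TM0.Stmt.write a') := by
  simp only [Quintuples.algorithm]
  split
  · rename_i h1; rw [h] at h1; cases h1
  · rename_i h1; rw [h] at h1; cases h1; rfl

theorem Quintuples.posStep_write (q : S) {a a' : Option (Fin B)} {q' : Λ} {d : Option Dir}
    (h : δ q a = some (q', a', d)) (l r : List (Option (Fin B))) :
    (δ.algorithm hB S hS q₀ h₀ hδ).posStep (δ.config hB S hS q₀ h₀ hδ q l (a :: r))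
      = some (⟨(⟨q', hδ q q.2 a q' _ h⟩, d), Tape.mk' (ListBlank.mk l) (ListBlank.mk (a' :: r))⟩,
        (l.length : ℤ)) := by
  exact Algorithm.posStep_of_write (A := δ.algorithm hB S hS q₀ h₀ hδ)
    (Quintuples.table_write δ hB S hS q₀ h₀ hδ q h) (write_mk_cons _ _ _ _)

theorem Quintuples.config_append_blank (q : S) (l r : List (Option (Fin B))) :
    δ.config hB S hS q₀ h₀ hδ q l (r ++ [none]) = δ.config hB S hS q₀ h₀ hδ q l r := by
  unfold config
  exact congrArg (fun r => ((⟨(q, none), Tape.mk' (ListBlank.mk l) r⟩, (l.length : ℤ)) :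
    (δ.algorithm hB S hS q₀ h₀ hδ).Config × ℤ)) (mk_append_blank r)

/-- The left list has no invisible blanks: its length is the position of the head. A move to the
left requires this list to be nonempty, so no position below `0` occurs. Blanks at the end of the
right list are immaterial. -/
theorem Quintuples.path_of_moves {H : ℕ} {q q' : Λ} {l r l' r' : List (Option (Fin B))}
    (h : Moves δ H (q, l, r) (q', l', r')) (hq : q ∈ S) (hl : l.length ≤ H) :
    ∃ hq' : q' ∈ S, l'.length ≤ H ∧ Algorithm.Path H (δ.config hB S hS q₀ h₀ hδ ⟨q, hq⟩ l r)
      (δ.config hB S hS q₀ h₀ hδ ⟨q', hq'⟩ l' r') := by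
  generalize hs : (q', l', r') = s at h
  induction h generalizing q' l' r' with
  | refl => cases hs; exact ⟨hq, hl, ReflTransGen.refl⟩
  | @tail s₁ s₂ _ hm ih =>
    subst hs
    obtain ⟨q₁, l₁, r₁⟩ := s₁
    obtain ⟨hq₁, hl₁, hp⟩ := ih rfl
    cases hm with
    | @right _ _ a a' _ _ h hH =>
      refine ⟨hδ _ hq₁ _ _ _ h, by simpa using hH, ?_⟩
      refine hp.trans ((ReflTransGen.single ⟨Quintuples.posStep_write δ hB S hS q₀ h₀ hδ _ h _ _,
        Int.natCast_nonneg _, by simpa using hl₁⟩).tail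
        ⟨?_, by simp only [Quintuples.config]; omega, ?_⟩)
      · exact Algorithm.posStep_of_right (A := δ.algorithm hB S hS q₀ h₀ hδ) rfl
          (move_right_mk_cons _ _ _)
      · simp only [Quintuples.config, List.length_cons]; exact_mod_cast hH
    | @left _ _ a a' c _ _ h =>
      simp only [List.length_cons] at hl₁
      refine ⟨hδ _ hq₁ _ _ _ h, by omega, ?_⟩
      refine hp.trans ((ReflTransGen.single ⟨Quintuples.posStep_write δ hB S hS q₀ h₀ hδ _ h _ _,
        Int.natCast_nonneg _, by simpa using hl₁⟩).tail
        ⟨?_, by simp only [Quintuples.config]; omega, ?_⟩)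
      · refine (Algorithm.posStep_of_left (A := δ.algorithm hB S hS q₀ h₀ hδ) rfl
          (move_left_mk_cons _ _ _)).trans ?_
        rw [List.length_cons, Nat.cast_succ, add_neg_cancel_right]
        rfl
      · simp only [Quintuples.config]; exact_mod_cast (by omega)
    | stay h =>
      refine ⟨hδ _ hq₁ _ _ _ h, hl₁, hp.tail ⟨Quintuples.posStep_write δ hB S hS q₀ h₀ hδ _ h _ _,
        by simp [Quintuples.config], ?_⟩⟩
      simp only [Quintuples.config]; exact_mod_cast hl₁
    | blank =>
      refine ⟨hq₁, hl₁, ?_⟩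
      rw [Quintuples.config_append_blank]; exact hp
    | unblank =>
      refine ⟨hq₁, hl₁, ?_⟩
      rw [Quintuples.config_append_blank] at hp; exact hp

end Quintuples

end TuringSpace

/-! ### A Turing machine that executes programs on a tape with several tracks -/

namespace TuringSpace

open Relation

section Symbols

variable (D m : ℕ)

/-- The size of the alphabet: a symbol has a digit below `D` for each of `m` tracks, and a mark for
the first cell of the area. -/
abbrev alphabetSize : ℕ := Fintype.card ((Fin m → Fin D) × Bool)

theorem two_le_alphabetSize [NeZero D] : 2 ≤ alphabetSize D m := by
  have : 1 ≤ D ^ m := Nat.one_le_pow _ _ (NeZero.pos D)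
  simp only [alphabetSize, Fintype.card_prod, Fintype.card_pi, Fintype.card_fin, Fintype.card_bool,
    Finset.prod_const, Finset.card_univ]
  omega

theorem le_alphabetSize (hm : m ≠ 0) : D ≤ alphabetSize D m := by
  have : D ≤ D ^ m := Nat.le_self_pow hm D
  simp only [alphabetSize, Fintype.card_prod, Fintype.card_pi, Fintype.card_fin, Fintype.card_bool,
    Finset.prod_const, Finset.card_univ]
  omega

variable {D m}

/-- The digit of a symbol on a track. -/
noncomputable def trackDigit (t : ℕ) (s : Fin (alphabetSize D m)) : ℕ :=
  if h : t < m then ((Fintype.equivFin ((Fin m → Fin D) × Bool)).symm s).1 ⟨t, h⟩ else 0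

/-- The mark of a symbol. -/
noncomputable def isFirst (s : Fin (alphabetSize D m)) : Bool :=
  ((Fintype.equivFin ((Fin m → Fin D) × Bool)).symm s).2

variable [NeZero D]

/-- The symbol with given digits and mark. -/
noncomputable def mkSymbol (D m : ℕ) [NeZero D] (v : ℕ → ℕ) (b : Bool) : Fin (alphabetSize D m) :=
  Fintype.equivFin ((Fin m → Fin D) × Bool) (fun t => Fin.ofNat D (v t), b)

/-- Change the digit of a symbol on a track. -/
noncomputable def setDigit (t : ℕ) (s : Fin (alphabetSize D m)) (d : ℕ) : Fin (alphabetSize D m) :=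
  mkSymbol D m (Function.update (fun t => trackDigit t s) t d) (isFirst s)

/-- The symbol that serves as the digit `d` of the raw numeral. -/
def rawDigit (D m : ℕ) [NeZero D] (d : ℕ) : Fin (alphabetSize D m) :=
  ⟨d % alphabetSize D m, Nat.mod_lt _ (by have := two_le_alphabetSize D m; omega)⟩

theorem trackDigit_lt (t : ℕ) (s : Fin (alphabetSize D m)) : trackDigit t s < D := by
  unfold trackDigit
  split_ifs
  · exact Fin.is_lt _
  · exact NeZero.pos D

theorem trackDigit_mkSymbol {t : ℕ} (ht : t < m) (v : ℕ → ℕ) (b : Bool) :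
    trackDigit t (mkSymbol D m v b) = v t % D := by
  simp [trackDigit, mkSymbol, ht]

@[simp] theorem isFirst_mkSymbol (v : ℕ → ℕ) (b : Bool) : isFirst (mkSymbol D m v b) = b := by
  simp [isFirst, mkSymbol]

@[simp] theorem isFirst_setDigit (t : ℕ) (s : Fin (alphabetSize D m)) (d : ℕ) :
    isFirst (setDigit t s d) = isFirst s := by
  simp [setDigit]

theorem trackDigit_setDigit_self {t d : ℕ} (ht : t < m) (hd : d < D) (s : Fin (alphabetSize D m)) :
    trackDigit t (setDigit t s d) = d := by
  simp [setDigit, trackDigit_mkSymbol ht, Nat.mod_eq_of_lt hd]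

theorem trackDigit_setDigit_of_ne {t t' : ℕ} (ht : t' < m) (h : t' ≠ t) (d : ℕ)
    (s : Fin (alphabetSize D m)) : trackDigit t' (setDigit t s d) = trackDigit t' s := by
  simp [setDigit, trackDigit_mkSymbol ht, h, Nat.mod_eq_of_lt (trackDigit_lt t' s)]

end Symbols

/-- The phases in the execution of one instruction of a program. -/
inductive Phase (B : ℕ) : Type
  | boot
  | bootNext (d : Fin B)
  | start
  | test
  | back (b : Bool)
  | backCount
  | incCount
  | insert (c : Option (Fin B))
  | insertBack
  | rawDec
  | rawErase
  | rawBack (b : Bool)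
  | rawInc
  | rawEnd
  | erase
  | seek
  | wordEnd
  | wordSeek
  | done

instance (B : ℕ) : Finite (Phase B) := by
  refine Finite.of_injective (β := Fin 19 × Option (Option (Fin B)) × Bool) (fun p => match p with
    | .boot => (0, none, false)
    | .bootNext d => (1, some (some d), false)
    | .start => (2, none, false)
    | .test => (3, none, false)
    | .back b => (4, none, b)
    | .backCount => (5, none, false)
    | .incCount => (6, none, false)
    | .insert c => (7, some c, false)
    | .insertBack => (8, none, false)
    | .rawDec => (9, none, false)
    | .rawErase => (10, none, false)
    | .rawBack b => (11, none, b)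
    | .rawInc => (12, none, false)
    | .rawEnd => (13, none, false)
    | .erase => (14, none, false)
    | .seek => (15, none, false)
    | .wordEnd => (16, none, false)
    | .wordSeek => (17, none, false)
    | .done => (18, none, false)) ?_
  intro p q h
  cases p <;> cases q <;> simp_all

/-- The stack of programs that remain to be executed after the first instruction on a stack, which
may be a test, has been completed. -/
def nextStack : List Prog → Bool → List Prog
  | .loop t p :: k, true => p :: .loop t p :: k
  | .ifBig _ p _ :: k, true => p :: k
  | .ifBig _ _ q :: k, false => q :: k
  | .loopRaw p :: k, true => p :: .loopRaw p :: k
  | _ :: k, _ => k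
  | [], _ => []

section Machine

variable {D m : ℕ} [NeZero D]

/-- The actions in the phase `start`. -/
noncomputable def startTable (k : List Prog) (a : Option (Fin (alphabetSize D m))) :
    Option ((List Prog × Phase (alphabetSize D m)) × Option (Fin (alphabetSize D m)) × Option Dir) :=
  match k, a with
  | .skip :: k, a => some ((k, .start), a, none)
  | .seq p q :: k, a => some ((p :: q :: k, .start), a, none)
  | .inc t :: k, some s =>
    if trackDigit t s + 1 < D then
      some ((.inc t :: k, .back true), some (setDigit t s (trackDigit t s + 1)), none)
    else some ((.inc t :: k, .start), some (setDigit t s 0), some .right)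
  -- A carry out of the area creates a new cell in place of the separating blank. The phase `insert`
  -- then shifts the raw numeral by one place, and the following phases increase track `0`.
  | .inc t :: k, none => some ((.inc t :: k, .insert none),
      some (mkSymbol D m (fun i => if i = t then 1 else 0) false), some .right)
  | .dec t :: k, some s =>
    if trackDigit t s = 0 then
      some ((.dec t :: k, .start), some (setDigit t s (D - 1)), some .right)
    else some ((.dec t :: k, .back true), some (setDigit t s (trackDigit t s - 1)), none)
  | .loop t p :: k, some s =>
    if trackDigit t s = 0 then some ((.loop t p :: k, .start), some s, some .right)
    else some ((.loop t p :: k, .back true), some s, none)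
  | .loop t p :: k, none => some ((.loop t p :: k, .back false), none, some .left)
  | .ifBig t p q :: k, a => some ((.ifBig t p q :: k, .test), a, some .right)
  | .loopRaw p :: k, some s => some ((.loopRaw p :: k, .start), some s, some .right)
  | .loopRaw p :: k, none => some ((.loopRaw p :: k, .rawDec), none, some .right)
  | .append :: k, some s => some ((.append :: k, .start), some s, some .right)
  | .append :: k, none => some ((.append :: k, .rawEnd), none, some .right)
  | .incRaw :: k, some s => some ((.incRaw :: k, .start), some s, some .right)
  | .incRaw :: k, none => some ((.incRaw :: k, .rawInc), none, some .right)
  | .grow :: k, some s => some ((.grow :: k, .start), some s, some .right)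
  | .grow :: k, none => some ((.grow :: k, .insert none), some (mkSymbol D m 0 false), some .right)
  | .finishDigit t :: k, some s =>
    some ((.finishDigit t :: k, .erase), some (rawDigit D m (trackDigit t s)), some .right)
  | .finishWord :: k, some _ => some ((.finishWord :: k, .start), none, some .right)
  | .finishWord :: k, none => some ((.finishWord :: k, .wordEnd), none, some .right)
  | _, _ => none

variable (f : ℕ → Bool → Prog)

/-- The transition table of the machine that executes the programs `f d b`, where `d` is the first
digit of the input, and `b` tells whether there are further digits. -/
noncomputable def progTable :
    Quintuples (alphabetSize D m) (List Prog × Phase (alphabetSize D m)) := fun s a =>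
  match s, a with
  | (k, .boot), some d => some ((k, .bootNext d), some (mkSymbol D m 0 true), some .right)
  | (_, .bootNext d), none => some (([.skip, f d false], .backCount), none, some .left)
  | (_, .bootNext d), some a => some (([.skip, f d true], .insert (some a)), none, some .right)
  | (k, .start), a => startTable k a
  | (k, .test), some s =>
    match k with
    | .ifBig t _ _ :: _ =>
      if trackDigit t s = 0 then some ((k, .test), some s, some .right)
      else some ((k, .back true), some s, none)
    | _ => none
  | (k, .test), none => some ((k, .back false), none, some .left)
  | (k, .back b), some s =>
    if isFirst s then some ((nextStack k b, .start), some s, none)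
    else some ((k, .back b), some s, some .left)
  | (k, .backCount), some s =>
    if isFirst s then some ((k, .incCount), some s, none)
    else some ((k, .backCount), some s, some .left)
  | (k, .incCount), some s =>
    if trackDigit 0 s + 1 < D then
      some ((k, .back true), some (setDigit 0 s (trackDigit 0 s + 1)), none)
    else some ((k, .incCount), some (setDigit 0 s 0), some .right)
  | (k, .insert c), none => some ((k, .insertBack), c, none)
  | (k, .insert c), some a => some ((k, .insert (some a)), c, some .right)
  | (k, .insertBack), some a => some ((k, .insertBack), some a, some .left)
  | (k, .insertBack), none => some ((k, .backCount), none, some .left)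
  | (k, .rawDec), some a =>
    if (a : ℕ) = 0 then
      some ((k, .rawDec), some (rawDigit D m (alphabetSize D m - 1)), some .right)
    else some ((k, .rawBack true), some (rawDigit D m (a - 1)), none)
  | (k, .rawDec), none => some ((k, .rawErase), none, some .left)
  | (k, .rawErase), some _ => some ((k, .rawErase), none, some .left)
  | (k, .rawErase), none => some ((k, .back false), none, some .left)
  | (k, .rawBack b), some a => some ((k, .rawBack b), some a, some .left)
  | (k, .rawBack b), none => some ((k, .back b), none, some .left)
  | (k, .rawInc), some a =>
    if (a : ℕ) + 1 < alphabetSize D m then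
      some ((k, .rawBack true), some (rawDigit D m (a + 1)), none)
    else some ((k, .rawInc), some (rawDigit D m 0), some .right)
  | (k, .rawEnd), some a => some ((k, .rawEnd), some a, some .right)
  | (k, .rawEnd), none => some ((k, .rawBack true), some (rawDigit D m 0), none)
  | (k, .erase), some _ => some ((k, .erase), none, some .right)
  | (k, .erase), none => some ((k, .seek), none, some .left)
  | (k, .seek), none => some ((k, .seek), none, some .left)
  | (k, .seek), some a => some ((k, .done), some a, none)
  | (k, .wordEnd), some a => some ((k, .wordEnd), some a, some .right)
  | (k, .wordEnd), none => some ((k, .wordSeek), none, some .left)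
  | (k, .wordSeek), some a => some ((k, .wordSeek), some a, some .left)
  | (k, .wordSeek), none => some ((k, .done), none, some .right)
  | _, _ => none

end Machine

/-- The stacks that occur while `p` is being executed on top of the stack `k`. -/
def Prog.stackSet : Prog → List Prog → Set (List Prog)
  | .seq p q, k => {.seq p q :: k} ∪ p.stackSet (q :: k) ∪ q.stackSet k
  | .loop t p, k => {.loop t p :: k} ∪ p.stackSet (.loop t p :: k)
  | .ifBig t p q, k => {.ifBig t p q :: k} ∪ p.stackSet k ∪ q.stackSet k
  | .loopRaw p, k => {.loopRaw p :: k} ∪ p.stackSet (.loopRaw p :: k)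
  | p, k => {p :: k}

theorem Prog.self_mem_stackSet (p : Prog) (k : List Prog) : p :: k ∈ p.stackSet k := by
  cases p <;> simp [Prog.stackSet]

theorem Prog.finite_stackSet (p : Prog) (k : List Prog) : (p.stackSet k).Finite := by
  induction p generalizing k with
  | seq p q ihp ihq => exact ((Set.finite_singleton _).union (ihp _)).union (ihq _)
  | loop t p ih => exact (Set.finite_singleton _).union (ih _)
  | ifBig t p q ihp ihq => exact ((Set.finite_singleton _).union (ihp _)).union (ihq _)
  | loopRaw p ih => exact (Set.finite_singleton _).union (ih _)
  | _ => exact Set.finite_singleton _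

/-- The possible changes of the stack. -/
inductive StackStep : List Prog → List Prog → Prop
  | next (s : List Prog) (b : Bool) : StackStep s (nextStack s b)
  | unfold (p q : Prog) (k : List Prog) : StackStep (.seq p q :: k) (p :: q :: k)

/-- While `p` is being executed the stack remains in a set that is finite by `Prog.finite_stackSet`;
it leaves this set only for `k`. Hence finitely many states suffice, although states contain lists
of programs. -/
theorem Prog.stackStep_mem (p : Prog) (k : List Prog) {s s' : List Prog} (hs : s ∈ p.stackSet k)
    (h : StackStep s s') : s' ∈ p.stackSet k ∨ s' = k := by
  induction p generalizing k with
  | seq p q ihp ihq =>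
    rcases hs with (rfl | hs) | hs
    · cases h with
      | next _ b => exact Or.inr (by cases b <;> rfl)
      | unfold => exact Or.inl (Or.inl (Or.inr (self_mem_stackSet _ _)))
    · rcases ihp _ hs with h1 | rfl
      · exact Or.inl (Or.inl (Or.inr h1))
      · exact Or.inl (Or.inr (self_mem_stackSet _ _))
    · rcases ihq _ hs with h1 | rfl
      · exact Or.inl (Or.inr h1)
      · exact Or.inr rfl
  | loop t p ih =>
    rcases hs with rfl | hs
    · cases h with
      | next _ b =>
        cases b
        · exact Or.inr rfl
        · exact Or.inl (Or.inr (self_mem_stackSet _ _))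
    · rcases ih _ hs with h1 | rfl
      · exact Or.inl (Or.inr h1)
      · exact Or.inl (Or.inl rfl)
  | ifBig t p q ihp ihq =>
    rcases hs with (rfl | hs) | hs
    · cases h with
      | next _ b =>
        cases b
        · exact Or.inl (Or.inr (self_mem_stackSet _ _))
        · exact Or.inl (Or.inl (Or.inr (self_mem_stackSet _ _)))
    · rcases ihp _ hs with h1 | rfl
      · exact Or.inl (Or.inl (Or.inr h1))
      · exact Or.inr rfl
    · rcases ihq _ hs with h1 | rfl
      · exact Or.inl (Or.inr h1)
      · exact Or.inr rfl
  | loopRaw p ih =>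
    rcases hs with rfl | hs
    · cases h with
      | next _ b =>
        cases b
        · exact Or.inr rfl
        · exact Or.inl (Or.inr (self_mem_stackSet _ _))
    · rcases ih _ hs with h1 | rfl
      · exact Or.inl (Or.inr h1)
      · exact Or.inl (Or.inl rfl)
  | _ =>
    obtain rfl := hs
    cases h with
    | next _ b => exact Or.inr (by cases b <;> rfl)

section Machine

variable {D m : ℕ} [NeZero D] (f : ℕ → Bool → Prog)

/-- The stacks that occur when the programs `f d b` are executed. -/
def bootStacks (B : ℕ) : Set (List Prog) :=
  {[]} ∪ ⋃ d : Fin B, ⋃ b : Bool, {[.skip, f d b]} ∪ (f d b).stackSet []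

theorem boot_mem_bootStacks {B : ℕ} (d : Fin B) (b : Bool) : [.skip, f d b] ∈ bootStacks f B :=
  Or.inr (Set.mem_iUnion.2 ⟨d, Set.mem_iUnion.2 ⟨b, Or.inl rfl⟩⟩)

theorem finite_bootStacks (B : ℕ) : (bootStacks f B).Finite :=
  (Set.finite_singleton _).union (Set.finite_iUnion fun _ => Set.finite_iUnion fun _ =>
    (Set.finite_singleton _).union (Prog.finite_stackSet _ _))

theorem stackStep_mem_bootStacks {B : ℕ} {s s' : List Prog} (hs : s ∈ bootStacks f B)
    (h : StackStep s s') : s' ∈ bootStacks f B := by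
  rcases hs with rfl | hs
  · cases h with
    | next _ b => exact Or.inl rfl
  · obtain ⟨d, hs⟩ := Set.mem_iUnion.1 hs
    obtain ⟨b, hs⟩ := Set.mem_iUnion.1 hs
    have key : ∀ s' ∈ (f d b).stackSet [], s' ∈ bootStacks f B := fun s' h =>
      Or.inr (Set.mem_iUnion.2 ⟨d, Set.mem_iUnion.2 ⟨b, Or.inr h⟩⟩)
    rcases hs with rfl | hs
    · cases h with
      | next _ b' => exact key _ (by cases b' <;> exact Prog.self_mem_stackSet _ _)
    · rcases Prog.stackStep_mem _ _ hs h with h1 | rfl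
      · exact key _ h1
      · exact Or.inl rfl

theorem startTable_stack {k : List Prog} {a : Option (Fin (alphabetSize D m))}
    {s' : List Prog × Phase (alphabetSize D m)} {w}
    (h : startTable k a = some (s', w)) : s'.1 = k ∨ StackStep k s'.1 := by
  unfold startTable at h
  split at h
  any_goals split_ifs at h
  all_goals first
    | (cases h; done)
    | (cases h; exact Or.inl rfl)
    | (cases h; exact Or.inr (StackStep.unfold _ _ _))
    | (cases h; exact Or.inr (StackStep.next (.skip :: _) true))

theorem progTable_closed : ∀ s ∈ {s : List Prog × Phase (alphabetSize D m) |
      s.1 ∈ bootStacks f (alphabetSize D m)}, ∀ a s' w, progTable f s a = some (s', w) →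
      s' ∈ {s : List Prog × Phase (alphabetSize D m) | s.1 ∈ bootStacks f (alphabetSize D m)} := by
  intro s hs a s' w h
  have key : s'.1 = s.1 ∨ StackStep s.1 s'.1 ∨ s'.1 ∈ bootStacks f (alphabetSize D m) := by
    unfold progTable at h
    split at h
    any_goals split at h
    any_goals split_ifs at h
    all_goals first
      | (cases h; done)
      | (cases h; exact Or.inl rfl)
      | (cases h; exact Or.inr (Or.inr (boot_mem_bootStacks f _ _)))
      | (cases h; exact Or.inr (Or.inl (StackStep.next _ _)))
      | exact (startTable_stack h).imp_right Or.inl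
  rcases key with h1 | h1 | h1
  · exact (congrArg (· ∈ bootStacks f (alphabetSize D m)) h1).mpr hs
  · exact stackStep_mem_bootStacks f hs h1
  · exact h1

/-- The algorithm that executes the programs `f d b`. -/
noncomputable def progAlgorithm (D m : ℕ) [NeZero D] (f : ℕ → Bool → Prog) : Algorithm :=
  Quintuples.algorithm (progTable (D := D) (m := m) f) (two_le_alphabetSize D m)
    {s | s.1 ∈ bootStacks f (alphabetSize D m)}
    ((Set.Finite.prod (finite_bootStacks f _) Set.finite_univ).subset fun s hs =>
      ⟨hs, Set.mem_univ s.2⟩)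
    ([], .boot) (Or.inl rfl) (progTable_closed f)

end Machine

end TuringSpace

/-! ### Sweeps over words: carry, borrow, test, return -/

namespace TuringSpace

open Relation

section Sweeps

variable {B : ℕ} {Λ : Type} {δ : Quintuples B Λ} {H : ℕ} {q q₁ q₂ : Λ}

theorem sweep_right {g : Fin B → Option (Fin B)} (u : List (Fin B))
    (h : ∀ x ∈ u, δ q (some x) = some (q, g x, some .right)) (l r : List (Option (Fin B)))
    (hl : l.length + u.length ≤ H) :
    Moves δ H (q, l, u.map some ++ r) (q, (u.map g).reverse ++ l, r) := by
  induction u generalizing l with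
  | nil => exact .refl
  | cons x u ih =>
    simp only [List.length_cons] at hl
    refine .head (Move.right (h x (by simp)) (by omega)) ?_
    simpa using ih (fun y hy => h y (by simp [hy])) (g x :: l) (by simp; omega)

/-- The scanned symbol `x` and the left list `l'` are tied together by `hx`, so that the swept word
`u` may be empty, in which case the head already stands on `c`. -/
theorem sweep_left {g : Fin B → Option (Fin B)} (u : List (Fin B)) {x c : Option (Fin B)}
    {l l' : List (Option (Fin B))} (r : List (Option (Fin B))) (hx : x :: l' = u.map some ++ c :: l)
    (h : ∀ y ∈ u, δ q (some y) = some (q, g y, some .left)) :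
    Moves δ H (q, l', x :: r) (q, l, c :: ((u.map g).reverse ++ r)) := by
  induction u generalizing x l' r with
  | nil => cases hx; exact .refl
  | cons y u ih =>
    simp only [List.map_cons, List.cons_append, List.cons.injEq] at hx
    obtain ⟨rfl, rfl⟩ := hx
    obtain ⟨x, l', hx⟩ : ∃ x l', u.map some ++ c :: l = x :: l' := by cases u <;> simp
    rw [hx]
    refine .head (Move.left (h y (by simp))) ?_
    simpa using ih (g y :: r) hx.symm fun z hz => h z (by simp [hz])

/-- The number denoted by a word, for a reading `dg` of its symbols as digits to the base `b`. -/
def wordValue (b : ℕ) (dg : Fin B → ℕ) (w : List (Fin B)) : ℕ := Nat.ofDigits b (w.map dg)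

@[simp] theorem wordValue_nil (b : ℕ) (dg : Fin B → ℕ) : wordValue b dg [] = 0 := rfl

@[simp] theorem wordValue_cons (b : ℕ) (dg : Fin B → ℕ) (a : Fin B) (w : List (Fin B)) :
    wordValue b dg (a :: w) = dg a + b * wordValue b dg w := by
  simp [wordValue, Nat.ofDigits_cons]

theorem wordValue_append (b : ℕ) (dg : Fin B → ℕ) (u w : List (Fin B)) :
    wordValue b dg (u ++ w) = wordValue b dg u + b ^ u.length * wordValue b dg w := by
  simp [wordValue, Nat.ofDigits_append]

theorem wordValue_lt {b : ℕ} {dg : Fin B → ℕ} (h : ∀ a, dg a < b) (w : List (Fin B)) :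
    wordValue b dg w < b ^ w.length := by
  induction w with
  | nil => simp
  | cons a w ih =>
    rw [wordValue_cons, List.length_cons, pow_succ]
    have := h a
    nlinarith

/-- Symbol `a'` arises from `a` by changing a digit. -/
def Changed (b : ℕ) (st : Fin B → ℕ → Fin B) (a' a : Fin B) : Prop := a' = a ∨ ∃ x < b, a' = st a x

theorem forall₂_changed_refl {b : ℕ} {st : Fin B → ℕ → Fin B} (w : List (Fin B)) :
    List.Forall₂ (Changed b st) w w :=
  List.forall₂_same.2 fun _ _ => Or.inl rfl

/-- Increase by one, least significant digit first. Either the carry is absorbed within the word, at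
the first symbol of `z`, or all digits were maximal, the word now denotes `0`, and the head stands
behind it. Reading and changing of digits are left general to cover both the tracks and the raw
numeral. -/
theorem moves_carry {b : ℕ} {dg : Fin B → ℕ} {st : Fin B → ℕ → Fin B} (hdg : ∀ a, dg a < b)
    (hst : ∀ a x, x < b → dg (st a x) = x)
    (h1 : ∀ a, dg a + 1 < b → δ q (some a) = some (q₁, some (st a (dg a + 1)), none))
    (h2 : ∀ a, ¬ dg a + 1 < b → δ q (some a) = some (q, some (st a 0), some .right))
    (w : List (Fin B)) (l r : List (Option (Fin B))) (hl : l.length + w.length ≤ H) :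
    (wordValue b dg w + 1 < b ^ w.length ∧ ∃ u z, z ≠ [] ∧
      List.Forall₂ (Changed b st) (u ++ z) w ∧ wordValue b dg (u ++ z) = wordValue b dg w + 1 ∧
      Moves δ H (q, l, w.map some ++ r) (q₁, (u.map some).reverse ++ l, z.map some ++ r)) ∨
    (wordValue b dg w + 1 = b ^ w.length ∧ ∃ w', List.Forall₂ (Changed b st) w' w ∧
      wordValue b dg w' = 0 ∧
      Moves δ H (q, l, w.map some ++ r) (q, (w'.map some).reverse ++ l, r)) := by
  induction w generalizing l with
  | nil => exact Or.inr ⟨by simp, [], .nil, by simp, .refl⟩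
  | cons a w ih =>
    have hb : 0 < b := (Nat.zero_le _).trans_lt (hdg a)
    simp only [List.length_cons] at hl
    by_cases ha : dg a + 1 < b
    · refine Or.inl ⟨?_, [], st a (dg a + 1) :: w, by simp, .cons (Or.inr ⟨_, ha, rfl⟩)
        (forall₂_changed_refl w), ?_, .single (Move.stay (h1 a ha))⟩
      · have := wordValue_lt hdg w
        rw [wordValue_cons, List.length_cons, pow_succ]
        nlinarith
      · simp only [List.nil_append, wordValue_cons, hst _ _ ha]; ring
    · have hm : Move δ H (q, l, (a :: w).map some ++ r) (q, some (st a 0) :: l, w.map some ++ r) :=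
        Move.right (h2 a ha) (by omega)
      have ha' : dg a + 1 = b := by have := hdg a; omega
      have e : wordValue b dg (a :: w) + 1 = b * (wordValue b dg w + 1) := by
        rw [wordValue_cons]; nlinarith
      rcases ih (some (st a 0) :: l) (by simp; omega) with ⟨h3, u, z, hz, hf, hv, hp⟩ | ⟨h3, w', hf, hv, hp⟩
      · refine Or.inl ⟨?_, st a 0 :: u, z, hz, .cons (Or.inr ⟨0, hb, rfl⟩) hf, ?_, ?_⟩
        · rw [e, List.length_cons, pow_succ, mul_comm]
          exact Nat.mul_lt_mul_of_pos_right h3 hb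
        · rw [List.cons_append, wordValue_cons, hst _ _ hb, hv, e]; ring
        · refine .head hm ?_
          simpa using hp
      · refine Or.inr ⟨?_, st a 0 :: w', .cons (Or.inr ⟨0, hb, rfl⟩) hf, ?_, ?_⟩
        · rw [e, h3, List.length_cons, pow_succ, mul_comm]
        · rw [wordValue_cons, hst _ _ hb, hv]; simp
        · refine .head hm ?_
          simpa using hp

/-- Dual to the carry. If the word denotes `0`, the borrow passes through it; the digits it then
contains do not matter to any caller. -/
theorem moves_borrow {b : ℕ} {dg : Fin B → ℕ} {st : Fin B → ℕ → Fin B} (hdg : ∀ a, dg a < b)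
    (hst : ∀ a x, x < b → dg (st a x) = x)
    (h1 : ∀ a, dg a ≠ 0 → δ q (some a) = some (q₁, some (st a (dg a - 1)), none))
    (h2 : ∀ a, dg a = 0 → δ q (some a) = some (q, some (st a (b - 1)), some .right))
    (w : List (Fin B)) (l r : List (Option (Fin B))) (hl : l.length + w.length ≤ H) :
    (∃ u z, z ≠ [] ∧
      List.Forall₂ (Changed b st) (u ++ z) w ∧ wordValue b dg (u ++ z) + 1 = wordValue b dg w ∧
      Moves δ H (q, l, w.map some ++ r) (q₁, (u.map some).reverse ++ l, z.map some ++ r)) ∨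
    (wordValue b dg w = 0 ∧ ∃ w', List.Forall₂ (Changed b st) w' w ∧
      Moves δ H (q, l, w.map some ++ r) (q, (w'.map some).reverse ++ l, r)) := by
  induction w generalizing l with
  | nil => exact Or.inr ⟨by simp, [], .nil, .refl⟩
  | cons a w ih =>
    have hb : 0 < b := (Nat.zero_le _).trans_lt (hdg a)
    simp only [List.length_cons] at hl
    by_cases ha : dg a ≠ 0
    · have := hdg a
      refine Or.inl ⟨[], st a (dg a - 1) :: w, by simp, .cons (Or.inr ⟨_, by omega, rfl⟩)
        (forall₂_changed_refl w), ?_, .single (Move.stay (h1 a ha))⟩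
      simp only [List.nil_append, wordValue_cons]
      rw [hst _ _ (by omega)]; omega
    · rw [not_not] at ha
      have hm : Move δ H (q, l, (a :: w).map some ++ r)
          (q, some (st a (b - 1)) :: l, w.map some ++ r) := Move.right (h2 a ha) (by omega)
      rcases ih (some (st a (b - 1)) :: l) (by simp; omega) with ⟨u, z, hz, hf, hv, hp⟩ | ⟨h3, w', hf, hp⟩
      · refine Or.inl ⟨st a (b - 1) :: u, z, hz, .cons (Or.inr ⟨_, by omega, rfl⟩) hf, ?_, ?_⟩
        · rw [List.cons_append, wordValue_cons, hst _ _ (by omega), wordValue_cons, ha, ← hv, mul_add]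
          omega
        · refine .head hm ?_
          simpa using hp
      · refine Or.inr ⟨by rw [wordValue_cons, ha, h3]; simp, st a (b - 1) :: w',
          .cons (Or.inr ⟨_, by omega, rfl⟩) hf, ?_⟩
        refine .head hm ?_
        simpa using hp

theorem moves_test {b : ℕ} {dg : Fin B → ℕ} (hb : 0 < b)
    (h1 : ∀ a, dg a ≠ 0 → δ q (some a) = some (q₁, some a, none))
    (h2 : ∀ a, dg a = 0 → δ q (some a) = some (q, some a, some .right))
    (w : List (Fin B)) (l r : List (Option (Fin B))) (hl : l.length + w.length ≤ H) :
    (wordValue b dg w ≠ 0 ∧ ∃ u z, z ≠ [] ∧ u ++ z = w ∧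
      Moves δ H (q, l, w.map some ++ r) (q₁, (u.map some).reverse ++ l, z.map some ++ r)) ∨
    (wordValue b dg w = 0 ∧
      Moves δ H (q, l, w.map some ++ r) (q, (w.map some).reverse ++ l, r)) := by
  induction w generalizing l with
  | nil => exact Or.inr ⟨by simp, .refl⟩
  | cons a w ih =>
    simp only [List.length_cons] at hl
    by_cases ha : dg a ≠ 0
    · exact Or.inl ⟨by simp [ha], [], a :: w, by simp, rfl, .single (Move.stay (h1 a ha))⟩
    · rw [not_not] at ha
      have hm : Move δ H (q, l, (a :: w).map some ++ r)
          (q, some a :: l, w.map some ++ r) := Move.right (h2 a ha) (by omega)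
      rcases ih (some a :: l) (by simp; omega) with ⟨h3, u, z, hz, rfl, hp⟩ | ⟨h3, hp⟩
      · refine Or.inl ⟨?_, a :: u, z, hz, rfl, ?_⟩
        · rw [wordValue_cons, ha, zero_add]
          exact Nat.mul_ne_zero hb.ne' h3
        · refine .head hm ?_
          simpa using hp
      · refine Or.inr ⟨by rw [wordValue_cons, ha, h3]; simp, ?_⟩
        refine .head hm ?_
        simpa using hp

/-- The first symbol of the word, and no other, is marked. -/
def MarkedFirst (mk : Fin B → Bool) (w : List (Fin B)) : Prop :=
  ∃ n, w.map mk = true :: List.replicate n false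

theorem MarkedFirst.exists_cons {mk : Fin B → Bool} {w : List (Fin B)} (h : MarkedFirst mk w) :
    ∃ s ws, w = s :: ws ∧ mk s = true ∧ ∀ x ∈ ws, mk x = false := by
  obtain ⟨n, h⟩ := h
  cases w with
  | nil => simp at h
  | cons s ws =>
    simp only [List.map_cons, List.cons.injEq] at h
    refine ⟨s, ws, rfl, h.1, fun x hx => ?_⟩
    have : mk x ∈ ws.map mk := List.mem_map_of_mem hx
    rw [h.2] at this
    exact List.eq_of_mem_replicate this

/-- The head stands on the first symbol of `z`, inside the word. The mark tells it where the tape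
begins, which it could not recognize otherwise. -/
theorem moves_home {mk : Fin B → Bool} (h : ∀ s, δ q (some s) =
      if mk s then some (q₁, some s, none) else some (q, some s, some .left))
    {u z : List (Fin B)} (hw : MarkedFirst mk (u ++ z)) (hz : z ≠ []) (r : List (Option (Fin B))) :
    Moves δ H (q, (u.map some).reverse, z.map some ++ r) (q₁, [], (u ++ z).map some ++ r) := by
  obtain ⟨s, ws, e, hs, hws⟩ := hw.exists_cons
  obtain ⟨x, z, rfl⟩ := List.exists_cons_of_ne_nil hz
  cases u with
  | nil =>
    obtain ⟨rfl, rfl⟩ : x = s ∧ z = ws := by simpa using e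
    exact .single (Move.stay (by rw [h, if_pos hs]))
  | cons s' u =>
    simp only [List.cons_append, List.cons.injEq] at e
    obtain ⟨rfl, rfl⟩ := e
    have h1 := sweep_left (δ := δ) (H := H) (q := q) (g := some) (u ++ [x]).reverse (x := some x)
      (c := some s') (l := []) (l' := ((s' :: u).map some).reverse) (z.map some ++ r) (by simp)
      (fun y hy => by
        rw [h, if_neg]
        have : y = x ∨ y ∈ u := by simpa [or_comm] using hy
        rw [hws y (by rcases this with rfl | h <;> simp [*])]
        simp)
    refine (h1.tail (Move.stay (q' := q₁) (a' := some s') (by rw [h, if_pos hs]))).trans ?_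
    simp only [List.map_reverse, List.reverse_reverse]
    simp
    exact .refl

theorem moves_left_home {mk : Fin B → Bool} (h : ∀ s, δ q (some s) =
      if mk s then some (q₁, some s, none) else some (q, some s, some .left))
    (h2 : δ q₂ none = some (q, none, some .left))
    {w : List (Fin B)} (hw : MarkedFirst mk w) (r : List (Option (Fin B))) :
    Moves δ H (q₂, (w.map some).reverse, none :: r) (q₁, [], w.map some ++ none :: r) := by
  rcases List.eq_nil_or_concat w with rfl | ⟨u, x, rfl⟩
  · obtain ⟨s, ws, e, -⟩ := hw.exists_cons
    simp at e
  · have := moves_home (H := H) h (u := u) (z := [x]) (by simpa using hw) (by simp) (none :: r)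
    refine .head (b := (q, (u.map some).reverse, some x :: none :: r)) ?_ ?_
    · simpa using Move.left (δ := δ) (H := H) (c := some x) (l := (u.map some).reverse) (r := r) h2
    · simpa using this

end Sweeps

end TuringSpace

/-! ### The area with its tracks, and the instructions acting on it -/

namespace TuringSpace

open Relation

section Changes

variable {B b : ℕ} {st : Fin B → ℕ → Fin B} {w w' : List (Fin B)}

theorem map_eq_of_forall₂_changed {α : Type} {g : Fin B → α}
    (h : List.Forall₂ (Changed b st) w' w) (hg : ∀ a x, x < b → g (st a x) = g a) :
    w'.map g = w.map g := by
  induction h with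
  | nil => rfl
  | @cons a' a _ _ h _ ih =>
    rw [List.map_cons, List.map_cons, ih]
    rcases h with rfl | ⟨x, hx, rfl⟩
    · rfl
    · rw [hg _ _ hx]

theorem moves_unblank {δ : Quintuples B Λ} {H : ℕ} (q : Λ) (l r : List (Option (Fin B))) (j : ℕ) :
    Moves δ H (q, l, r ++ List.replicate j none) (q, l, r) := by
  induction j with
  | zero => simpa using ReflTransGen.refl
  | succ j ih =>
    rw [List.replicate_succ', ← List.append_assoc]
    exact .head Move.unblank ih

end Changes

section Area

variable {D m : ℕ} [NeZero D]

/-- The word `w` is an area with the numbers `v t` on its tracks. -/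
def Area (w : List (Fin (alphabetSize D m))) (v : ℕ → ℕ) : Prop :=
  MarkedFirst isFirst w ∧ ∀ t < m, wordValue D (trackDigit t) w = v t

variable {w w' : List (Fin (alphabetSize D m))} {v : ℕ → ℕ} {t : ℕ}

theorem Area.ne_nil (h : Area w v) : w ≠ [] := by
  obtain ⟨s, ws, rfl, -⟩ := h.1.exists_cons
  simp

theorem Area.of_changed (h : Area w v)
    (hc : List.Forall₂ (Changed D (setDigit t)) w' w) {x : ℕ}
    (hx : wordValue D (trackDigit t) w' = x) : Area w' (Function.update v t x) := by
  obtain ⟨⟨n, h1⟩, h2⟩ := h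
  refine ⟨⟨n, (map_eq_of_forall₂_changed hc fun a x _ => isFirst_setDigit t a x).trans h1⟩,
    fun t' ht' => ?_⟩
  by_cases e : t' = t
  · subst e; simpa using hx
  · rw [Function.update_of_ne e, ← h2 t' ht', wordValue, wordValue,
      map_eq_of_forall₂_changed hc fun a x _ => trackDigit_setDigit_of_ne ht' e x a]

theorem Area.congr {v' : ℕ → ℕ} (h : Area w v) (hv : ∀ t < m, v t = v' t) : Area w v' :=
  ⟨h.1, fun t ht => (h.2 t ht).trans (hv t ht)⟩

/-- The new cell holds the most significant digits, of place value `D ^ w.length`, on all tracks at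
once. -/
theorem Area.append (h : Area w v) (v' : ℕ → ℕ) (hv' : ∀ t, v' t < D) :
    Area (w ++ [mkSymbol D m v' false]) (fun t => v t + D ^ w.length * v' t) := by
  obtain ⟨⟨n, h1⟩, h2⟩ := h
  refine ⟨⟨n + 1, by simp [h1, List.replicate_succ']⟩, fun t ht => ?_⟩
  rw [wordValue_append, h2 t ht]
  simp [trackDigit_mkSymbol ht, Nat.mod_eq_of_lt (hv' t)]

theorem Area.length_pos (h : Area w v) : 0 < w.length := List.length_pos_of_ne_nil h.ne_nil

variable {f : ℕ → Bool → Prog} {H : ℕ}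

/-- The machine is about to execute the stack of programs `k`, with a given area and raw numeral. -/
abbrev atStart (k : List Prog) (w raw : List (Fin (alphabetSize D m))) :
    (List Prog × Phase (alphabetSize D m)) × List (Option (Fin (alphabetSize D m))) ×
      List (Option (Fin (alphabetSize D m))) :=
  ((k, .start), [], w.map some ++ none :: raw.map some)

theorem moves_back {k : List Prog} {b : Bool} {u z raw : List (Fin (alphabetSize D m))}
    (hw : Area (u ++ z) v) (hz : z ≠ []) :
    Moves (progTable f) H ((k, .back b), (u.map some).reverse, z.map some ++ none :: raw.map some)
      (atStart (nextStack k b) (u ++ z) raw) :=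
  moves_home (fun s => by simp only [progTable]) hw.1 hz _

/-- The symbol displaced from each cell is carried in the state to the next one, which shifts the
raw numeral one place to the right. -/
theorem moves_insert {k : List Prog} (raw : List (Fin (alphabetSize D m)))
    (c : Option (Fin (alphabetSize D m))) (l : List (Option (Fin (alphabetSize D m))))
    (hl : l.length + raw.length ≤ H) :
    ∃ x l', x :: l' = (raw.map some).reverse ++ c :: l ∧
      Moves (progTable f) H ((k, .insert c), l, raw.map some) ((k, .insertBack), l', [x]) := by
  induction raw generalizing c l with
  | nil =>
    refine ⟨c, l, rfl, ?_⟩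
    refine .head Move.blank (.single ?_)
    exact Move.stay (by simp only [progTable])
  | cons a raw ih =>
    simp only [List.length_cons] at hl
    obtain ⟨x, l', h1, h2⟩ := ih (some a) (c :: l) (by simp; omega)
    refine ⟨x, l', by simpa using h1, .head (Move.right ?_ (by omega)) h2⟩
    simp only [progTable]

/-- By `hv` the new count still fits into the present cells, so that counting the cells never
enlarges the area again. -/
theorem moves_incCount (hm : 0 < m) {k : List Prog} {w raw : List (Fin (alphabetSize D m))}
    (hw : Area w v) (hH : w.length ≤ H) (hv : v 0 + 1 < D ^ w.length) :
    ∃ w', Area w' (Function.update v 0 (v 0 + 1)) ∧ w'.length = w.length ∧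
      Moves (progTable f) H ((k, .incCount), [], w.map some ++ none :: raw.map some)
        (atStart (nextStack k true) w' raw) := by
  have h3 := moves_carry (δ := progTable f) (H := H) (q := (k, .incCount)) (q₁ := (k, .back true))
    (b := D) (dg := trackDigit 0) (st := setDigit 0) (trackDigit_lt 0)
    (fun a x hx => trackDigit_setDigit_self hm hx a)
    (fun a ha => by simp only [progTable, if_pos ha]) (fun a ha => by simp only [progTable, if_neg ha])
    w [] (none :: raw.map some) (by simpa using hH)
  rw [hw.2 0 hm] at h3
  rcases h3 with ⟨-, u, z, hz, hc, he, h3⟩ | ⟨h3, -⟩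
  · have ha := hw.of_changed hc he
    refine ⟨u ++ z, ha, hc.length_eq, ?_⟩
    rw [List.append_nil] at h3
    exact h3.trans (moves_back ha hz)
  · omega

theorem moves_insertBack (hm : 0 < m) {k : List Prog} {w raw : List (Fin (alphabetSize D m))}
    (hw : Area w v) (hH : w.length ≤ H) (hv : v 0 + 1 < D ^ w.length)
    {x : Option (Fin (alphabetSize D m))} {l' : List (Option (Fin (alphabetSize D m)))}
    (hx : x :: l' = (raw.map some).reverse ++ none :: (w.map some).reverse) :
    ∃ w', Area w' (Function.update v 0 (v 0 + 1)) ∧ w'.length = w.length ∧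
      Moves (progTable f) H ((k, .insertBack), l', [x]) (atStart (nextStack k true) w' raw) := by
  have h1 := sweep_left (δ := progTable f) (H := H) (q := (k, .insertBack)) (g := some) raw.reverse
    (l := (w.map some).reverse) (c := none) [] (by simpa using hx) (fun y _ => by simp only [progTable])
  simp only [List.map_reverse, List.reverse_reverse, List.append_nil] at h1
  have h2 := moves_left_home (δ := progTable f) (H := H) (q := (k, .backCount)) (q₁ := (k, .incCount))
    (q₂ := (k, .insertBack)) (mk := isFirst) (fun s => by simp only [progTable])
    (by simp only [progTable]) hw.1 (raw.map some)
  obtain ⟨w', hw', hl, h3⟩ := moves_incCount (f := f) (k := k) (raw := raw) hm hw hH hv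
  exact ⟨w', hw', hl, (h1.trans h2).trans h3⟩

/-- From any area with the numbers `v` and `n` cells the machine passes to an area with the numbers
`v'` and `n'` cells, the stack and the raw numeral changing as described. -/
def Runs (f : ℕ → Bool → Prog) (H : ℕ) (k : List Prog) (v : ℕ → ℕ) (n : ℕ)
    (raw : List (Fin (alphabetSize D m))) (k' : List Prog) (v' : ℕ → ℕ) (n' : ℕ)
    (raw' : List (Fin (alphabetSize D m))) : Prop :=
  ∀ w, Area w v → w.length = n → ∃ w', Area w' v' ∧ w'.length = n' ∧
    Moves (progTable f) H (atStart k w raw) (atStart k' w' raw')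

/-- The number of cells used for the raw numeral. -/
def room (raw : List (Fin (alphabetSize D m))) : ℕ := if raw = [] then 0 else raw.length + 1

theorem length_le_room (raw : List (Fin (alphabetSize D m))) : raw.length ≤ room raw := by
  unfold room; split_ifs with h <;> simp [h]

variable {k k' k'' : List Prog} {v' v'' : ℕ → ℕ} {n n' n'' : ℕ}
  {raw raw' raw'' : List (Fin (alphabetSize D m))}

theorem Runs.trans (h1 : Runs f H k v n raw k' v' n' raw') (h2 : Runs f H k' v' n' raw' k'' v'' n'' raw'') :
    Runs f H k v n raw k'' v'' n'' raw'' := by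
  intro w hw hn
  obtain ⟨w', hw', hn', h⟩ := h1 w hw hn
  obtain ⟨w'', hw'', hn'', h'⟩ := h2 w' hw' hn'
  exact ⟨w'', hw'', hn'', h.trans h'⟩

theorem Runs.skip : Runs f H (.skip :: k) v n raw k v n raw := by
  intro w hw hn
  refine ⟨w, hw, hn, ?_⟩
  obtain ⟨s, ws, rfl, hs, -⟩ := hw.1.exists_cons
  exact .single (Move.stay (by simp only [progTable, startTable]))

theorem Runs.seq {p q : Prog} : Runs f H (.seq p q :: k) v n raw (p :: q :: k) v n raw := by
  intro w hw hn
  refine ⟨w, hw, hn, ?_⟩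
  obtain ⟨s, ws, rfl, hs, -⟩ := hw.1.exists_cons
  exact .single (Move.stay (by simp only [progTable, startTable]))

theorem Runs.inc {t : ℕ} (ht : t < m) (h : v t + 1 < D ^ n) (hH : n ≤ H) :
    Runs f H (.inc t :: k) v n raw k (Function.update v t (v t + 1)) n raw := by
  rintro w hw rfl
  have h3 := moves_carry (δ := progTable f) (H := H) (q := (.inc t :: k, .start))
    (q₁ := (.inc t :: k, .back true)) (b := D) (dg := trackDigit t) (st := setDigit t) (trackDigit_lt t)
    (fun a x hx => trackDigit_setDigit_self ht hx a)
    (fun a ha => by simp only [progTable, startTable, if_pos ha])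
    (fun a ha => by simp only [progTable, startTable, if_neg ha])
    w [] (none :: raw.map some) (by simpa using hH)
  rw [hw.2 t ht] at h3
  rcases h3 with ⟨-, u, z, hz, hc, he, h3⟩ | ⟨h3, -⟩
  · have ha := hw.of_changed hc he
    rw [List.append_nil] at h3
    exact ⟨u ++ z, ha, hc.length_eq, h3.trans (moves_back ha hz)⟩
  · omega

/-- All digits on track `t` were maximal and have become `0`; the digit `1` in a new cell supplies
the value `D ^ n`. The new cell has to be counted on track `0` as well. -/
theorem Runs.inc_overflow {t : ℕ} (ht : t < m) (h0 : t ≠ 0) (h : v t + 1 = D ^ n)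
    (hc : v 0 + 1 < D ^ (n + 1)) (hD : 2 ≤ D) (hH : n + 1 + room raw ≤ H) :
    Runs f H (.inc t :: k) v n raw k
      (Function.update (Function.update v t (v t + 1)) 0 (v 0 + 1)) (n + 1) raw := by
  rintro w hw rfl
  have hr := length_le_room raw
  have h3 := moves_carry (δ := progTable f) (H := H) (q := (.inc t :: k, .start))
    (q₁ := (.inc t :: k, .back true)) (b := D) (dg := trackDigit t) (st := setDigit t) (trackDigit_lt t)
    (fun a x hx => trackDigit_setDigit_self ht hx a)
    (fun a ha => by simp only [progTable, startTable, if_pos ha])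
    (fun a ha => by simp only [progTable, startTable, if_neg ha])
    w [] (none :: raw.map some) (by simp; omega)
  rw [hw.2 t ht] at h3
  rcases h3 with ⟨h3, -⟩ | ⟨-, w₁, hc₁, he, h3⟩
  · omega
  have ha := (hw.of_changed hc₁ he).append (fun i => if i = t then 1 else 0)
    (fun i => by split_ifs <;> omega)
  rw [hc₁.length_eq] at ha
  set x := mkSymbol D m (fun i => if i = t then 1 else 0) false with hxdef
  have ha2 : Area (w₁ ++ [x]) (Function.update v t (v t + 1)) := ha.congr fun i _ => by
    by_cases hi : i = t
    · subst hi; simp [h]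
    · simp [hi]
  have hlen : (w₁ ++ [x]).length = w.length + 1 := by simp [hc₁.length_eq]
  obtain ⟨y, l', hx, h4⟩ := moves_insert (f := f) (H := H) (k := .inc t :: k) raw none
    ((w₁ ++ [x]).map some).reverse (by
      rw [List.length_reverse, List.length_map, hlen]; omega)
  obtain ⟨w', hw', hl', h5⟩ := moves_insertBack (f := f) (H := H) (k := .inc t :: k) (raw := raw)
    (by omega) ha2 (by omega) (by rw [hlen, Function.update_of_ne h0.symm]; exact hc) hx
  refine ⟨w', ?_, hl'.trans hlen, ?_⟩
  · simpa [Function.update_of_ne h0.symm] using hw'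
  · refine (h3.tail ?_).trans (h4.trans h5)
    have := Move.right (δ := progTable f) (H := H) (q := (.inc t :: k, .start))
      (q' := (.inc t :: k, .insert none)) (a := none) (a' := some x)
      (l := (w₁.map some).reverse ++ []) (r := raw.map some) (by simp only [progTable, startTable]; rfl)
      (by simp [hc₁.length_eq]; omega)
    simpa using this

theorem Runs.grow (hm : 0 < m) (hc : v 0 + 1 < D ^ (n + 1)) (hH : n + 1 + room raw ≤ H) :
    Runs f H (.grow :: k) v n raw k (Function.update v 0 (v 0 + 1)) (n + 1) raw := by
  rintro w hw rfl
  have hr := length_le_room raw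
  have h3 := sweep_right (δ := progTable f) (H := H) (q := (.grow :: k, .start)) (g := some) w
    (fun a _ => by simp only [progTable, startTable]) [] (none :: raw.map some) (by simp; omega)
  have ha := hw.append 0 (fun _ => NeZero.pos D)
  set x := mkSymbol D m 0 false with hxdef
  have ha2 : Area (w ++ [x]) v := ha.congr fun i _ => by simp
  have hlen : (w ++ [x]).length = w.length + 1 := by simp
  obtain ⟨y, l', hx, h4⟩ := moves_insert (f := f) (H := H) (k := .grow :: k) raw none
    ((w ++ [x]).map some).reverse (by
      rw [List.length_reverse, List.length_map, hlen]; omega)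
  obtain ⟨w', hw', hl', h5⟩ := moves_insertBack (f := f) (H := H) (k := .grow :: k) (raw := raw)
    (by omega) ha2 (by omega) (by rw [hlen]; exact hc) hx
  refine ⟨w', hw', hl'.trans hlen, ?_⟩
  refine (h3.tail ?_).trans (h4.trans h5)
  have := Move.right (δ := progTable f) (H := H) (q := (.grow :: k, .start))
    (q' := (.grow :: k, .insert none)) (a := none) (a' := some x)
    (l := (w.map some).reverse ++ []) (r := raw.map some) (by simp only [progTable, startTable]; rfl)
    (by simp; omega)
  simpa using this

theorem Runs.dec {t j : ℕ} (ht : t < m) (h : v t = j + 1) (hH : n ≤ H) :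
    Runs f H (.dec t :: k) v n raw k (Function.update v t j) n raw := by
  rintro w hw rfl
  have h3 := moves_borrow (δ := progTable f) (H := H) (q := (.dec t :: k, .start))
    (q₁ := (.dec t :: k, .back true)) (b := D) (dg := trackDigit t) (st := setDigit t) (trackDigit_lt t)
    (fun a x hx => trackDigit_setDigit_self ht hx a)
    (fun a ha => by simp only [progTable, startTable, if_neg ha])
    (fun a ha => by simp only [progTable, startTable, if_pos ha])
    w [] (none :: raw.map some) (by simpa using hH)
  rw [hw.2 t ht] at h3
  rcases h3 with ⟨u, z, hz, hc, he, h3⟩ | ⟨h3, -⟩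
  · have ha := hw.of_changed hc (x := j) (by omega)
    rw [List.append_nil] at h3
    exact ⟨u ++ z, ha, hc.length_eq, h3.trans (moves_back ha hz)⟩
  · omega

theorem moves_loop_test {t : ℕ} {p : Prog} (ht : t < m) {w : List (Fin (alphabetSize D m))}
    (hw : Area w v) (hH : w.length ≤ H) :
    Moves (progTable f) H (atStart (.loop t p :: k) w raw)
      (atStart (if v t ≠ 0 then p :: .loop t p :: k else k) w raw) := by
  have h3 := moves_test (δ := progTable f) (H := H) (q := (.loop t p :: k, .start))
    (q₁ := (.loop t p :: k, .back true)) (b := D) (dg := trackDigit t) (NeZero.pos D)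
    (fun a ha => by simp only [progTable, startTable, if_neg ha])
    (fun a ha => by simp only [progTable, startTable, if_pos ha])
    w [] (none :: raw.map some) (by simpa using hH)
  rw [hw.2 t ht, List.append_nil] at h3
  rcases h3 with ⟨h, u, z, hz, rfl, h3⟩ | ⟨h, h3⟩
  · rw [if_pos h]
    rw [List.append_nil] at h3
    exact h3.trans (moves_back hw hz)
  · rw [if_neg (by simpa using h)]
    exact h3.trans (moves_left_home (δ := progTable f) (H := H) (q := (.loop t p :: k, .back false))
      (mk := isFirst) (fun s => by simp only [progTable]; rfl)
      (by simp only [progTable, startTable]) hw.1 (raw.map some))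

theorem Runs.loop {t : ℕ} {p : Prog} (ht : t < m) (hH : n ≤ H) :
    Runs f H (.loop t p :: k) v n raw (if v t ≠ 0 then p :: .loop t p :: k else k) v n raw := by
  rintro w hw rfl
  exact ⟨w, hw, rfl, moves_loop_test ht hw hH⟩

/-- A number is at least `D` exactly if some digit after the first is not `0`; the machine therefore
skips the first cell and tests the others. -/
theorem Runs.ifBig {t : ℕ} {p q : Prog} (ht : t < m) (hH : n ≤ H) :
    Runs f H (.ifBig t p q :: k) v n raw ((if D ≤ v t then p else q) :: k) v n raw := by
  rintro w hw rfl
  refine ⟨w, hw, rfl, ?_⟩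
  obtain ⟨s, ws, rfl, hs, -⟩ := hw.1.exists_cons
  simp only [List.length_cons] at hH
  have e := hw.2 t ht
  rw [wordValue_cons] at e
  have hD := trackDigit_lt t s
  have h1 : Move (progTable f) H (atStart (.ifBig t p q :: k) (s :: ws) raw)
      ((.ifBig t p q :: k, .test), [some s], ws.map some ++ none :: raw.map some) :=
    Move.right (by simp only [progTable, startTable]) (by simp; omega)
  have h3 := moves_test (δ := progTable f) (H := H) (q := (.ifBig t p q :: k, .test))
    (q₁ := (.ifBig t p q :: k, .back true)) (b := D) (dg := trackDigit t) (NeZero.pos D)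
    (fun a ha => by simp only [progTable, if_neg ha])
    (fun a ha => by simp only [progTable, if_pos ha])
    ws [some s] (none :: raw.map some) (by simp; omega)
  rcases h3 with ⟨h, u, z, hz, rfl, h3⟩ | ⟨h, h3⟩
  · rw [if_pos (by nlinarith [Nat.pos_of_ne_zero h])]
    refine .head h1 (h3.trans ?_)
    have := moves_back (f := f) (H := H) (k := .ifBig t p q :: k) (b := true) (u := s :: u) (z := z)
      (raw := raw) hw hz
    simpa [nextStack] using this
  · rw [if_neg (by rw [h] at e; omega)]
    refine .head h1 (h3.trans ?_)
    have := moves_left_home (δ := progTable f) (H := H) (q := (.ifBig t p q :: k, .back false))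
      (q₂ := (.ifBig t p q :: k, .test)) (q₁ := (q :: k, .start)) (w := s :: ws)
      (mk := isFirst) (fun s => by simp only [progTable]; rfl)
      (by simp only [progTable]) hw.1 (raw.map some)
    simpa [atStart] using this

end Area

end TuringSpace

/-! ### The raw numeral, the start of the machine, and the output -/

namespace TuringSpace

open Relation

section RawNumeral

variable {D m : ℕ} [NeZero D] {f : ℕ → Bool → Prog} {H : ℕ} {k : List Prog} {v : ℕ → ℕ} {n : ℕ}
  {raw : List (Fin (alphabetSize D m))}

/-- The number denoted by the raw numeral. -/
abbrev rawValue (raw : List (Fin (alphabetSize D m))) : ℕ := wordValue (alphabetSize D m) Fin.val raw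

theorem val_rawDigit {d : ℕ} (hd : d < alphabetSize D m) : (rawDigit D m d : ℕ) = d :=
  Nat.mod_eq_of_lt hd

theorem moves_rawBack {b : Bool} {w u z : List (Fin (alphabetSize D m))} (hw : Area w v)
    (hz : z ≠ []) :
    Moves (progTable f) H
      ((k, .rawBack b), (u.map some).reverse ++ none :: (w.map some).reverse, z.map some)
      (atStart (nextStack k b) w (u ++ z)) := by
  obtain ⟨x, z, rfl⟩ := List.exists_cons_of_ne_nil hz
  obtain ⟨y, l', hx⟩ : ∃ y l', y :: l' = (u.map some).reverse ++ none :: (w.map some).reverse := by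
    obtain ⟨y, l', h⟩ := List.exists_cons_of_ne_nil
      (l := (u.map some).reverse ++ none :: (w.map some).reverse) (by simp)
    exact ⟨y, l', h.symm⟩
  rw [← hx]
  refine .head (b := ((k, .rawBack b), l', y :: (x :: z).map some))
    (Move.left (by simp only [progTable])) ?_
  have h1 := sweep_left (δ := progTable f) (H := H) (q := (k, .rawBack b)) (g := some) u.reverse
    (l := (w.map some).reverse) (c := none) ((x :: z).map some) (by simpa using hx)
    (fun y _ => by simp only [progTable])
  refine h1.trans ?_
  have := moves_left_home (δ := progTable f) (H := H) (q := (k, .back b))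
    (q₂ := (k, .rawBack b)) (q₁ := (nextStack k b, .start)) (w := w)
    (mk := isFirst) (fun s => by simp only [progTable])
    (by simp only [progTable]) hw.1 ((u ++ x :: z).map some)
  simpa [atStart] using this

/-- The move from the area to the raw numeral. -/
theorem moves_to_raw {p : Prog} {ph : Phase (alphabetSize D m)} {w : List (Fin (alphabetSize D m))}
    (h1 : ∀ a, progTable (D := D) (m := m) f (p :: k, .start) (some a)
      = some ((p :: k, .start), some a, some .right))
    (h2 : progTable (D := D) (m := m) f (p :: k, .start) none
      = some ((p :: k, ph), none, some .right)) (hH : w.length + 1 ≤ H) :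
    Moves (progTable f) H (atStart (p :: k) w raw)
      ((p :: k, ph), none :: (w.map some).reverse, raw.map some) := by
  have h3 := sweep_right (δ := progTable f) (H := H) (q := (p :: k, .start)) (g := some) w
    (fun a _ => h1 a) [] (none :: raw.map some) (by simp; omega)
  have := h3.tail (Move.right h2 (by simpa using hH))
  simpa using this

/-- The raw numeral of a given length with a given value. -/
def rawWord (D m : ℕ) [NeZero D] : ℕ → ℕ → List (Fin (alphabetSize D m))
  | 0, _ => []
  | l + 1, x => rawDigit D m x :: rawWord D m l (x / alphabetSize D m)

@[simp] theorem length_rawWord (l x : ℕ) : (rawWord D m l x).length = l := by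
  induction l generalizing x with
  | zero => rfl
  | succ l ih => simp [rawWord, ih]

theorem rawValue_rawWord {l x : ℕ} (hx : x < alphabetSize D m ^ l) :
    rawValue (rawWord D m l x) = x := by
  induction l generalizing x with
  | zero => simp_all [rawWord]
  | succ l ih =>
    rw [rawWord, rawValue, wordValue_cons, ← rawValue, ih (Nat.div_lt_of_lt_mul (by rwa [← pow_succ']))]
    exact Nat.mod_add_div _ _

/-- A numeral of fixed length is determined by its value. This identifies the word left behind by a
carry or a borrow, of which only value and length are known. -/
theorem rawWord_rawValue (raw : List (Fin (alphabetSize D m))) :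
    rawWord D m raw.length (rawValue raw) = raw := by
  have hB := two_le_alphabetSize D m
  induction raw with
  | nil => rfl
  | cons a raw ih =>
    rw [List.length_cons, rawWord, rawValue, wordValue_cons, Nat.add_mul_div_left _ _ (by omega),
      Nat.div_eq_of_lt a.2, zero_add, ih]
    congr 1
    apply Fin.ext
    simp only [rawDigit, Nat.add_mul_mod_self_left]
    exact Nat.mod_eq_of_lt a.2

theorem rawWord_zero_append (l : ℕ) : rawWord D m l 0 ++ [rawDigit D m 0] = rawWord D m (l + 1) 0 := by
  induction l with
  | zero => simp [rawWord]
  | succ l ih =>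
    rw [rawWord, Nat.zero_div, List.cons_append, ih]
    simp [rawWord]

theorem Runs.append (hH : n + 1 + raw.length ≤ H) :
    Runs f H (.append :: k) v n raw k v n (raw ++ [rawDigit D m 0]) := by
  rintro w hw rfl
  refine ⟨w, hw, rfl, ?_⟩
  have h1 := moves_to_raw (f := f) (k := k) (p := .append) (ph := .rawEnd) (raw := raw) (w := w)
    (H := H) (fun a => by simp only [progTable, startTable]) (by simp only [progTable, startTable])
    (by omega)
  have h2 := sweep_right (δ := progTable f) (H := H) (q := (.append :: k, .rawEnd)) (g := some) raw
    (fun a _ => by simp only [progTable]) (none :: (w.map some).reverse) [] (by simp; omega)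
  rw [List.append_nil] at h2
  refine h1.trans (h2.trans ?_)
  refine .head Move.blank (.head (Move.stay (q' := (.append :: k, .rawBack true))
    (a' := some (rawDigit D m 0)) (by simp only [progTable])) ?_)
  exact moves_rawBack hw (z := [rawDigit D m 0]) (by simp)

theorem Runs.incRaw {l x : ℕ} (h : x + 1 < alphabetSize D m ^ l) (hH : n + 1 + l ≤ H) :
    Runs f H (.incRaw :: k) v n (rawWord D m l x) k v n (rawWord D m l (x + 1)) := by
  rintro w hw rfl
  refine ⟨w, hw, rfl, ?_⟩
  have hB := two_le_alphabetSize D m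
  have h1 := moves_to_raw (f := f) (k := k) (p := .incRaw) (ph := .rawInc) (raw := rawWord D m l x)
    (w := w) (H := H) (fun a => by simp only [progTable, startTable])
    (by simp only [progTable, startTable]) (by omega)
  have h2 := moves_carry (δ := progTable f) (H := H) (q := (.incRaw :: k, .rawInc))
    (q₁ := (.incRaw :: k, .rawBack true)) (b := alphabetSize D m) (dg := Fin.val)
    (st := fun _ d => rawDigit D m d) (fun a => a.2) (fun a x hx => val_rawDigit hx)
    (fun a ha => by simp only [progTable, if_pos ha])
    (fun a ha => by simp only [progTable, if_neg ha])
    (rawWord D m l x) (none :: (w.map some).reverse) [] (by simp; omega)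
  rw [← rawValue, rawValue_rawWord (by omega), length_rawWord] at h2
  rcases h2 with ⟨-, u, z, hz, hc, he, h2⟩ | ⟨h2, -⟩
  · rw [List.append_nil, List.append_nil] at h2
    have e : rawWord D m l (x + 1) = u ++ z := by
      have := rawWord_rawValue (u ++ z)
      rwa [hc.length_eq, length_rawWord, rawValue, he] at this
    rw [e]
    exact h1.trans (h2.trans (moves_rawBack hw hz))
  · omega

theorem Runs.loopRaw_succ {p : Prog} {l x : ℕ} (h : x + 1 < alphabetSize D m ^ l) (hH : n + 1 + l ≤ H) :
    Runs f H (.loopRaw p :: k) v n (rawWord D m l (x + 1)) (p :: .loopRaw p :: k) v n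
      (rawWord D m l x) := by
  rintro w hw rfl
  refine ⟨w, hw, rfl, ?_⟩
  have hB := two_le_alphabetSize D m
  have h1 := moves_to_raw (f := f) (k := k) (p := .loopRaw p) (ph := .rawDec)
    (raw := rawWord D m l (x + 1)) (w := w) (H := H) (fun a => by simp only [progTable, startTable])
    (by simp only [progTable, startTable]) (by omega)
  have h2 := moves_borrow (δ := progTable f) (H := H) (q := (.loopRaw p :: k, .rawDec))
    (q₁ := (.loopRaw p :: k, .rawBack true)) (b := alphabetSize D m) (dg := Fin.val)
    (st := fun _ d => rawDigit D m d) (fun a => a.2) (fun a x hx => val_rawDigit hx)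
    (fun a ha => by simp only [progTable, if_neg ha])
    (fun a ha => by simp only [progTable, if_pos ha])
    (rawWord D m l (x + 1)) (none :: (w.map some).reverse) [] (by simp; omega)
  rw [← rawValue, rawValue_rawWord h] at h2
  rcases h2 with ⟨u, z, hz, hc, he, h2⟩ | ⟨h2, -⟩
  · rw [List.append_nil, List.append_nil] at h2
    have e : rawWord D m l x = u ++ z := by
      have := rawWord_rawValue (u ++ z)
      rwa [hc.length_eq, length_rawWord, rawValue, Nat.succ_injective he] at this
    rw [e]
    exact h1.trans (h2.trans (moves_rawBack hw hz))
  · omega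

/-- The borrow runs through the whole numeral to the blank behind it. This signals the value `0`,
and on the way back the numeral is erased up to the separating blank. -/
theorem Runs.loopRaw_zero {p : Prog} {l : ℕ} (hl : l ≠ 0) (hH : n + 1 + l ≤ H) :
    Runs f H (.loopRaw p :: k) v n (rawWord D m l 0) k v n [] := by
  rintro w hw rfl
  refine ⟨w, hw, rfl, ?_⟩
  have hB := two_le_alphabetSize D m
  have h1 := moves_to_raw (f := f) (k := k) (p := .loopRaw p) (ph := .rawDec)
    (raw := rawWord D m l 0) (w := w) (H := H) (fun a => by simp only [progTable, startTable])
    (by simp only [progTable, startTable]) (by omega)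
  have h2 := moves_borrow (δ := progTable f) (H := H) (q := (.loopRaw p :: k, .rawDec))
    (q₁ := (.loopRaw p :: k, .rawBack true)) (b := alphabetSize D m) (dg := Fin.val)
    (st := fun _ d => rawDigit D m d) (fun a => a.2) (fun a x hx => val_rawDigit hx)
    (fun a ha => by simp only [progTable, if_neg ha])
    (fun a ha => by simp only [progTable, if_pos ha])
    (rawWord D m l 0) (none :: (w.map some).reverse) [] (by simp; omega)
  rw [← rawValue, rawValue_rawWord (by positivity)] at h2
  rcases h2 with ⟨u, z, hz, hc, he, h2⟩ | ⟨-, w', hc, h2⟩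
  · omega
  rw [List.append_nil] at h2
  obtain ⟨a, w'', rfl⟩ : ∃ a w'', w' = w'' ++ [a] := by
    have : w' ≠ [] := by
      rintro rfl
      have := hc.length_eq
      simp at this; omega
    exact ⟨_, _, (List.dropLast_append_getLast this).symm⟩
  refine h1.trans (h2.trans (.head Move.blank ?_))
  refine .head (b := ((.loopRaw p :: k, .rawErase), (w''.map some).reverse ++ none :: (w.map some).reverse,
    some a :: [none])) ?_ ?_
  · have := Move.left (δ := progTable f) (H := H) (q := (.loopRaw p :: k, .rawDec))
      (q' := (.loopRaw p :: k, .rawErase)) (a := none) (a' := none) (c := some a)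
      (l := (w''.map some).reverse ++ none :: (w.map some).reverse) (r := [])
      (by simp only [progTable])
    simpa using this
  obtain ⟨y, l', hx⟩ : ∃ y l', y :: l' = (w''.map some).reverse ++ none :: (w.map some).reverse := by
    obtain ⟨y, l', h⟩ := List.exists_cons_of_ne_nil
      (l := (w''.map some).reverse ++ none :: (w.map some).reverse) (by simp)
    exact ⟨y, l', h.symm⟩
  rw [← hx]
  refine .head (Move.left (q' := (.loopRaw p :: k, .rawErase)) (a' := none) (by simp only [progTable])) ?_
  have h3 := sweep_left (δ := progTable f) (H := H) (q := (.loopRaw p :: k, .rawErase))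
    (g := fun _ => none) w''.reverse
    (l := (w.map some).reverse) (c := none) [none, none] (by simpa using hx)
    (fun y _ => by simp only [progTable])
  refine h3.trans ?_
  have h4 := moves_left_home (δ := progTable f) (H := H) (q := (.loopRaw p :: k, .back false))
    (q₂ := (.loopRaw p :: k, .rawErase)) (q₁ := (k, .start)) (w := w)
    (mk := isFirst) (fun s => by simp only [progTable]; rfl)
    (by simp only [progTable]) hw.1 ((w''.reverse.map fun _ => none).reverse ++ [none, none])
  refine h4.trans ?_
  have h5 := moves_unblank (δ := progTable f) (H := H) (k, .start) [] (w.map some ++ [none])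
    (w''.length + 2)
  convert h5 using 3
  on_goal 2 => simp
  simp only [List.map_reverse, List.reverse_reverse, List.map_const', List.append_assoc,
    List.cons_append, List.nil_append, List.replicate_succ']

theorem area_singleton : Area [mkSymbol D m 0 true] 0 :=
  ⟨⟨0, by simp⟩, fun t ht => by simp [trackDigit_mkSymbol ht]⟩

/-- The cell of the units digit becomes the first cell of the area, while the digit itself survives
in the state. Further digits, if any, are shifted to make room for a separating blank and form the
raw numeral. -/
theorem moves_boot (hD : 2 ≤ D) (hm : 0 < m) (d : Fin (alphabetSize D m))
    (rest : List (Fin (alphabetSize D m))) (hH : 1 + room rest ≤ H) :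
    ∃ w, Area w (push 1 0) ∧ w.length = 1 ∧
      Moves (progTable f) H (([], .boot), [], (d :: rest).map some)
        (atStart [f d !rest.isEmpty] w rest) := by
  have e : Function.update (0 : ℕ → ℕ) 0 ((0 : ℕ → ℕ) 0 + 1) = push 1 0 := by
    funext i; cases i <;> simp
  have ha := area_singleton (D := D) (m := m)
  have h1 : Move (progTable f) H (([], .boot), [], (d :: rest).map some)
      (([], .bootNext d), [some (mkSymbol D m 0 true)], rest.map some) :=
    Move.right (by simp only [progTable]) (by simp; omega)
  cases rest with
  | nil =>
    obtain ⟨w', hw', hl', h5⟩ := moves_incCount (f := f) (H := H) (k := [.skip, f d false])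
      (raw := []) hm ha (by simp; omega) (by simp; omega)
    refine ⟨w', e ▸ hw', hl', .head h1 (.head Move.blank (.head
      (b := (([.skip, f d false], .backCount), [], [some (mkSymbol D m 0 true), none])) ?_
      (.head (Move.stay ?_) h5)))⟩
    · exact Move.left (by simp only [progTable])
    · simp only [progTable, isFirst_mkSymbol, if_true]
  | cons a rest =>
    have hr : room (a :: rest) = rest.length + 2 := rfl
    have h2 : Move (progTable f) H (([], .bootNext d), [some (mkSymbol D m 0 true)], (a :: rest).map some)
        (([.skip, f d true], .insert (some a)), [none, some (mkSymbol D m 0 true)], rest.map some) :=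
      Move.right (by simp only [progTable]) (by simp; omega)
    obtain ⟨x, l', hx, h4⟩ := moves_insert (f := f) (H := H) (k := [.skip, f d true]) rest (some a)
      [none, some (mkSymbol D m 0 true)] (by simp; omega)
    obtain ⟨w', hw', hl', h5⟩ := moves_insertBack (f := f) (H := H) (k := [.skip, f d true])
      (raw := a :: rest) hm ha (by simp; omega) (by simp; omega) (x := x) (l' := l')
      (by simpa using hx)
    exact ⟨w', e ▸ hw', hl', .head h1 (.head h2 (h4.trans h5))⟩

/-- The erasing sweep ends on the blank behind the area, at position `w.length`; this is the
configuration `s`, in which the padded area determines the space. The single digit, valid in the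
larger base too, is left in the first cell. -/
theorem moves_finishDigit {t : ℕ} (ht : t < m) (hv : v t < D) {w : List (Fin (alphabetSize D m))}
    (hw : Area w v) (hH : w.length ≤ H) :
    ∃ s : (List Prog × Phase (alphabetSize D m)) × List (Option (Fin (alphabetSize D m))) ×
      List (Option (Fin (alphabetSize D m))), s.2.1.length = w.length ∧
      Moves (progTable f) H (atStart (.finishDigit t :: k) w []) s ∧ ∃ a : Fin (alphabetSize D m),
        (a : ℕ) = v t ∧
        Moves (progTable f) H s ((.finishDigit t :: k, .done), [], [some a]) := by
  have hB := le_alphabetSize (D := D) (m := m) (by omega)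
  obtain ⟨s, ws, rfl, hs, -⟩ := hw.1.exists_cons
  have e := hw.2 t ht
  rw [wordValue_cons] at e
  have e2 : wordValue D (trackDigit t) ws = 0 := by
    by_contra h
    nlinarith [Nat.pos_of_ne_zero h]
  rw [e2, mul_zero, add_zero] at e
  simp only [List.length_cons] at hH
  have h1 : Move (progTable f) H (atStart (.finishDigit t :: k) (s :: ws) [])
      ((.finishDigit t :: k, .erase), [some (rawDigit D m (trackDigit t s))], ws.map some ++ [none]) :=
    Move.right (by simp only [progTable, startTable]) (by simp; omega)
  have h2 := sweep_right (δ := progTable f) (H := H) (q := (.finishDigit t :: k, .erase))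
    (g := fun _ => none) ws (fun a _ => by simp only [progTable])
    [some (rawDigit D m (trackDigit t s))] [none] (by simp; omega)
  refine ⟨_, ?_, .head h1 h2, rawDigit D m (trackDigit t s), ?_, ?_⟩
  · simp
  · rw [val_rawDigit, e]
    have := trackDigit_lt t s
    omega
  · have key : ∀ (j : ℕ) (r : List (Option (Fin (alphabetSize D m)))) (ph : Phase (alphabetSize D m)),
        ph = .erase ∨ ph = .seek →
        Moves (progTable f) H ((.finishDigit t :: k, ph), List.replicate j none ++
            [some (rawDigit D m (trackDigit t s))], none :: r)
          ((.finishDigit t :: k, .seek), [],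
            some (rawDigit D m (trackDigit t s)) :: (List.replicate (j + 1) none ++ r)) := by
      intro j
      induction j with
      | zero =>
        intro r ph hph
        exact .single (Move.left (by rcases hph with rfl | rfl <;> simp only [progTable]))
      | succ j ih =>
        intro r ph hph
        refine .head (b := ((.finishDigit t :: k, .seek), List.replicate j none ++
            [some (rawDigit D m (trackDigit t s))], none :: none :: r)) ?_ ?_
        · exact Move.left (by rcases hph with rfl | rfl <;> simp only [progTable])
        · have := ih (none :: r) .seek (Or.inr rfl)
          convert this using 3
          simp [List.replicate_succ']
    have h3 := key ws.length [] .erase (Or.inl rfl)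
    simp only [List.map_const', List.reverse_replicate]
    refine h3.trans (.head (Move.stay (q' := (.finishDigit t :: k, .done))
      (a' := some (rawDigit D m (trackDigit t s))) (by simp only [progTable])) ?_)
    have := moves_unblank (δ := progTable f) (H := H) (.finishDigit t :: k, .done) []
      [some (rawDigit D m (trackDigit t s))] (ws.length + 1)
    simpa using this

/-- The configuration `s` is at the blank behind the raw numeral, the farthest position needed. The
head then returns to the units digit, where the output is read; the area on the left has been
erased. -/
theorem moves_finishWord {w raw : List (Fin (alphabetSize D m))} (hraw : raw ≠ [])
    (hH : w.length + 1 + raw.length ≤ H) :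
    ∃ s : (List Prog × Phase (alphabetSize D m)) × List (Option (Fin (alphabetSize D m))) ×
      List (Option (Fin (alphabetSize D m))), s.2.1.length = w.length + 1 + raw.length ∧
      Moves (progTable f) H (atStart (.finishWord :: k) w raw) s ∧ ∃ l,
        Moves (progTable f) H s ((.finishWord :: k, .done), l, raw.map some ++ [none]) := by
  have h1 := sweep_right (δ := progTable f) (H := H) (q := (.finishWord :: k, .start))
    (g := fun _ => none) w (fun a _ => by simp only [progTable, startTable])
    [] (none :: raw.map some) (by simp; omega)
  have h2 := h1.tail (Move.right (q' := (.finishWord :: k, .wordEnd)) (a' := none)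
    (by simp only [progTable, startTable]) (by simp; omega))
  set l := none :: ((w.map fun _ => (none : Option (Fin (alphabetSize D m)))).reverse ++ []) with hl
  have hll : l.length = w.length + 1 := by simp [hl]
  have h3 := sweep_right (δ := progTable f) (H := H) (q := (.finishWord :: k, .wordEnd))
    (g := some) raw (fun a _ => by simp only [progTable])
    l [] (by omega)
  rw [List.append_nil] at h3
  refine ⟨_, ?_, h2.trans h3, ?_⟩
  · simp [hll]; omega
  obtain ⟨u, a, rfl⟩ : ∃ u a, raw = u ++ [a] :=
    ⟨_, _, (List.dropLast_append_getLast hraw).symm⟩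
  obtain ⟨y, l', hx⟩ : ∃ y l', y :: l' = ((u ++ [a]).map some).reverse ++ l := by
    obtain ⟨y, l', h⟩ := List.exists_cons_of_ne_nil
      (l := ((u ++ [a]).map some).reverse ++ l) (by simp)
    exact ⟨y, l', h.symm⟩
  have h4 := sweep_left (δ := progTable f) (H := H) (q := (.finishWord :: k, .wordSeek))
    (g := some) (u ++ [a]).reverse (l := l.tail) (c := none) [none] (by simpa [hl] using hx)
    (fun y _ => by simp only [progTable])
  refine ⟨none :: l.tail, ?_⟩
  rw [← hx]
  refine .head Move.blank (.head (Move.left (q' := (.finishWord :: k, .wordSeek)) (a' := none)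
    (by simp only [progTable])) ?_)
  have := h4.tail (Move.right (q' := (.finishWord :: k, .done)) (a' := none)
    (by simp only [progTable]) (by simp [hl]; omega))
  simpa using this

end RawNumeral

end TuringSpace

/-! ### Programs on the tape: growth of the area, reading, writing, padding -/

namespace TuringSpace

open Relation

theorem update_push_zero (a b : ℕ) (σ : ℕ → ℕ) : Function.update (push a σ) 0 b = push b σ := by
  funext i; cases i <;> simp

theorem update_push_succ (a b r : ℕ) (σ : ℕ → ℕ) :
    Function.update (push a σ) (r + 1) b = push a (Function.update σ r b) := by
  funext i
  cases i with
  | zero => simp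
  | succ i =>
    by_cases h : i = r
    · subst h; simp
    · simp [h]

section Programs

variable {D m : ℕ} [NeZero D] {f : ℕ → Bool → Prog} {H N : ℕ} {k : List Prog}
  {raw : List (Fin (alphabetSize D m))} {n cnt : ℕ} {σ σ' σ'' : ℕ → ℕ} {p q : Prog}

/-- The program changes the registers from `σ` to `σ'`, the area growing to at most `N` cells. -/
def Effect (f : ℕ → Bool → Prog) (H N : ℕ) (raw : List (Fin (alphabetSize D m))) (p : Prog)
    (σ σ' : ℕ → ℕ) : Prop :=
  ∀ k n, 0 < n → n ≤ N → ∃ n', n ≤ n' ∧ n' ≤ N ∧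
    Runs f H (p :: k) (push n σ) n raw k (push n' σ') n' raw

theorem Effect.seq (h1 : Effect f H N raw p σ σ') (h2 : Effect f H N raw q σ' σ'') :
    Effect f H N raw (.seq p q) σ σ'' := by
  intro k n h0 hn
  obtain ⟨n', ha, hb, hc⟩ := h1 (q :: k) n h0 hn
  obtain ⟨n'', ha', hb', hc'⟩ := h2 k n' (by omega) hb
  exact ⟨n'', by omega, hb', Runs.seq.trans (hc.trans hc')⟩

theorem Effect.skip : Effect f H N raw .skip σ σ :=
  fun _ n _ hn => ⟨n, le_rfl, hn, Runs.skip⟩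

/-- The area grows only when a register reaches `D ^ n`; as registers are at most `V < D ^ N`, it
never exceeds `N` cells. The count fits into the enlarged area because `n + 1 < D ^ (n + 1)`. -/
theorem Effect.of_exec {V : ℕ} (hD : 2 ≤ D) (hV : V < D ^ N) (hH : N + room raw ≤ H)
    (h : Exec V m p σ σ') : Effect f H N raw p σ σ' := by
  induction h with
  | @inc r σ hr h1 =>
    intro k n h0 hn
    rcases lt_trichotomy (σ r + 1) (D ^ n) with h | h | h
    · exact ⟨n, le_rfl, hn, by
        simpa [update_push_succ] using Runs.inc (f := f) (H := H) (k := k) (v := push n σ) (raw := raw)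
          hr (by simpa using h) (by omega)⟩
    · have hnN : n < N := (Nat.pow_lt_pow_iff_right (a := D) (by omega)).1 (by omega)
      have hc : n + 1 < D ^ (n + 1) := (n + 1).lt_two_pow_self.trans_le (Nat.pow_le_pow_left hD _)
      exact ⟨n + 1, by omega, hnN, by
        simpa [update_push_succ, update_push_zero] using Runs.inc_overflow (f := f) (H := H) (k := k)
          (v := push n σ) (raw := raw) hr (by omega) (by simpa using h) (by simpa using hc) hD
          (by omega)⟩
    · refine ⟨n, le_rfl, hn, fun w hw hl => ?_⟩
      have h3 := hw.2 (r + 1) hr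
      have h4 := wordValue_lt (trackDigit_lt (r + 1)) w
      simp only [push_succ] at h3
      rw [hl] at h4
      omega
  | @dec r σ j hr h1 =>
    intro k n h0 hn
    exact ⟨n, le_rfl, hn, by
        simpa [update_push_succ] using Runs.dec (f := f) (H := H) (k := k) (v := push n σ) (raw := raw)
          hr (by simpa using h1) (by omega)⟩
  | seq _ _ ih1 ih2 => exact ih1.seq ih2
  | @loop_zero r p σ hr h1 =>
    intro k n h0 hn
    exact ⟨n, le_rfl, hn, by
        simpa [h1] using Runs.loop (f := f) (H := H) (k := k) (v := push n σ) (raw := raw) (p := p)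
          hr (by omega)⟩
  | @loop_succ r p σ₁ σ₂ σ₃ hr h1 _ _ ih1 ih2 =>
    intro k n h0 hn
    have h2 := Runs.loop (f := f) (H := H) (k := k) (v := push n σ₁) (n := n) (raw := raw) (p := p)
          hr (by omega)
    rw [push_succ, if_pos h1] at h2
    obtain ⟨n', ha, hb, hc⟩ := ih1 (.loop (r + 1) p :: k) n h0 hn
    obtain ⟨n'', ha', hb', hc'⟩ := ih2 k n' (by omega) hb
    exact ⟨n'', by omega, hb', h2.trans (hc.trans hc')⟩

/-- The program that increases a register `j` times. -/
def Prog.incs (r : ℕ) : ℕ → Prog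
  | 0 => .skip
  | j + 1 => .seq (.inc (r + 1)) (.incs r j)

theorem Effect.incs {V r : ℕ} (hD : 2 ≤ D) (hr : r + 1 < m) (hV : V < D ^ N) (hH : N + room raw ≤ H)
    (j : ℕ) (h : σ r + j ≤ V) :
    Effect f H N raw (.incs r j) σ (Function.update σ r (σ r + j)) := by
  induction j generalizing σ with
  | zero => simpa [Prog.incs] using Effect.skip
  | succ j ih =>
    have h1 : Effect f H N raw (.inc (r + 1)) σ _ :=
      Effect.of_exec (V := V) hD hV hH (Exec.inc hr (by omega))
    have h2 := ih (σ := Function.update σ r (σ r + 1)) (by simp; omega)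
    have h3 := h1.seq h2
    simpa [Prog.incs, add_assoc, add_comm 1 j] using h3

theorem room_rawWord {l x : ℕ} (hl : l ≠ 0) : room (rawWord D m l x) = l + 1 := by
  rw [room, if_neg, length_rawWord]
  intro h
  have := congrArg List.length h
  simp at this
  omega

/-- The raw numeral is read by counting it down while `B` is added to a register each time. Time is
irrelevant, and no space beyond area and numeral is needed. -/
theorem runs_read {V r B l : ℕ} (hD : 2 ≤ D) (hr : r + 1 < m) (hV : V < D ^ N)
    (hl : l ≠ 0) (hH : N + (l + 1) ≤ H) (x : ℕ) (hx : x < alphabetSize D m ^ l)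
    (h : σ r + B * x ≤ V) (hn0 : 0 < n) (hn : n ≤ N) :
    ∃ n', n ≤ n' ∧ n' ≤ N ∧ Runs f H (.loopRaw (.incs r B) :: k) (push n σ) n (rawWord D m l x) k
      (push n' (Function.update σ r (σ r + B * x))) n' [] := by
  induction x generalizing n σ with
  | zero => exact ⟨n, le_rfl, hn, by simpa using Runs.loopRaw_zero hl (by omega)⟩
  | succ x ih =>
    have e : B * (x + 1) = B + B * x := by ring
    obtain ⟨n', ha, hb, hc⟩ := Effect.incs (f := f) (H := H) (N := N) (σ := σ) (raw := rawWord D m l x) hD hr hV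
      (by rw [room_rawWord hl]; exact hH) B (by omega) (.loopRaw (.incs r B) :: k) n hn0 hn
    obtain ⟨n'', ha', hb', hc'⟩ := ih (σ := Function.update σ r (σ r + B)) (n := n') (by omega)
      (by simp; omega) (by omega) hb
    refine ⟨n'', by omega, hb', (Runs.loopRaw_succ hx (by omega)).trans (hc.trans ?_)⟩
    simpa [e, add_assoc] using hc'

/-- Emptying track `0` subtracts the number of cells from register `r`. If `r` held the prescribed
space, it now holds the number of cells to be added. -/
theorem runs_countdown {r a : ℕ} (hr : r + 1 < m) (hH : n ≤ H) (j : ℕ) (h : σ r = j + a) :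
    Runs f H (.loop 0 (.seq (.dec 0) (.dec (r + 1))) :: k) (push j σ) n raw k
      (push 0 (Function.update σ r a)) n raw := by
  induction j generalizing σ with
  | zero =>
    have h2 := Runs.loop (f := f) (H := H) (k := k) (v := push 0 σ) (n := n) (raw := raw)
      (p := .seq (.dec 0) (.dec (r + 1))) (t := 0) (by omega) hH
    rw [show Function.update σ r a = σ by rw [← Nat.zero_add a, ← h]; simp]
    simpa using h2
  | succ j ih =>
    have h2 := Runs.loop (f := f) (H := H) (k := k) (v := push (j + 1) σ) (n := n) (raw := raw)
      (p := .seq (.dec 0) (.dec (r + 1))) (t := 0) (by omega) hH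
    rw [push_zero, if_pos (by omega)] at h2
    refine h2.trans (Runs.seq.trans ((Runs.dec (by omega) (push_zero _ _) hH).trans ?_))
    rw [update_push_zero]
    refine (Runs.dec (j := j + a) hr (by rw [push_succ, h]; omega) hH).trans ?_
    rw [update_push_succ]
    simpa using ih (σ := Function.update σ r (j + a)) (by simp)

/-- Each cell of the area provides one digit place of the output. Two units are subtracted from the
prescribed space, one for the cell and one for the place. -/
theorem runs_append {r a : ℕ} (hr : r + 1 < m) (j l : ℕ) (hH : n + 1 + (l + j) ≤ H)
    (h : σ r = 2 * j + a) :
    Runs f H (.loop 0 (.seq (.dec 0) (.seq .append (.seq (.dec (r + 1)) (.dec (r + 1))))) :: k)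
      (push j σ) n (rawWord D m l 0) k (push 0 (Function.update σ r a)) n (rawWord D m (l + j) 0) := by
  induction j generalizing σ l with
  | zero =>
    have h2 := Runs.loop (f := f) (H := H) (k := k) (v := push 0 σ) (n := n) (raw := rawWord D m l 0)
      (p := .seq (.dec 0) (.seq .append (.seq (.dec (r + 1)) (.dec (r + 1))))) (t := 0) (by omega)
      (by omega)
    rw [show Function.update σ r a = σ by rw [← Nat.zero_add a, ← mul_zero 2, ← h]; simp]
    simpa using h2
  | succ j ih =>
    have h2 := Runs.loop (f := f) (H := H) (k := k) (v := push (j + 1) σ) (n := n)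
      (raw := rawWord D m l 0)
      (p := .seq (.dec 0) (.seq .append (.seq (.dec (r + 1)) (.dec (r + 1))))) (t := 0) (by omega)
      (by omega)
    rw [push_zero, if_pos (by omega)] at h2
    refine h2.trans (Runs.seq.trans ((Runs.dec (by omega) (push_zero _ _) (by omega)).trans ?_))
    rw [update_push_zero]
    refine Runs.seq.trans ((Runs.append (by rw [length_rawWord]; omega)).trans (Runs.seq.trans ?_))
    rw [rawWord_zero_append]
    refine (Runs.dec (j := 2 * j + 1 + a) hr (by rw [push_succ, h]; omega) (by omega)).trans ?_
    rw [update_push_succ]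
    refine (Runs.dec (j := 2 * j + a) hr (by simp; omega) (by omega)).trans ?_
    rw [update_push_succ]
    have := ih (σ := Function.update σ r (2 * j + a)) (l + 1) (by omega) (by simp)
    simpa [add_assoc, add_comm 1 j] using this

/-- Track `0` may have been emptied before, so it need not agree with the number of cells any more;
`cnt ≤ n` is enough for it not to overflow. -/
theorem runs_grow {r : ℕ} (hD : 2 ≤ D) (hr : r + 1 < m) (j : ℕ) (hH : n + j + room raw ≤ H)
    (hc : cnt ≤ n) (h : σ r = j) :
    Runs f H (.loop (r + 1) (.seq (.dec (r + 1)) .grow) :: k) (push cnt σ) n raw k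
      (push (cnt + j) (Function.update σ r 0)) (n + j) raw := by
  induction j generalizing σ n cnt with
  | zero =>
    have h2 := Runs.loop (f := f) (H := H) (k := k) (v := push cnt σ) (n := n) (raw := raw)
      (p := .seq (.dec (r + 1)) .grow) hr (by omega)
    rw [show Function.update σ r 0 = σ by rw [← h]; simp]
    simpa [h] using h2
  | succ j ih =>
    have h2 := Runs.loop (f := f) (H := H) (k := k) (v := push cnt σ) (n := n) (raw := raw)
      (p := .seq (.dec (r + 1)) .grow) hr (by omega)
    rw [push_succ, if_pos (by omega)] at h2
    have hcc : n + 1 < D ^ (n + 1) := (n + 1).lt_two_pow_self.trans_le (Nat.pow_le_pow_left hD _)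
    refine h2.trans (Runs.seq.trans ((Runs.dec hr h (by omega)).trans ?_))
    rw [update_push_succ]
    refine (Runs.grow (by omega) (by rw [push_zero]; omega) (by omega)).trans ?_
    rw [update_push_zero]
    have := ih (σ := Function.update σ r j) (n := n + 1) (cnt := cnt + 1) (by omega) (by omega) (by simp)
    simpa [add_assoc, add_comm 1 j] using this

theorem runs_write {r l : ℕ} (hr : r + 1 < m) (hH : n + 1 + l ≤ H) (j x : ℕ)
    (hx : x + j < alphabetSize D m ^ l) (h : σ r = j) :
    Runs f H (.loop (r + 1) (.seq (.dec (r + 1)) .incRaw) :: k) (push cnt σ) n (rawWord D m l x) k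
      (push cnt (Function.update σ r 0)) n (rawWord D m l (x + j)) := by
  induction j generalizing σ x with
  | zero =>
    have h2 := Runs.loop (f := f) (H := H) (k := k) (v := push cnt σ) (n := n) (raw := rawWord D m l x)
      (p := .seq (.dec (r + 1)) .incRaw) hr (by omega)
    rw [show Function.update σ r 0 = σ by rw [← h]; simp]
    simpa [h] using h2
  | succ j ih =>
    have h2 := Runs.loop (f := f) (H := H) (k := k) (v := push cnt σ) (n := n) (raw := rawWord D m l x)
      (p := .seq (.dec (r + 1)) .incRaw) hr (by omega)
    rw [push_succ, if_pos (by omega)] at h2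
    refine h2.trans (Runs.seq.trans ((Runs.dec hr h (by omega)).trans ?_))
    rw [update_push_succ]
    refine (Runs.incRaw (by omega) hH).trans ?_
    have := ih (σ := Function.update σ r j) (x := x + 1) (by omega) (by simp)
    simpa [add_assoc, add_comm 1 j] using this

end Programs

/-- The units digit is split off, as the machine does at its start. The remaining digits number at
most the logarithm of `x`, because the leading digit is not `0`. -/
theorem exists_numeral (b : ℕ) (hb : 2 ≤ b) (x : ℕ) : ∃ d rest, numeral b hb x = d :: rest ∧
    x = d + b * wordValue b Fin.val rest ∧ (rest ≠ [] → b ^ rest.length ≤ x) := by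
  have key : wordValue b Fin.val (numeral b hb x) = x ∧
      (x ≠ 0 → b ^ (numeral b hb x).length ≤ b * x) ∧ numeral b hb x ≠ [] := by
    unfold numeral
    split_ifs with h
    · subst h; simp
    · refine ⟨?_, fun _ => ?_, ?_⟩
      · rw [wordValue, List.map_pmap]
        simp [Nat.ofDigits_digits]
      · obtain ⟨b, rfl⟩ : ∃ b', b = b' + 2 := ⟨b - 2, by omega⟩
        simpa using Nat.base_pow_length_digits_le (b + 2) x (by omega) h
      · simpa [Nat.digits_ne_nil_iff_ne_zero] using h
  obtain ⟨h1, h2, h3⟩ := key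
  obtain ⟨d, rest, e⟩ := List.exists_cons_of_ne_nil h3
  rw [e] at h1 h2
  rw [wordValue_cons] at h1
  refine ⟨d, rest, e, h1.symm, fun hr => ?_⟩
  have hx : x ≠ 0 := by
    rintro rfl
    rw [numeral, if_pos rfl] at e
    simp at e
    exact hr e.2
  have := h2 hx
  rw [List.length_cons, pow_succ, mul_comm] at this
  exact Nat.le_of_mul_le_mul_left this (by omega)

end TuringSpace

/-! ### From moves to output and space; the programs of a loop -/

namespace TuringSpace

open Relation

section Realization

variable {D m : ℕ} [NeZero D] {f : ℕ → Bool → Prog} {H N : ℕ} {k : List Prog}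
  {raw : List (Fin (alphabetSize D m))} {n cnt : ℕ} {σ σ' σ'' : ℕ → ℕ} {p q : Prog}

theorem readNumber_mk {b : ℕ} (w : List (Fin b)) (r : List (Option (Fin b))) :
    readNumber (ListBlank.mk (w.map some ++ none :: r)) = wordValue b Fin.val w := by
  have : leadingDigits (w.map some ++ none :: r) = w.map Fin.val := by
    unfold leadingDigits
    induction w with
    | nil => simp
    | cons a w ih => simpa using ih
  show Nat.ofDigits b (leadingDigits (w.map some ++ none :: r)) = _
  rw [this, wordValue]

/-- The start of the machine on the input `x`. -/
abbrev atBoot (D m x : ℕ) [NeZero D] : (List Prog × Phase (alphabetSize D m)) ×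
    List (Option (Fin (alphabetSize D m))) × List (Option (Fin (alphabetSize D m))) :=
  (([], .boot), [], (numeral (alphabetSize D m) (two_le_alphabetSize D m) x).map some)

/-- The configuration `s` witnesses that position `H` is attained, and both stretches of the
computation keep within `H`. -/
theorem progAlgorithm_space {x : ℕ} {s} (h1 : Moves (progTable f) H (atBoot D m x) s)
    (hs : s.2.1.length = H) {k : List Prog} {l r : List (Option (Fin (alphabetSize D m)))}
    (h2 : Moves (progTable f) H s ((k, .done), l, r)) :
    (progAlgorithm D m f).eval x = Part.some (readNumber (ListBlank.mk r)) ∧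
      ((numeral (alphabetSize D m) (two_le_alphabetSize D m) x).length ≤ H →
        (progAlgorithm D m f).space x = H) := by
  obtain ⟨q, l', r'⟩ := s
  obtain ⟨hq, hl, h3⟩ := Quintuples.path_of_moves (progTable f) (two_le_alphabetSize D m) _ _ _ _
    (progTable_closed f) h1 (Or.inl rfl) (Nat.zero_le _)
  obtain ⟨hq', hl', h4⟩ := Quintuples.path_of_moves (progTable f) (two_le_alphabetSize D m) _ _ _ _
    (progTable_closed f) h2 hq hl
  have := Algorithm.space_eq_of_path (A := progAlgorithm D m f) (x := x) (H := H) h3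
    (by simpa [Quintuples.config] using hs) h4 rfl
  refine ⟨this.1.trans (congrArg (fun r => Part.some (readNumber r)) (Tape.mk'_right₀ _ _)),
    fun h => this.2 ((List.length_map _).trans_le h)⟩

/-- The bound `H` may differ from one stretch to the next, so that the space of a diverging
computation may be unbounded. -/
theorem progAlgorithm_not_dom {x : ℕ} {P : (List Prog × Phase (alphabetSize D m)) ×
      List (Option (Fin (alphabetSize D m))) × List (Option (Fin (alphabetSize D m))) → Prop}
    (h0 : ∃ s H, Moves (progTable f) H (atBoot D m x) s ∧ P s)
    (h : ∀ s, P s → ∃ s' s'' H, P s' ∧ s''.1 ≠ s.1 ∧ s.2.1.length ≤ H ∧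
      Moves (progTable f) H s s'' ∧ Moves (progTable f) H s'' s') :
    ¬ ((progAlgorithm D m f).eval x).Dom := by
  refine Algorithm.not_dom_of_chain (A := progAlgorithm D m f) (P := fun c => ∃ q l r,
    P (q, l, r) ∧ ∃ hq, c = Quintuples.config (progTable f) (two_le_alphabetSize D m) _
      ((Set.Finite.prod (finite_bootStacks f _) Set.finite_univ).subset fun s hs =>
      ⟨hs, Set.mem_univ s.2⟩) ([], .boot) (Or.inl rfl) (progTable_closed f) ⟨q, hq⟩ l r) ?_ ?_
  · obtain ⟨⟨q, l, r⟩, H, h1, hP⟩ := h0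
    obtain ⟨hq, -, h2⟩ := Quintuples.path_of_moves (progTable f) (two_le_alphabetSize D m) _ _ _ _
      (progTable_closed f) h1 (Or.inl rfl) (Nat.zero_le _)
    obtain ⟨t, -, ht, -⟩ := Algorithm.Path.exists_after (A := progAlgorithm D m f) (x := x) (t := 0)
      h2 rfl (fun r hr s hs => by
        obtain rfl : r = 0 := by omega
        obtain rfl := Option.some.inj hs
        exact ⟨le_rfl, Int.natCast_nonneg _⟩)
    exact ⟨t, _, ht, q, l, r, hP, hq, rfl⟩
  · rintro _ ⟨q, l, r, hP, hq, rfl⟩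
    obtain ⟨⟨q', l', r'⟩, ⟨q'', l'', r''⟩, H, hP', hne, hl, h1, h2⟩ := h _ hP
    obtain ⟨hq1, hl1, h3⟩ := Quintuples.path_of_moves (progTable f) (two_le_alphabetSize D m) _ _ _ _
      (progTable_closed f) h1 hq hl
    obtain ⟨hq2, hl2, h4⟩ := Quintuples.path_of_moves (progTable f) (two_le_alphabetSize D m) _ _ _ _
      (progTable_closed f) h2 hq1 hl1
    refine ⟨_, H, ⟨_, _, _, hP', hq2, rfl⟩, h3.trans h4, _, ?_, h3, h4⟩
    intro e
    apply hne
    have e1 := congrArg (fun c => c.1.q.1.1) e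
    exact e1

end Realization

section Loop

variable {D m : ℕ} [NeZero D] {f : ℕ → Bool → Prog} {H N : ℕ} {k : List Prog}
  {n : ℕ} {σ : ℕ → ℕ}

/-- The program that halts with the number in register `4`, which has more than one digit, as the
output, in the space given in register `5`. -/
def Prog.outputWord : Prog :=
  .seq (.dec 6) (.seq (.loop 0 (.seq (.dec 0) (.seq .append (.seq (.dec 6) (.dec 6)))))
    (.seq (.loop 5 (.seq (.dec 5) .incRaw)) (.seq (.loop 6 (.seq (.dec 6) .grow)) .finishWord)))

/-- The program that halts with the number in register `4`, which has a single digit, as the output,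
in the space given in register `5`. -/
def Prog.outputDigit : Prog :=
  .seq (.loop 0 (.seq (.dec 0) (.dec 6))) (.seq (.loop 6 (.seq (.dec 6) .grow)) (.finishDigit 5))

theorem moves_outputDigit (hD : 2 ≤ D) (hm : 6 < m) {w : List (Fin (alphabetSize D m))}
    (hw : Area w (push n σ)) (hl : w.length = n) (hs : σ 5 = H) (hn : n ≤ H) (hy : σ 4 < D) :
    ∃ s, s.2.1.length = H ∧ Moves (progTable f) H (atStart (.outputDigit :: k) w []) s ∧
      ∃ k' l r, readNumber (ListBlank.mk r) = σ 4 ∧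
        Moves (progTable f) H s ((k', .done), l, r) := by
  have h1 := (Runs.seq (f := f) (H := H) (k := k) (v := push n σ) (n := n)
    (raw := ([] : List (Fin (alphabetSize D m)))) (p := .loop 0 (.seq (.dec 0) (.dec 6)))
    (q := .seq (.loop 6 (.seq (.dec 6) .grow)) (.finishDigit 5))).trans
    (runs_countdown (r := 5) (a := H - n) (by omega) hn n (by omega))
  have h2 := h1.trans (Runs.seq.trans (runs_grow (r := 5) hD (by omega) (H - n) (by simp [room]; omega)
    (by omega) (by simp)))
  obtain ⟨w', hw', hl', h3⟩ := h2 w hw hl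
  rw [Nat.add_sub_cancel' hn] at hl'
  obtain ⟨s, hs, h4, a, ha, h5⟩ := moves_finishDigit (f := f) (k := k) (t := 5) (by omega)
    (by simpa using hy) hw' hl'.le
  refine ⟨s, hs.trans hl', h3.trans h4, _, _, _, ?_, h5.tail Move.blank⟩
  have := readNumber_mk [a] []
  simp only [List.map_cons, List.map_nil] at this
  rw [this]
  simpa using ha

theorem moves_outputWord (hD : 2 ≤ D) (hm : 6 < m) {w : List (Fin (alphabetSize D m))}
    (hw : Area w (push n σ)) (hl : w.length = n) (hs : σ 5 = H) (hn : 2 * n + 1 ≤ H) :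
    ∃ s, s.2.1.length = H ∧ Moves (progTable f) H (atStart (.outputWord :: k) w []) s ∧
      ∃ k' l r, readNumber (ListBlank.mk r) = σ 4 ∧
        Moves (progTable f) H s ((k', .done), l, r) := by
  have hn0 : 0 < n := hl ▸ hw.length_pos
  -- The output stands on a track of the area, and the base of the raw numeral is at least `D`;
  -- hence `n` places suffice, possibly with superfluous zeros.
  have hy : σ 4 < alphabetSize D m ^ n := by
    have h1 := wordValue_lt (trackDigit_lt 5) w
    rw [hw.2 5 (by omega), hl] at h1
    exact h1.trans_le (Nat.pow_le_pow_left (le_alphabetSize D m (by omega)) _)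
  have h1 := (Runs.seq (f := f) (H := H) (k := k) (v := push n σ) (n := n)
    (raw := ([] : List (Fin (alphabetSize D m)))) (p := .dec 6)
    (q := .seq (.loop 0 (.seq (.dec 0) (.seq .append (.seq (.dec 6) (.dec 6)))))
      (.seq (.loop 5 (.seq (.dec 5) .incRaw)) (.seq (.loop 6 (.seq (.dec 6) .grow)) .finishWord)))).trans
    (Runs.dec (t := 6) (j := H - 1) hm (by simp; omega) (by omega))
  rw [update_push_succ] at h1
  have h2 := h1.trans (Runs.seq.trans (runs_append (r := 5) (a := H - 1 - 2 * n) (by omega) n 0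
    (by omega) (by simp; omega)))
  have h3 := h2.trans (Runs.seq.trans (runs_write (r := 4) (by omega) (by omega) (σ 4) 0 (by simpa using hy)
    (by simp)))
  have h4 := h3.trans (Runs.seq.trans (runs_grow (r := 5) (k := .finishWord :: k) hD (by omega)
    (H - 1 - 2 * n) (by rw [room_rawWord (by omega)]; omega) (by omega) (by simp)))
  obtain ⟨w', hw', hl', h5⟩ := h4 w hw hl
  obtain ⟨s, hs, h6, l, h7⟩ := moves_finishWord (f := f) (H := H) (k := k) (w := w')
    (raw := rawWord D m (0 + n) (0 + σ 4))
    (by intro h; have := congrArg List.length h; simp at this; omega)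
    (by rw [hl', length_rawWord]; omega)
  refine ⟨s, by rw [hs, hl', length_rawWord]; omega, h5.trans h6, _, _, _, ?_, h7⟩
  rw [readNumber_mk, ← rawValue, rawValue_rawWord (by simpa using hy)]
  simp

/-- The contents of the registers while a loop is running. -/
def loopRegs (x a b : ℕ) (r : ℕ) : ℕ := if r = 0 then x else if r = 1 then a else if r = 3 then b else 0

theorem LinSpace.compile_unary {g : ℕ → ℕ} (hg : LinSpace fun σ => g (σ 0)) {i o : ℕ} (hi : i < 6)
    (ho : o < 6) (hio : i ≠ o) : ∃ p m c, ∀ σ M V, (∀ r ≥ 6, σ r = 0) → σ o = 0 → σ i ≤ M →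
      (M + 2) ^ c ≤ V → Exec V m p σ (Function.update σ o (g (σ i))) := by
  obtain ⟨p, m, c, h⟩ := hg.compile (fun _ => i) o 6 (fun _ => hi) ho (fun _ => hio)
  exact ⟨p, m, c, fun σ M V h1 h2 h3 h4 => h σ M V h1 h2 (fun _ => h3) h4⟩

/-- Register `0` holds the input, `1` the state of the loop, `2` the next state, `3` the flag that
controls the loop, `4` the output and `5` the prescribed space. One exponent `c` serves all
programs. -/
theorem exists_loop_programs {ini stp flag out tot : ℕ → ℕ} (hini : LinSpace fun σ => ini (σ 0))
    (hstp : LinSpace fun σ => stp (σ 0)) (hflag : LinSpace fun σ => flag (σ 0))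
    (hout : LinSpace fun σ => out (σ 0)) (htot : LinSpace fun σ => tot (σ 0)) :
    ∃ pi pb po m c, 6 < m ∧ 0 < c ∧ ∀ M V, (M + 2) ^ c ≤ V →
      (∀ x, x ≤ M → ini x ≤ M → Exec V m pi (loopRegs x 0 0) (loopRegs x (ini x) (flag (ini x)))) ∧
      (∀ x a, a ≤ M → stp a ≤ M →
        Exec V m pb (loopRegs x a (flag a)) (loopRegs x (stp a) (flag (stp a)))) ∧
      (∀ x a, a ≤ M → out a ≤ V ∧ ∃ σ, σ 4 = out a ∧ σ 5 = tot a ∧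
        Exec V m po (loopRegs x a 0) σ) := by
  obtain ⟨p₁, m₁, c₁, h₁⟩ := hini.compile_unary (i := 0) (o := 1) (by omega) (by omega) (by omega)
  obtain ⟨p₂, m₂, c₂, h₂⟩ := hflag.compile_unary (i := 1) (o := 3) (by omega) (by omega) (by omega)
  obtain ⟨p₃, m₃, c₃, h₃⟩ := hstp.compile_unary (i := 1) (o := 2) (by omega) (by omega) (by omega)
  obtain ⟨p₄, m₄, c₄, h₄⟩ := hout.compile_unary (i := 1) (o := 4) (by omega) (by omega) (by omega)
  obtain ⟨p₅, m₅, c₅, h₅⟩ := htot.compile_unary (i := 1) (o := 5) (by omega) (by omega) (by omega)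
  obtain ⟨c₆, h₆⟩ := hout.exists_bound
  let m := m₁ + m₂ + m₃ + m₄ + m₅ + 7
  refine ⟨.seq p₁ p₂, .seq p₃ (.seq (.clear 1) (.seq (.move 2 1) (.seq (.clear 3) p₂))), .seq p₄ p₅,
    m, c₁ + c₂ + c₃ + c₄ + c₅ + c₆ + 1, by omega, by omega, fun M V hV => ?_⟩
  have hle : ∀ c ≤ c₁ + c₂ + c₃ + c₄ + c₅ + c₆ + 1, (M + 2) ^ c ≤ V := fun c hc =>
    (Nat.pow_le_pow_right (by omega) hc).trans hV
  have hMV : M ≤ V := by have := hle 1 (by omega); rw [pow_one] at this; omega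
  refine ⟨fun x hx hi => ?_, fun x a ha hs => ?_, fun x a ha => ⟨?_, _, ?_, ?_, Exec.seq
    ((h₄ (loopRegs x a 0) M V (fun r hr => ?_) rfl ha (hle _ (by omega))).mono_tracks (by omega))
    ((h₅ _ M V (fun r hr => ?_) ?_ ?_ (hle _ (by omega))).mono_tracks (by omega))⟩⟩
  · refine (Exec.seq ((h₁ (loopRegs x 0 0) M V (fun r hr => ?_) rfl hx (hle _ (by omega))).mono_tracks
      (by omega)) ((h₂ _ M V (fun r hr => ?_) ?_ ?_ (hle _ (by omega))).mono_tracks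
      (by omega))).cast ?_
    · simp only [loopRegs]; split_ifs <;> omega
    · rw [Function.update_of_ne (by omega)]; simp only [loopRegs]; split_ifs <;> omega
    · simp [loopRegs]
    · simpa [loopRegs] using hi
    · funext r
      by_cases h1 : r = 1
      · subst h1; simp [loopRegs]
      by_cases h2 : r = 3
      · subst h2; simp [loopRegs]
      simp [loopRegs, h1, h2]
  · refine (Exec.seq ((h₃ (loopRegs x a (flag a)) M V (fun r hr => ?_) rfl ha (hle _ (by omega))).mono_tracks
      (by omega)) (Exec.seq (Exec.clear (by omega)) (Exec.seq (Exec.move (by omega) (by omega)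
      (by omega) ?_) (Exec.seq (Exec.clear (by omega))
      ((h₂ _ M V (fun r hr => ?_) ?_ ?_ (hle _ (by omega))).mono_tracks (by omega)))))).cast ?_
    · simp only [loopRegs]; split_ifs <;> omega
    · simp [loopRegs]; omega
    · simp only [ge_iff_le] at hr
      rw [Function.update_of_ne (by omega), Function.update_of_ne (by omega),
        Function.update_of_ne (by omega), Function.update_of_ne (by omega),
        Function.update_of_ne (by omega)]
      simp only [loopRegs]; split_ifs <;> omega
    · simp [loopRegs]
    · simpa [loopRegs] using hs
    · funext r
      by_cases h1 : r = 1
      · subst h1; simp [loopRegs]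
      by_cases h2 : r = 3
      · subst h2; simp [loopRegs]
      by_cases h3 : r = 2
      · subst h3; simp [loopRegs]
      simp [loopRegs, h1, h2, h3]
  · exact (h₆ (fun _ => a) M (fun _ => ha)).trans (hle _ (by omega))
  · simp [loopRegs]
  · simp [loopRegs]
  · simp only [loopRegs]; split_ifs <;> omega
  · rw [Function.update_of_ne (by omega)]; simp only [loopRegs]; split_ifs <;> omega
  · simp [loopRegs]
  · simpa [loopRegs] using ha

end Loop

end TuringSpace

/-! ### Carrying out a loop in exactly prescribed space -/

namespace TuringSpace

open Relation

/-- The program that reads the remaining digits of the input, whose first digit is `d`, to register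
`0`; the base of the numeral is `B`. -/
def Prog.readInput (B d : ℕ) (b : Bool) : Prog :=
  .seq (.incs 0 d) (if b then .loopRaw (.incs 0 B) else .skip)

section Realization

variable {D m : ℕ} [NeZero D] {H N : ℕ} {k : List Prog} {n : ℕ} {σ : ℕ → ℕ}

/-- The first digit is available in the program `f d b` as a constant; the rest, if any, is read
with weight `alphabetSize D m`. -/
theorem moves_readInput {V x : ℕ} {q : Prog} (hD : 2 ≤ D) (hm : 6 < m) (hV : V < D ^ N) (hx : x ≤ V)
    (hN : 0 < N) {d : Fin (alphabetSize D m)} {rest : List (Fin (alphabetSize D m))}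
    (hH : N + room rest ≤ H)
    (hd : numeral (alphabetSize D m) (two_le_alphabetSize D m) x = d :: rest)
    (hxd : x = d + alphabetSize D m * rawValue rest) :
    ∃ n w, 0 < n ∧ n ≤ N ∧ Area w (push n (loopRegs x 0 0)) ∧ w.length = n ∧
      Moves (progTable fun d b => .seq (.readInput (alphabetSize D m) d b) q) H (atBoot D m x)
        (atStart [q] w []) := by
  set f : ℕ → Bool → Prog := fun d b => .seq (.readInput (alphabetSize D m) d b) q with hf
  obtain ⟨w, hw, hl, h1⟩ := moves_boot (f := f) (H := H) hD (by omega) d rest (by omega)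
  have e : ∀ a b c : ℕ, Function.update (loopRegs a 0 0) 0 b = loopRegs b 0 0 := by
    intro a b c; funext r
    by_cases h : r = 0
    · subst h; simp [loopRegs]
    · simp [loopRegs, h]
  have e0 : (0 : ℕ → ℕ) = loopRegs 0 0 0 := by funext r; simp [loopRegs]
  rw [e0] at hw
  obtain ⟨n, h0, hn, h2⟩ := Effect.incs (f := f) (H := H) (N := N) (σ := loopRegs 0 0 0) (r := 0)
    (raw := rest) hD (by omega) hV hH (d : ℕ) (by simp [loopRegs]; omega)
    ((if (!rest.isEmpty) then .loopRaw (.incs 0 (alphabetSize D m)) else .skip) :: [q]) 1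
    (by omega) (by omega)
  have h3 : Runs f H [f d !rest.isEmpty] (push 1 (loopRegs 0 0 0)) 1 rest _ _ n rest :=
    Runs.seq.trans (Runs.seq.trans h2)
  rw [e _ _ 0] at h3
  have h4 : ∃ n', 0 < n' ∧ n' ≤ N ∧ Runs f H [f d !rest.isEmpty] (push 1 (loopRegs 0 0 0)) 1 rest
      [q] (push n' (loopRegs x 0 0)) n' [] := by
    cases rest with
    | nil =>
      refine ⟨n, by omega, hn, ?_⟩
      have : x = loopRegs 0 0 0 0 + d := by rw [hxd]; simp [loopRegs]
      rw [← this] at h3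
      exact h3.trans Runs.skip
    | cons a rest =>
      obtain ⟨n', h0', hn', h5⟩ := runs_read (f := f) (H := H) (N := N) (k := [q]) (n := n) (r := 0)
        (σ := loopRegs d 0 0) (B := alphabetSize D m) (l := (a :: rest).length) hD
        (by omega) hV (by simp)
        (by simpa [room] using hH) (rawValue (a :: rest)) (wordValue_lt (fun a => a.2) _)
        (by simp only [loopRegs, if_true]; omega) (by omega) hn
      rw [rawWord_rawValue, e _ _ 0] at h5
      refine ⟨n', by omega, hn', h3.trans ?_⟩
      have h6 : loopRegs 0 0 0 0 + (d : ℕ) = d := by simp [loopRegs]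
      have h7 : x = loopRegs d 0 0 0 + alphabetSize D m * rawValue (a :: rest) := by
        simpa [loopRegs] using hxd
      rw [h6]
      rw [← h7] at h5
      exact h5
  obtain ⟨n', h0', hn', h5⟩ := h4
  obtain ⟨w', hw', hl', h6⟩ := h5 w hw hl
  exact ⟨n', w', h0', hn', hw', hl', by rw [atBoot, hd]; exact h1.trans h6⟩

end Realization

/-- All numbers in the loop are below `K ^ s`, where `s` is the prescribed space. Tracks with a
sufficiently large base `D` hold them in about `s / 8` cells. The remaining cells accommodate the
raw input at the start, and the raw output and padding at the end. As `s` becomes known only after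
the loop, the area is not laid out in advance but grows on demand. -/
theorem exists_algorithm {ini stp flag out tot : ℕ → ℕ} (hini : LinSpace fun σ => ini (σ 0))
    (hstp : LinSpace fun σ => stp (σ 0)) (hflag : LinSpace fun σ => flag (σ 0))
    (hout : LinSpace fun σ => out (σ 0)) (htot : LinSpace fun σ => tot (σ 0)) (K : ℕ) :
    ∃ T : Algorithm, ∀ x,
      (∀ t M, (∀ i < t, flag (stp^[i] (ini x)) ≠ 0) → flag (stp^[t] (ini x)) = 0 →
        1 ≤ tot (stp^[t] (ini x)) → x ≤ M → (∀ i ≤ t, stp^[i] (ini x) ≤ M) →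
        M + 2 ≤ K ^ tot (stp^[t] (ini x)) →
        T.eval x = Part.some (out (stp^[t] (ini x))) ∧ T.space x = tot (stp^[t] (ini x))) ∧
      ((∀ i, flag (stp^[i] (ini x)) ≠ 0) → ¬ (T.eval x).Dom) := by
  obtain ⟨pi, pb, po, m, c, hm, hc, hp⟩ := exists_loop_programs hini hstp hflag hout htot
  -- Chosen so that `M + 2 ≤ K ^ s` implies `(M + 2) ^ c < W ^ s`; the latter is the bound on the
  -- registers.
  set W := (K + 2) ^ (c + 1) with hW
  have hW2 : 2 ≤ W := by
    rw [hW, pow_succ]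
    have : 1 ≤ (K + 2) ^ c := Nat.one_le_pow _ _ (by omega)
    nlinarith
  -- The eighth power lets an area of `s / 8` cells, rounded up, hold all numbers below `W ^ s`.
  set D := W ^ 8 with hDdef
  have hD : 2 ≤ D := hW2.trans (Nat.le_self_pow (by omega) W)
  have : NeZero D := ⟨by omega⟩
  set B := alphabetSize D m with hB
  have hBD : D ≤ B := le_alphabetSize D m (by omega)
  set tl : Prog := .seq po (.ifBig 5 .outputWord .outputDigit) with htl
  set q : Prog := .seq pi (.seq (.loop 4 pb) tl) with hq
  set f : ℕ → Bool → Prog := fun d b => .seq (.readInput B d b) q with hf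
  have hle : ∀ M, M ≤ (M + 2) ^ c := fun M =>
    (Nat.le_add_right M 2).trans (Nat.le_self_pow (by omega) _)
  -- reading the input and the initial value of the loop
  have key0 : ∀ x M N H, x ≤ M → ini x ≤ M → (M + 2) ^ c < D ^ N → 0 < N →
      (∀ d rest, numeral B (two_le_alphabetSize D m) x = d :: rest → N + room rest ≤ H) →
      ∃ n w, 0 < n ∧ n ≤ N ∧ Area w (push n (loopRegs x (ini x) (flag (ini x)))) ∧ w.length = n ∧
        Moves (progTable f) H (atBoot D m x) (atStart [.loop 4 pb, tl] w []) := by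
    intro x M N H hx hi hV hN hH
    obtain ⟨d, rest, h1, h2, -⟩ := exists_numeral B (two_le_alphabetSize D m) x
    have hMV : x ≤ (M + 2) ^ c := hx.trans (hle M)
    obtain ⟨n, w, h0, hn, hw, hl, h3⟩ := moves_readInput (q := q) hD hm hV hMV hN (hH _ _ h1) h1 h2
    obtain ⟨n', h0', hn', h4⟩ := Effect.of_exec (f := f) (H := H) (N := N)
      (raw := ([] : List (Fin (alphabetSize D m)))) hD hV (by have := hH _ _ h1; simp [room]; omega)
      ((hp M _ le_rfl).1 x hx hi) [.seq (.loop 4 pb) tl] n h0 hn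
    obtain ⟨w', hw', hl', h5⟩ := (Runs.seq.trans (h4.trans Runs.seq)) w hw hl
    exact ⟨n', w', by omega, hn', hw', hl', h3.trans h5⟩
  -- one pass through the loop
  have key1 : ∀ x a M N H n (w : List (Fin (alphabetSize D m))), 0 < n → n ≤ N → N ≤ H → a ≤ M → stp a ≤ M → (M + 2) ^ c < D ^ N →
      flag a ≠ 0 →  Area w (push n (loopRegs x a (flag a))) → w.length = n →
      Moves (progTable f) H (atStart [.loop 4 pb, tl] w []) (atStart [pb, .loop 4 pb, tl] w []) ∧
      ∃ n' w', 0 < n' ∧ n' ≤ N ∧ Area w' (push n' (loopRegs x (stp a) (flag (stp a)))) ∧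
        w'.length = n' ∧
        Moves (progTable f) H (atStart [pb, .loop 4 pb, tl] w []) (atStart [.loop 4 pb, tl] w' []) := by
    intro x a M N H n w h0 hn hH ha hs hV hfl hw hl
    constructor
    · have := moves_loop_test (f := f) (H := H) (k := [tl]) (t := 4) (p := pb) (raw := []) (by omega) hw
        (by omega)
      rwa [if_pos (by simpa [loopRegs] using hfl)] at this
    · obtain ⟨n', h0', hn', h4⟩ := Effect.of_exec (f := f) (H := H) (N := N)
        (raw := ([] : List (Fin (alphabetSize D m)))) hD hV (by simp [room]; omega)
        ((hp M _ le_rfl).2.1 x a ha hs) [.loop 4 pb, tl] n h0 hn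
      obtain ⟨w', hw', hl', h5⟩ := h4 w hw hl
      exact ⟨n', w', by omega, hn', hw', hl', h5⟩
  refine ⟨progAlgorithm D m f, fun x => ⟨fun t M hfl hft htot hx hM hK => ?_, fun hfl => ?_⟩⟩
  · set s := tot (stp^[t] (ini x)) with hs
    set N := (s + 7) / 8 with hN
    have hV : (M + 2) ^ c < W ^ s := by
      calc (M + 2) ^ c ≤ (K ^ s) ^ c := Nat.pow_le_pow_left hK c
        _ ≤ ((K + 2) ^ s) ^ c := Nat.pow_le_pow_left (Nat.pow_le_pow_left (by omega) _) c
        _ = (K + 2) ^ (s * c) := by rw [← pow_mul]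
        _ < (K + 2) ^ ((c + 1) * s) := Nat.pow_lt_pow_right (by omega) (by nlinarith)
        _ = W ^ s := by rw [pow_mul]
    have hVN : (M + 2) ^ c < D ^ N := by
      rw [hDdef, ← pow_mul]
      exact hV.trans_le (Nat.pow_le_pow_right (by omega) (by omega))
    have hxW : x < W ^ s := (hx.trans (hle M)).trans_lt hV
    have hrest : ∀ d rest, numeral B (two_le_alphabetSize D m) x = d :: rest → N + room rest ≤ s := by
      intro d rest hd
      obtain ⟨d', rest', h1, -, h2⟩ := exists_numeral B (two_le_alphabetSize D m) x
      obtain ⟨rfl, rfl⟩ : d = d' ∧ rest = rest' := by simpa using hd.symm.trans h1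
      unfold room
      split_ifs with h
      · omega
      -- The raw input also takes less than `s / 8` cells, since its base is at least `W ^ 8`. With
      -- a nonempty rest this forces `s > 8`, which leaves room for the separating blank too.
      · have h3 : W ^ (8 * rest.length) < W ^ s := by
          rw [pow_mul, ← hDdef]
          exact (Nat.pow_le_pow_left hBD _).trans_lt ((h2 h).trans_lt hxW)
        have h4 := (Nat.pow_lt_pow_iff_right (by omega)).1 h3
        have := List.length_pos_of_ne_nil h
        omega
    have loop : ∀ i ≤ t, ∃ n w, 0 < n ∧ n ≤ N ∧
        Area w (push n (loopRegs x (stp^[i] (ini x)) (flag (stp^[i] (ini x))))) ∧ w.length = n ∧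
        Moves (progTable f) s (atBoot D m x) (atStart [.loop 4 pb, tl] w []) := by
      intro i
      induction i with
      | zero => intro _; exact key0 x M N s hx (hM 0 (by omega)) hVN (by omega) hrest
      | succ i ih =>
        intro hi
        obtain ⟨n, w, h0, hn, hw, hl, h1⟩ := ih (by omega)
        obtain ⟨h2, n', w', h0', hn', hw', hl', h3⟩ := key1 x (stp^[i] (ini x)) M N s n w h0 hn
          (by omega) (hM i (by omega))
          (by have := hM (i + 1) hi; rwa [Function.iterate_succ_apply'] at this) hVN
          (hfl i (by omega)) hw hl
        rw [Function.iterate_succ_apply']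
        exact ⟨n', w', h0', hn', hw', hl', h1.trans (h2.trans h3)⟩
    obtain ⟨n, w, h0, hn, hw, hl, h1⟩ := loop t le_rfl
    rw [hft] at hw
    obtain ⟨hob, σ, hσ4, hσ5, hex⟩ := (hp M _ le_rfl).2.2 x _ (hM t le_rfl)
    have h2 := moves_loop_test (f := f) (H := s) (k := [tl]) (t := 4) (p := pb) (raw := []) (by omega) hw
        (by omega)
    rw [if_neg (by simp [loopRegs])] at h2
    obtain ⟨n', h0', hn', h3⟩ := Effect.of_exec (f := f) (H := s) (N := N)
      (raw := ([] : List (Fin (alphabetSize D m)))) hD hVN (by simp [room]; omega)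
      hex [.ifBig 5 .outputWord .outputDigit] n h0 hn
    obtain ⟨w', hw', hl', h4⟩ := (Runs.seq.trans (h3.trans (Runs.ifBig (by omega) (by omega)))) w hw hl
    rw [push_succ, hσ4] at h4
    have h5 : ∃ c, c.2.1.length = s ∧ Moves (progTable f) s (atBoot D m x) c ∧
      ∃ k' l r, readNumber (ListBlank.mk r) = σ 4 ∧
        Moves (progTable f) s c ((k', .done), l, r) := by
      split_ifs at h4 with hbig
      -- An output of at least `D` forces `s > 8`, so area, separator and raw output fit: `2 * N + 1
      -- ≤ s`. Smaller outputs need their own treatment, as `s` may be as small as `1`.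
      · have : W ^ 8 < W ^ s := by rw [← hDdef]; omega
        have := (Nat.pow_lt_pow_iff_right (by omega)).1 this
        obtain ⟨c, h6, h7, h8⟩ := moves_outputWord (f := f) (H := s) (k := []) hD hm hw' hl' hσ5 (by omega)
        exact ⟨c, h6, h1.trans (h2.trans (h4.trans h7)), h8⟩
      · obtain ⟨c, h6, h7, h8⟩ := moves_outputDigit (f := f) (H := s) (k := []) hD hm hw' hl' hσ5 (by omega)
          (by omega)
        exact ⟨c, h6, h1.trans (h2.trans (h4.trans h7)), h8⟩
    obtain ⟨c, h6, h7, k', l, r, h8, h9⟩ := h5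
    obtain ⟨h10, h11⟩ := progAlgorithm_space h7 h6 h9
    refine ⟨by rw [h10, h8, hσ4], h11 ?_⟩
    obtain ⟨d, rest, h12, -⟩ := exists_numeral B (two_le_alphabetSize D m) x
    have h13 := hrest _ _ h12
    have := length_le_room rest
    rw [h12, List.length_cons]
    omega
  -- In the diverging case no common bound is available or needed; every pass through the loop gets
  -- its own.
  · have hbound : ∀ M, ∃ N, 0 < N ∧ (M + 2) ^ c < D ^ N := fun M =>
      ⟨(M + 2) ^ c + 1, by omega, ((M + 2) ^ c).lt_two_pow_self.trans_le
        ((Nat.pow_le_pow_left hD _).trans (Nat.pow_le_pow_right (by omega) (by omega)))⟩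
    refine progAlgorithm_not_dom (P := fun c => ∃ i n w, 0 < n ∧
      Area w (push n (loopRegs x (stp^[i] (ini x)) (flag (stp^[i] (ini x))))) ∧ w.length = n ∧
      c = atStart [.loop 4 pb, tl] w []) ?_ ?_
    · obtain ⟨N, hN, hV⟩ := hbound (x + ini x)
      obtain ⟨d, rest, h1, -⟩ := exists_numeral B (two_le_alphabetSize D m) x
      obtain ⟨n, w, h0, hn, hw, hl, h2⟩ := key0 x (x + ini x) N (N + room rest) (by omega) (by omega)
        hV hN (fun d' rest' h => by
          obtain ⟨rfl, rfl⟩ : d = d' ∧ rest = rest' := by simpa using h1.symm.trans h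
          exact le_rfl)
      exact ⟨_, _, h2, 0, n, w, h0, hw, hl, rfl⟩
    · rintro _ ⟨i, n, w, h0, hw, hl, rfl⟩
      obtain ⟨N, hN, hV⟩ := hbound (stp^[i] (ini x) + stp (stp^[i] (ini x)))
      obtain ⟨h2, n', w', h0', hn', hw', hl', h3⟩ := key1 x (stp^[i] (ini x)) _ (N + n) (N + n) n w h0
        (by omega) le_rfl (Nat.le_add_right _ _) (Nat.le_add_left _ _)
        (hV.trans_le (Nat.pow_le_pow_right (by omega) (by omega))) (hfl i) hw hl
      refine ⟨_, _, _, ⟨i + 1, n', w', h0', ?_, hl', rfl⟩, ?_, Nat.zero_le _, h2, h3⟩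
      · rw [Function.iterate_succ_apply']; exact hw'
      · intro h
        have := congrArg (fun q => q.1.length) h
        simp at this

end TuringSpace

/-! ### Conversion of numerals between bases -/

namespace TuringSpace

/-- One step in the conversion of a numeral from the base `b₁` to the base `b₂`, where `s - 1` is added
to each digit. The conversion ends with the number `0` if `s ≠ 0`, and with a digit `0` if `s = 0`.
The components of `z` are the part of the number that remains to be converted, the value of the
converted part, and its length `l`, preceded by `b₂ ^ l`. -/
def convStep (b₁ b₂ s z : ℕ) : ℕ :=
  if z.unpair.1 % b₁ + s * z.unpair.1 = 0 then z else
    Nat.pair (z.unpair.1 / b₁) (Nat.pair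
      (z.unpair.2.unpair.1 + (z.unpair.1 % b₁ + s - 1) * z.unpair.2.unpair.2.unpair.1)
      (Nat.pair (z.unpair.2.unpair.2.unpair.1 * b₂) (z.unpair.2.unpair.2.unpair.2 + 1)))

/-- The conversion of a numeral. -/
def conv (b₁ b₂ s y : ℕ) : ℕ := (convStep b₁ b₂ s)^[y] (Nat.pair y (Nat.pair 0 (Nat.pair 1 0)))

theorem convStep_pair (b₁ b₂ s y v P l : ℕ) :
    convStep b₁ b₂ s (Nat.pair y (Nat.pair v (Nat.pair P l))) = if y % b₁ + s * y = 0 then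
      Nat.pair y (Nat.pair v (Nat.pair P l)) else
      Nat.pair (y / b₁) (Nat.pair (v + (y % b₁ + s - 1) * P) (Nat.pair (P * b₂) (l + 1))) := by
  simp only [convStep, Nat.unpair_pair]

theorem pair_mono {a a' b b' : ℕ} (ha : a ≤ a') (hb : b ≤ b') : Nat.pair a b ≤ Nat.pair a' b' :=
  (ha.lt_or_eq.elim (fun h => (Nat.pair_lt_pair_left b h).le) fun h => h ▸ le_rfl).trans
    (hb.lt_or_eq.elim (fun h => (Nat.pair_lt_pair_right a' h).le) fun h => h ▸ le_rfl)

/-- As long as digits are being converted, `b₁ ^ l ≤ y`. With `b₂ ≤ b₁ ^ 2` the power `b₂ ^ l` stays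
polynomial in `b₁ * y`, and it bounds the converted part. -/
theorem exists_convStep_iterate {b₁ b₂ s y : ℕ} (h1 : 2 ≤ b₁) (h3 : b₂ ≤ b₁ ^ 2)
    (h4 : ∀ y, y % b₁ + s - 1 < b₂) (t : ℕ) :
    ∃ z v P l, (convStep b₁ b₂ s)^[t] (Nat.pair y (Nat.pair 0 (Nat.pair 1 0)))
        = Nat.pair z (Nat.pair v (Nat.pair P l)) ∧
      b₁ ^ l * z ≤ y ∧ P = b₂ ^ l ∧ v < P ∧ P ≤ (b₁ * y + 1) ^ 2 ∧ l ≤ y := by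
  induction t with
  | zero => exact ⟨y, 0, 1, 0, rfl, by simp, by simp, by simp, Nat.one_le_pow _ _ (by omega), by simp⟩
  | succ t ih =>
    obtain ⟨z, v, P, l, e, hz, hP, hv, hb, hl⟩ := ih
    rw [Function.iterate_succ_apply', e, convStep_pair]
    split_ifs with h
    · exact ⟨z, v, P, l, rfl, hz, hP, hv, hb, hl⟩
    · have hz0 : z ≠ 0 := by rintro rfl; simp at h
      have hly : b₁ ^ l ≤ y := by nlinarith [Nat.pos_of_ne_zero hz0]
      refine ⟨_, _, _, _, rfl, ?_, ?_, ?_, ?_, ?_⟩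
      · rw [pow_succ, mul_assoc]
        exact (Nat.mul_le_mul_left _ (Nat.mul_div_le z b₁)).trans hz
      · rw [hP, pow_succ]
      · have := h4 z
        nlinarith
      · rw [hP, ← pow_succ]
        calc b₂ ^ (l + 1) ≤ (b₁ ^ 2) ^ (l + 1) := Nat.pow_le_pow_left h3 _
          _ = (b₁ * b₁ ^ l) ^ 2 := by ring
          _ ≤ (b₁ * y + 1) ^ 2 := Nat.pow_le_pow_left
            ((Nat.mul_le_mul_left _ hly).trans (Nat.le_succ _)) _
      · exact (Nat.lt_pow_self (by omega)).trans_le hly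

theorem LinSpace.conv {b₁ b₂ y : (ℕ → ℕ) → ℕ} {s : ℕ} (hb₁ : LinSpace b₁) (hb₂ : LinSpace b₂)
    (hy : LinSpace y) (h1 : ∀ σ, 2 ≤ b₁ σ) (h3 : ∀ σ, b₂ σ ≤ b₁ σ ^ 2)
    (h4 : ∀ σ y, y % b₁ σ + s - 1 < b₂ σ) :
    LinSpace fun σ => conv (b₁ σ) (b₂ σ) s (y σ) := by
  have hB : LinSpace fun σ => (b₁ σ * y σ + 1) * (b₁ σ * y σ + 1) :=
    ((hb₁.mul hy).succ).mul ((hb₁.mul hy).succ)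
  have hz : LinSpace fun σ => σ 0 := var 0
  have hst : LinSpace fun σ => convStep (b₁ fun i => σ (i + 1)) (b₂ fun i => σ (i + 1)) s (σ 0) :=
    ite_zero ((hz.fst.mod hb₁.weaken).add ((const s).mul hz.fst)) hz
      ((hz.fst.div hb₁.weaken).pair (((hz.snd.fst).add
        ((((hz.fst.mod hb₁.weaken).add (const s)).pred).mul hz.snd.snd.fst)).pair
        ((hz.snd.snd.fst.mul hb₂.weaken).pair hz.snd.snd.snd.succ)))
  refine (iterate hy (hy.pair (zero.pair ((const 1).pair zero))) hst
    (hy.pair (hB.pair (hB.pair hy))) fun σ t _ => ?_)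
  obtain ⟨z, v, P, l, e, hz, hP, hv, hb, hl⟩ := exists_convStep_iterate (y := y σ) (h1 σ) (h3 σ)
    (h4 σ) t
  refine (le_of_eq e).trans ?_
  rw [pow_two] at hb
  have : z ≤ y σ := le_trans (Nat.le_mul_of_pos_left z (Nat.pow_pos (by have := h1 σ; omega))) hz
  exact pair_mono this (pair_mono (by omega) (pair_mono hb hl))

/-- The condition `hw` says that the conversion does not stop before the word `w` is exhausted; `r`
is the part of the number behind it. -/
theorem convStep_iterate_word {b₁ b₂ s : ℕ} (h1 : 2 ≤ b₁) (w : List ℕ) (r v P l : ℕ)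
    (hd : ∀ d ∈ w, d < b₁)
    (hw : ∀ u z, w = u ++ z → z ≠ [] →
      (Nat.ofDigits b₁ z + b₁ ^ z.length * r) % b₁ + s * (Nat.ofDigits b₁ z + b₁ ^ z.length * r) ≠ 0) :
    (convStep b₁ b₂ s)^[w.length]
      (Nat.pair (Nat.ofDigits b₁ w + b₁ ^ w.length * r) (Nat.pair v (Nat.pair P l)))
    = Nat.pair r (Nat.pair (v + P * Nat.ofDigits b₂ (w.map fun d => d + s - 1))
        (Nat.pair (P * b₂ ^ w.length) (l + w.length))) := by
  induction w generalizing v P l with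
  | nil => simp
  | cons d w ih =>
    have hd' := hd d (by simp)
    have e : Nat.ofDigits b₁ (d :: w) + b₁ ^ (d :: w).length * r
        = d + b₁ * (Nat.ofDigits b₁ w + b₁ ^ w.length * r) := by
      rw [Nat.ofDigits_cons, List.length_cons, pow_succ]; ring
    have hne := hw [] (d :: w) rfl (by simp)
    rw [List.length_cons, Function.iterate_succ_apply, convStep_pair, ← List.length_cons (a := d),
      if_neg hne, e, Nat.add_mul_mod_self_left, Nat.mod_eq_of_lt hd',
      Nat.add_mul_div_left _ _ (by omega), Nat.div_eq_of_lt hd', zero_add,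
      ih _ _ _ (fun d hd' => hd d (by simp [hd'])) fun u z h hz => hw (d :: u) z (by simp [h]) hz,
      List.map_cons, Nat.ofDigits_cons, List.length_cons, pow_succ]
    congr 2
    · ring
    · congr 1
      · ring
      · ring

theorem conv_eq {b₁ b₂ s : ℕ} (h1 : 2 ≤ b₁) (w : List ℕ) (r : ℕ) (hd : ∀ d ∈ w, d < b₁)
    (hw : ∀ u z, w = u ++ z → z ≠ [] →
      (Nat.ofDigits b₁ z + b₁ ^ z.length * r) % b₁ + s * (Nat.ofDigits b₁ z + b₁ ^ z.length * r) ≠ 0)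
    (hr : r % b₁ + s * r = 0) :
    conv b₁ b₂ s (Nat.ofDigits b₁ w + b₁ ^ w.length * r) = Nat.pair r (Nat.pair
      (Nat.ofDigits b₂ (w.map fun d => d + s - 1)) (Nat.pair (b₂ ^ w.length) w.length)) := by
  -- The conversion makes `y` steps, which must be enough. Not having stopped at the last digit of
  -- `w`, it found a nonzero number there, so `y` is at least the place value of that digit. After
  -- `w` the iteration is stationary by `hr`.
  have hlen : w.length ≤ Nat.ofDigits b₁ w + b₁ ^ w.length * r := by
    rcases List.eq_nil_or_concat w with rfl | ⟨u, d, rfl⟩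
    · simp
    · have h3 := hw u [d] (by simp) (by simp)
      have h4 : d + b₁ * r ≠ 0 := by
        intro h
        simp at h3
        obtain ⟨rfl, h5⟩ : d = 0 ∧ b₁ * r = 0 := by omega
        rcases Nat.mul_eq_zero.1 h5 with h6 | rfl
        · omega
        · simp at h3
      rw [List.concat_eq_append, Nat.ofDigits_append, List.length_append, List.length_singleton,
        pow_succ, Nat.ofDigits_singleton]
      have : u.length < b₁ ^ u.length := Nat.lt_pow_self (by omega)
      nlinarith [Nat.pos_of_ne_zero h4, Nat.zero_le (Nat.ofDigits b₁ u)]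
  obtain ⟨k, hk⟩ := Nat.exists_eq_add_of_le' hlen
  have hfix : ∀ v, convStep b₁ b₂ s (Nat.pair r v) = Nat.pair r v := by
    intro v
    simp [convStep, hr]
  rw [conv]
  nth_rewrite 1 [hk]
  rw [Function.iterate_add_apply, convStep_iterate_word h1 w r 0 1 0 hd hw,
    Function.iterate_fixed (hfix _)]
  simp

end TuringSpace

/-! ### Arithmetization of Turing machines -/

namespace TuringSpace

/-- The base of the machine with code `e`. -/
def machBase (e : ℕ) : ℕ := e.unpair.1 + 2

/-- The code of the initial configuration of the machine with code `e` on the input `x`. A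
configuration consists of the state, the numbers denoted by the two half-tapes, and the number of
used cells to the left and to the right of the head. -/
def machInit (e x : ℕ) : ℕ :=
  Nat.pair e.unpair.2.unpair.1 (Nat.pair 0 (if x = 0 then Nat.pair 1 (Nat.pair 0 1) else
    Nat.pair (conv (machBase e) (machBase e + 1) 2 x).unpair.2.unpair.1
      (Nat.pair 0 (conv (machBase e) (machBase e + 1) 2 x).unpair.2.unpair.2.unpair.2)))

/-- The entry of the transition table for the configuration `c`; it is `0` if the machine halts. -/
def machAction (e c : ℕ) : ℕ :=
  Nat.beta e.unpair.2.unpair.2 (c.unpair.1 * (machBase e + 1) + c.unpair.2.unpair.2.unpair.1 % (machBase e + 1))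

/-- The effect on the tape of moving left, for the base `d`. -/
def moveLeft (d s : ℕ) : ℕ :=
  Nat.pair (s.unpair.1 / d) (Nat.pair (s.unpair.2.unpair.1 * d + s.unpair.1 % d)
    (Nat.pair (s.unpair.2.unpair.2.unpair.1 - 1) (s.unpair.2.unpair.2.unpair.2 + 1)))

/-- The effect on the tape of moving right, for the base `d`. -/
def moveRight (d s : ℕ) : ℕ :=
  Nat.pair (s.unpair.1 * d + s.unpair.2.unpair.1 % d) (Nat.pair (s.unpair.2.unpair.1 / d)
    (Nat.pair (s.unpair.2.unpair.2.unpair.1 + 1) (s.unpair.2.unpair.2.unpair.2 - 1)))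

/-- The effect on the tape of writing the symbol with code `a`, for the base `d`. -/
def writeSymbol (d a s : ℕ) : ℕ :=
  Nat.pair s.unpair.1 (Nat.pair (s.unpair.2.unpair.1 - s.unpair.2.unpair.1 % d + a) s.unpair.2.unpair.2)

/-- A step of the machine with code `e`. -/
def machStep (e c : ℕ) : ℕ :=
  Nat.pair (machAction e c - 1).unpair.1
    (if (machAction e c - 1).unpair.2 = 0 then moveLeft (machBase e + 1) c.unpair.2
    else if (machAction e c - 1).unpair.2 = 1 then moveRight (machBase e + 1) c.unpair.2
    else writeSymbol (machBase e + 1) ((machAction e c - 1).unpair.2 - 2) c.unpair.2)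

/-- The output in the configuration `c`. -/
def machOut (e c : ℕ) : ℕ :=
  (conv (machBase e + 1) (machBase e) 0 c.unpair.2.unpair.2.unpair.1).unpair.2.unpair.1

/-- The space used up to the configuration `c`. -/
def machSpace (c : ℕ) : ℕ := c.unpair.2.unpair.2.unpair.2.unpair.1 + c.unpair.2.unpair.2.unpair.2.unpair.2

namespace LinSpace

variable {f g h : (ℕ → ℕ) → ℕ}

theorem machBase (hf : LinSpace f) : LinSpace fun σ => machBase (f σ) := hf.fst.succ.succ

theorem beta (hf : LinSpace f) (hg : LinSpace g) : LinSpace fun σ => Nat.beta (f σ) (g σ) :=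
  hf.fst.mod ((hg.succ.mul hf.snd).succ)

theorem machInit (hf : LinSpace f) (hg : LinSpace g) : LinSpace fun σ => machInit (f σ) (g σ) := by
  have hc : LinSpace fun σ => TuringSpace.conv (TuringSpace.machBase (f σ))
      (TuringSpace.machBase (f σ) + 1) 2 (g σ) :=
    LinSpace.conv hf.machBase hf.machBase.succ hg (fun σ => Nat.le_add_left _ _)
      (fun σ => by unfold TuringSpace.machBase; nlinarith)
      (fun σ y => by
        have := Nat.mod_lt y (y := TuringSpace.machBase (f σ)) (Nat.succ_pos _)
        omega)
  exact hf.snd.fst.pair (zero.pair (ite_zero hg ((const 1).pair (zero.pair (const 1)))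
    (hc.snd.fst.pair (zero.pair hc.snd.snd.snd))))

theorem machAction (hf : LinSpace f) (hg : LinSpace g) : LinSpace fun σ => machAction (f σ) (g σ) :=
  hf.snd.snd.beta ((hg.fst.mul hf.machBase.succ).add (hg.snd.snd.fst.mod hf.machBase.succ))

theorem moveLeft (hf : LinSpace f) (hg : LinSpace g) : LinSpace fun σ => moveLeft (f σ) (g σ) :=
  (hg.fst.div hf).pair (((hg.snd.fst.mul hf).add (hg.fst.mod hf)).pair
    (hg.snd.snd.fst.pred.pair hg.snd.snd.snd.succ))

theorem moveRight (hf : LinSpace f) (hg : LinSpace g) : LinSpace fun σ => moveRight (f σ) (g σ) :=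
  ((hg.fst.mul hf).add (hg.snd.fst.mod hf)).pair ((hg.snd.fst.div hf).pair
    (hg.snd.snd.fst.succ.pair hg.snd.snd.snd.pred))

theorem writeSymbol (hf : LinSpace f) (hg : LinSpace g) (hh : LinSpace h) :
    LinSpace fun σ => writeSymbol (f σ) (g σ) (h σ) :=
  hh.fst.pair (((hh.snd.fst.sub (hh.snd.fst.mod hf)).add hg).pair hh.snd.snd)

theorem machStep (hf : LinSpace f) (hg : LinSpace g) : LinSpace fun σ => machStep (f σ) (g σ) :=
  (hf.machAction hg).pred.fst.pair (ite_zero (hf.machAction hg).pred.snd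
    (hf.machBase.succ.moveLeft hg.snd) (ite_eq (hf.machAction hg).pred.snd (const 1)
      (hf.machBase.succ.moveRight hg.snd)
      (hf.machBase.succ.writeSymbol ((hf.machAction hg).pred.snd.sub (const 2)) hg.snd)))

theorem machOut (hf : LinSpace f) (hg : LinSpace g) : LinSpace fun σ => machOut (f σ) (g σ) :=
  (LinSpace.conv (s := 0) hf.machBase.succ hf.machBase hg.snd.snd.fst
    (fun σ => (Nat.le_add_left _ _).trans (Nat.le_succ _)) (fun σ => by nlinarith)
    (fun σ y => by
      have := Nat.mod_lt y (y := TuringSpace.machBase (f σ) + 1) (Nat.succ_pos _)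
      have : 2 ≤ TuringSpace.machBase (f σ) := Nat.le_add_left _ _
      omega)).snd.fst

theorem machSpace (hf : LinSpace f) : LinSpace fun σ => machSpace (f σ) :=
  hf.snd.snd.snd.fst.add hf.snd.snd.snd.snd

end LinSpace

section Encoding

variable {b : ℕ}

/-- The code of a symbol. -/
def symbolCode (o : Option (Fin b)) : ℕ := o.elim 0 fun d => d + 1

theorem symbolCode_lt (o : Option (Fin b)) : symbolCode o < b + 1 := by
  cases o <;> simp [symbolCode]

theorem symbolCode_injective : Function.Injective (symbolCode (b := b)) := by
  rintro (_ | x) (_ | y) h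
  · rfl
  · simp [symbolCode] at h
  · simp [symbolCode] at h
  · simp [symbolCode] at h
    rw [Fin.ext h]

/-- The number denoted by a half-tape. -/
def tapeNumber (l : ListBlank (Option (Fin b))) : ℕ :=
  l.liftOn (fun w => Nat.ofDigits (b + 1) (w.map symbolCode)) (by
    rintro w _ ⟨k, rfl⟩
    rw [List.map_append, Nat.ofDigits_append]
    simp [symbolCode, show (default : Option (Fin b)) = none from rfl, Nat.ofDigits_replicate_zero])

theorem tapeNumber_mk (w : List (Option (Fin b))) :
    tapeNumber (ListBlank.mk w) = Nat.ofDigits (b + 1) (w.map symbolCode) := rfl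

theorem tapeNumber_cons (a : Option (Fin b)) (l : ListBlank (Option (Fin b))) :
    tapeNumber (l.cons a) = symbolCode a + (b + 1) * tapeNumber l := by
  refine l.inductionOn fun w => ?_
  show Nat.ofDigits (b + 1) ((a :: w).map symbolCode) = _ + _ * Nat.ofDigits (b + 1) (w.map symbolCode)
  simp [Nat.ofDigits_cons]

theorem tapeNumber_head_tail (l : ListBlank (Option (Fin b))) :
    tapeNumber l = symbolCode l.head + (b + 1) * tapeNumber l.tail := by
  rw [← tapeNumber_cons, ListBlank.cons_head_tail]

theorem tapeNumber_mod (l : ListBlank (Option (Fin b))) :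
    tapeNumber l % (b + 1) = symbolCode l.head := by
  rw [tapeNumber_head_tail, Nat.add_mul_mod_self_left, Nat.mod_eq_of_lt (symbolCode_lt _)]

theorem tapeNumber_div (l : ListBlank (Option (Fin b))) :
    tapeNumber l / (b + 1) = tapeNumber l.tail := by
  rw [tapeNumber_head_tail, Nat.add_mul_div_left _ _ (by omega),
    Nat.div_eq_of_lt (symbolCode_lt _), zero_add]

/-- Codes of digits are one more than the digits and the blank has code `0`. The conversion with `s
= 0` therefore subtracts one from each digit and stops at the first blank; `r` is the remaining
tape, beginning with a blank. -/
theorem readNumber_eq_conv (hb : 2 ≤ b) (l : ListBlank (Option (Fin b))) :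
    (conv (b + 1) b 0 (tapeNumber l)).unpair.2.unpair.1 = readNumber l := by
  refine l.inductionOn fun w => ?_
  show (conv (b + 1) b 0 (Nat.ofDigits (b + 1) (w.map symbolCode))).unpair.2.unpair.1
    = Nat.ofDigits b (leadingDigits w)
  obtain ⟨u, r, h1, h2⟩ : ∃ (u : List (Fin b)) (r : ℕ), r % (b + 1) = 0 ∧
      (Nat.ofDigits (b + 1) (w.map symbolCode) = Nat.ofDigits (b + 1) (u.map fun d : Fin b => (d : ℕ) + 1)
        + (b + 1) ^ (u.map fun d : Fin b => (d : ℕ) + 1).length * r ∧ leadingDigits w = u.map Fin.val) := by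
    induction w with
    | nil => exact ⟨[], 0, by simp, by simp, by simp [leadingDigits]⟩
    | cons a w ih =>
      cases a with
      | none =>
        refine ⟨[], (b + 1) * Nat.ofDigits (b + 1) (w.map symbolCode), by simp, ?_, by simp [leadingDigits]⟩
        simp [symbolCode, Nat.ofDigits_cons]
      | some d =>
        obtain ⟨u, r, h1, h2, h3⟩ := ih
        refine ⟨d :: u, r, h1, ?_, ?_⟩
        · rw [List.map_cons, Nat.ofDigits_cons, h2, List.map_cons, Nat.ofDigits_cons, List.length_cons,
            pow_succ]
          simp [symbolCode]; ring
        · simpa [leadingDigits] using h3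
  rw [h2.1, h2.2, conv_eq (by omega) _ _ _ _ (by simpa using h1)]
  · simp only [Nat.unpair_pair, List.map_map]
    congr 2
  · intro d hd
    obtain ⟨d, -, rfl⟩ := List.mem_map.1 hd
    have := d.2
    omega
  · intro v z hvz hz
    obtain ⟨d, z, rfl⟩ := List.exists_cons_of_ne_nil hz
    have hd : d ∈ u.map fun d : Fin b => (d : ℕ) + 1 := hvz ▸ by simp
    obtain ⟨d, -, rfl⟩ := List.mem_map.1 hd
    have e : Nat.ofDigits (b + 1) (((d : ℕ) + 1) :: z) + (b + 1) ^ (((d : ℕ) + 1) :: z).length * r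
        = ((d : ℕ) + 1) + (b + 1) * (Nat.ofDigits (b + 1) z + (b + 1) ^ z.length * r) := by
      rw [Nat.ofDigits_cons, List.length_cons, pow_succ]; ring
    rw [e, Nat.add_mul_mod_self_left, Nat.mod_eq_of_lt (by have := d.2; omega)]
    omega

/-- With `s = 2` each digit is increased by one, turning the numeral into the code of the input
word, and the length comes along. -/
theorem conv_eq_numeral (hb : 2 ≤ b) {x : ℕ} (hx : x ≠ 0) :
    conv b (b + 1) 2 x = Nat.pair 0 (Nat.pair
      (tapeNumber (ListBlank.mk ((numeral b hb x).map some)))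
      (Nat.pair ((b + 1) ^ (numeral b hb x).length) (numeral b hb x).length)) := by
  have e : (numeral b hb x).map Fin.val = Nat.digits b x := by
    rw [numeral, if_neg hx, List.map_pmap]
    simp
  have hl : (numeral b hb x).length = (Nat.digits b x).length := by rw [← e, List.length_map]
  have h := conv_eq (b₂ := b + 1) (s := 2) hb (Nat.digits b x) 0 (fun d hd => Nat.digits_lt_base hb hd) ?_ (by simp)
  · rw [mul_zero, add_zero, Nat.ofDigits_digits] at h
    rw [h, hl]
    congr 2
    rw [tapeNumber_mk, ← e, List.map_map, List.map_map]
    congr 1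
  · intro u z h hz
    -- The conversion stops only at the number `0`, which no suffix denotes, because the leading
    -- digit is not `0`.
    have hne : Nat.ofDigits b z ≠ 0 := by
      intro h0
      have hlast : (Nat.digits b x).getLast (by rw [h]; simp [hz]) ≠ 0 := Nat.getLast_digit_ne_zero b hx
      have h4 := Nat.digits_zero_of_eq_zero (b := b) (by omega) h0 (z.getLast hz) (List.getLast_mem hz)
      apply hlast
      rw [← h4]
      simp only [h]
      exact List.getLast_append_of_ne_nil _ hz
    simp [hne]

end Encoding

end TuringSpace

/-! ### Every algorithm has a code; codes and single steps -/

namespace TuringSpace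

section Machine

variable (A : Algorithm)

/-- The code of an entry of the transition table. -/
def actionCode (st : A.State → ℕ) : Option (A.State × TM0.Stmt (Option (Fin A.base))) → ℕ
  | none => 0
  | some (q, .move .left) => Nat.pair (st q) 0 + 1
  | some (q, .move .right) => Nat.pair (st q) 1 + 1
  | some (q, .write a) => Nat.pair (st q) (symbolCode a + 2) + 1

/-- The number `e` is a code of the algorithm, for a numbering of its states. -/
structure IsCode (e : ℕ) (st : A.State → ℕ) : Prop where
  base : machBase e = A.base
  init : e.unpair.2.unpair.1 = st default
  action (q : A.State) (a : Option (Fin A.base)) :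
    Nat.beta e.unpair.2.unpair.2 (st q * (A.base + 1) + symbolCode a) = actionCode A st (A.table q a)

/-- The transition table is a finite list, indexed injectively by state and symbol, and is stored by
Gödel's beta function. -/
theorem exists_isCode : ∃ e st k, IsCode A e st ∧ ∀ q, st q < k := by
  obtain ⟨k, ⟨φ⟩⟩ := Finite.exists_equiv_fin A.State
  set st : A.State → ℕ := fun q => φ q with hst
  have hinj : Function.Injective fun p : A.State × Option (Fin A.base) =>
      st p.1 * (A.base + 1) + symbolCode p.2 := by
    rintro ⟨q, a⟩ ⟨q', a'⟩ h
    have h1 := congrArg (· / (A.base + 1)) h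
    have h2 := congrArg (· % (A.base + 1)) h
    have ha := symbolCode_lt a
    have ha' := symbolCode_lt a'
    simp only [mul_comm _ (A.base + 1), Nat.mul_add_div (Nat.succ_pos A.base), Nat.div_eq_of_lt ha,
      Nat.div_eq_of_lt ha', add_zero, Nat.mul_add_mod, Nat.mod_eq_of_lt ha, Nat.mod_eq_of_lt ha'] at h1 h2
    rw [symbolCode_injective h2, φ.injective (Fin.ext h1)]
  set T : ℕ → ℕ := Function.extend (fun p : A.State × Option (Fin A.base) =>
      st p.1 * (A.base + 1) + symbolCode p.2) (fun p => actionCode A st (A.table p.1 p.2)) 0 with hT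
  set l := (List.range (k * (A.base + 1))).map T with hl
  refine ⟨Nat.pair (A.base - 2) (Nat.pair (st default) (Nat.unbeta l)), st, k, ⟨?_, ?_, fun q a => ?_⟩,
    fun q => (φ q).2⟩
  · have := A.two_le_base
    simp [machBase]; omega
  · simp
  · have hq : st q * (A.base + 1) + symbolCode a < k * (A.base + 1) := by
      have h1 : st q + 1 ≤ k := (φ q).2
      have h2 := symbolCode_lt a
      nlinarith
    have h := Nat.beta_unbeta_coe l ⟨_, by simpa [hl] using hq⟩
    simp only [Nat.unpair_pair]
    rw [h]
    simp only [hl, Fin.getElem_fin, List.getElem_map, List.getElem_range]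
    exact hinj.extend_apply _ _ (q, a)

variable {A}

/-- The code of a configuration, with `u` and `v` used cells to the left and to the right of the
head. -/
def configCode (st : A.State → ℕ) (c : A.Config) (u v : ℕ) : ℕ :=
  Nat.pair (st c.q) (Nat.pair (tapeNumber c.Tape.left) (Nat.pair (tapeNumber c.Tape.right₀) (Nat.pair u v)))

variable {e : ℕ} {st : A.State → ℕ}

theorem machAction_configCode (he : IsCode A e st) (c : A.Config) (u v : ℕ) :
    machAction e (configCode st c u v) = actionCode A st (A.table c.q c.Tape.head) := by
  unfold machAction configCode
  simp only [Nat.unpair_pair]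
  rw [he.base, tapeNumber_mod]
  simpa [Tape.right₀] using he.action c.q c.Tape.head

theorem actionCode_eq_zero {o : Option (A.State × TM0.Stmt (Option (Fin A.base)))} :
    actionCode A st o = 0 ↔ o = none := by
  rcases o with _ | ⟨q, (_ | _) | a⟩ <;> simp [actionCode]

theorem machAction_eq_zero (he : IsCode A e st) (c : A.Config) (u v : ℕ) :
    machAction e (configCode st c u v) = 0 ↔ TM0.step A.table c = none := by
  rw [machAction_configCode he, actionCode_eq_zero, TM0.step]
  simp

/-- The used cells are the interval from `z - u` to `z + v`, where `z` is the position of the head.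
Truncated subtraction in `u - 1` and `v - 1` makes the interval grow precisely when the head leaves
it. The bounds on the tape numbers say that all other cells are blank. -/
theorem machStep_configCode (he : IsCode A e st) {c c' : A.Config} (h : TM0.step A.table c = some c')
    {u v : ℕ} (hL : tapeNumber c.Tape.left < (A.base + 1) ^ u)
    (hR : tapeNumber c.Tape.right₀ < (A.base + 1) ^ (v + 1)) :
    ∃ u' v', machStep e (configCode st c u v) = configCode st c' u' v' ∧
      tapeNumber c'.Tape.left < (A.base + 1) ^ u' ∧
      tapeNumber c'.Tape.right₀ < (A.base + 1) ^ (v' + 1) ∧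
      ∀ z : ℤ, Set.Icc (z + A.shift c - u') (z + A.shift c + v')
        = insert (z + A.shift c) (Set.Icc (z - u) (z + v)) := by
  obtain ⟨q, a, L, R⟩ := c
  have hact := machAction_configCode he ⟨q, a, L, R⟩ u v
  have hβ : 0 < A.base + 1 := Nat.succ_pos _
  have eR : tapeNumber (Tape.right₀ ⟨a, L, R⟩) = symbolCode a + (A.base + 1) * tapeNumber R :=
    tapeNumber_cons a R
  have hhd : (Tape.right₀ ⟨a, L, R⟩).head = a := ListBlank.head_cons _ _
  have htl : (Tape.right₀ ⟨a, L, R⟩).tail = R := ListBlank.tail_cons _ _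
  have hsa := symbolCode_lt a
  dsimp only at hact hL
  rw [eR] at hR
  have hR' : tapeNumber R < (A.base + 1) ^ v := by
    rw [pow_succ'] at hR
    refine Nat.lt_of_mul_lt_mul_left (a := A.base + 1) ?_
    omega
  have eL := tapeNumber_head_tail L
  have hsL := symbolCode_lt L.head
  have eRt := tapeNumber_head_tail R
  unfold TM0.step at h
  dsimp only at h
  rcases hA : A.table q a with _ | ⟨q', (_ | _) | a'⟩
  · rw [hA] at h; simp at h
  · have hs : A.shift ⟨q, a, L, R⟩ = -1 := by simp [Algorithm.shift, hA]
    obtain rfl : c' = ⟨q', L.head, L.tail, R.cons a⟩ := by rw [hA] at h; exact (Option.some.inj h).symm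
    have eR' : tapeNumber (Tape.right₀ ⟨L.head, L.tail, R.cons a⟩) = symbolCode L.head
        + (A.base + 1) * (symbolCode a + (A.base + 1) * tapeNumber R) := by
      rw [← tapeNumber_cons, ← tapeNumber_cons]; rfl
    refine ⟨u - 1, v + 1, ?_, ?_, ?_, fun z => ?_⟩
    · unfold machStep
      rw [hact, hA]
      simp only [actionCode, Nat.add_sub_cancel, Nat.unpair_pair, if_true, moveLeft, configCode]
      rw [he.base, tapeNumber_mod, tapeNumber_div, eR, eR']
      congr 3
      ring
    · show tapeNumber L.tail < _
      rcases u with _ | u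
      · rw [pow_zero] at hL ⊢
        nlinarith
      · rw [Nat.add_sub_cancel]
        refine Nat.lt_of_mul_lt_mul_left (a := A.base + 1) ?_
        rw [pow_succ'] at hL
        omega
    · show tapeNumber (Tape.right₀ ⟨L.head, L.tail, R.cons a⟩) < _
      rw [eR', pow_succ]
      nlinarith
    · rw [hs]
      ext y
      simp only [Set.mem_insert_iff, Set.mem_Icc]
      rcases u with _ | u
      · simp; omega
      · simp; omega
  · have hs : A.shift ⟨q, a, L, R⟩ = 1 := by simp [Algorithm.shift, hA]
    obtain rfl : c' = ⟨q', R.head, L.cons a, R.tail⟩ := by rw [hA] at h; exact (Option.some.inj h).symm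
    have eR' : tapeNumber (Tape.right₀ ⟨R.head, L.cons a, R.tail⟩) = tapeNumber R := by
      rw [eRt, ← tapeNumber_cons]; rfl
    refine ⟨u + 1, v - 1, ?_, ?_, ?_, fun z => ?_⟩
    · unfold machStep
      rw [hact, hA]
      simp only [actionCode, Nat.add_sub_cancel, Nat.unpair_pair, if_true, one_ne_zero, if_false,
        moveRight, configCode]
      rw [he.base, tapeNumber_mod, tapeNumber_div, eR', hhd, htl, tapeNumber_cons]
      congr 2
      ring
    · show tapeNumber (L.cons a) < _
      rw [tapeNumber_cons, pow_succ]
      nlinarith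
    · show tapeNumber (Tape.right₀ ⟨R.head, L.cons a, R.tail⟩) < _
      rw [eR']
      exact hR'.trans_le (Nat.pow_le_pow_right hβ (by omega))
    · rw [hs]
      ext y
      simp only [Set.mem_insert_iff, Set.mem_Icc]
      rcases v with _ | v
      · simp; omega
      · simp; omega
  · have hs : A.shift ⟨q, a, L, R⟩ = 0 := by simp [Algorithm.shift, hA]
    obtain rfl : c' = ⟨q', a', L, R⟩ := by rw [hA] at h; exact (Option.some.inj h).symm
    have eR' : tapeNumber (Tape.right₀ ⟨a', L, R⟩) = symbolCode a' + (A.base + 1) * tapeNumber R :=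
      tapeNumber_cons a' R
    refine ⟨u, v, ?_, hL, ?_, fun z => ?_⟩
    · unfold machStep
      rw [hact, hA]
      simp only [actionCode, Nat.add_sub_cancel, Nat.unpair_pair, writeSymbol, configCode]
      rw [if_neg (by omega), if_neg (by omega), he.base, tapeNumber_mod, eR, eR', hhd]
      congr 3
      omega
    · show tapeNumber (Tape.right₀ ⟨a', L, R⟩) < _
      have := symbolCode_lt a'
      rw [eR', pow_succ]
      nlinarith
    · rw [hs]
      ext y
      simp only [Set.mem_insert_iff, Set.mem_Icc]
      omega

end Machine

end TuringSpace

/-! ### Simulation of whole computations, with bounds exponential in the space -/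

namespace TuringSpace

variable {A : Algorithm} {e : ℕ} {st : A.State → ℕ}

theorem numeral_ne_nil (b : ℕ) (hb : 2 ≤ b) (x : ℕ) : numeral b hb x ≠ [] := by
  obtain ⟨d, rest, h, -⟩ := exists_numeral b hb x
  simp [h]

theorem tapeNumber_mk_lt {b : ℕ} (w : List (Option (Fin b))) :
    tapeNumber (ListBlank.mk w) < (b + 1) ^ w.length := by
  rw [tapeNumber_mk]
  induction w with
  | nil => simp
  | cons a w ih =>
    rw [List.map_cons, Nat.ofDigits_cons, List.length_cons, pow_succ]
    have := symbolCode_lt a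
    nlinarith

theorem machInit_eq (he : IsCode A e st) (x : ℕ) :
    machInit e x = configCode st (TM0.init (A.input x)) 0 (A.input x).length := by
  have e2 : (TM0.init (Λ := A.State) (A.input x)).Tape.left = ListBlank.mk [] := rfl
  have e1 : (Tape.right₀ (TM0.init (Λ := A.State) (A.input x)).Tape) = ListBlank.mk (A.input x) := by
    exact Tape.mk'_right₀ _ _
  have e3 : tapeNumber (ListBlank.mk ([] : List (Option (Fin A.base)))) = 0 := rfl
  rw [machInit, configCode, he.init, he.base, e1, e2, e3]
  congr 2
  split_ifs with h
  · subst h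
    simp [Algorithm.input, numeral, tapeNumber_mk, symbolCode]
  · rw [conv_eq_numeral A.two_le_base h]
    simp [Algorithm.input]

/-- The interval begins as the input word with its terminating blank, hence with `v` the length of
the word, and is extended by the positions visited. -/
theorem exists_configCode (he : IsCode A e st) {x t : ℕ} {c : A.Config} {z : ℤ}
    (h : A.after x t = some (c, z)) : ∃ u v,
      (machStep e)^[t] (machInit e x) = configCode st c u v ∧
      tapeNumber c.Tape.left < (A.base + 1) ^ u ∧
      tapeNumber c.Tape.right₀ < (A.base + 1) ^ (v + 1) ∧
      Set.Icc (z - u) (z + v) = Set.Icc 0 ((A.input x).length : ℤ) ∪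
        {y | ∃ r ≤ t, ∃ c', A.after x r = some (c', y)} := by
  induction t generalizing c z with
  | zero =>
    obtain ⟨rfl, rfl⟩ : TM0.init (A.input x) = c ∧ 0 = z := by simpa [Algorithm.after] using h
    refine ⟨0, (A.input x).length, machInit_eq he x, ?_, ?_, ?_⟩
    · have : (TM0.init (Λ := A.State) (A.input x)).Tape.left = ListBlank.mk [] := rfl
      rw [this]
      exact tapeNumber_mk_lt _
    · have : (Tape.right₀ (TM0.init (Λ := A.State) (A.input x)).Tape) = ListBlank.mk (A.input x) :=
        Tape.mk'_right₀ _ _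
      rw [this]
      exact (tapeNumber_mk_lt _).trans_le (Nat.pow_le_pow_right (by omega) (by omega))
    · ext y
      simp only [Set.mem_Icc, Set.mem_union, Set.mem_ofPred_eq]
      constructor
      · intro h; left; simpa using h
      · rintro (h | ⟨r, hr, c', h⟩)
        · simpa using h
        · obtain rfl : r = 0 := by omega
          obtain rfl : (0 : ℤ) = y := congrArg Prod.snd (Option.some.inj h)
          simp
  | succ t ih =>
    obtain ⟨⟨c₀, z₀⟩, h0, h1⟩ := Option.bind_eq_some_iff.1 h
    obtain ⟨u, v, hW, hL, hR, hI⟩ := ih h0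
    obtain ⟨c', hc', h2⟩ := Option.map_eq_some_iff.1 h1
    obtain ⟨rfl, rfl⟩ := Prod.mk.inj h2
    obtain ⟨u', v', hs, hL', hR', hI'⟩ := machStep_configCode he hc' hL hR
    refine ⟨u', v', by rw [Function.iterate_succ_apply', hW, hs], hL', hR', ?_⟩
    rw [hI' z₀, hI]
    ext y
    simp only [Set.mem_Icc, Set.mem_union, Set.mem_ofPred_eq, Set.mem_insert_iff]
    constructor
    · rintro (rfl | h | ⟨r, hr, c', h⟩)
      · exact Or.inr ⟨t + 1, le_rfl, _, h⟩
      · exact Or.inl h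
      · exact Or.inr ⟨r, by omega, c', h⟩
    · rintro (h' | ⟨r, hr, c'', h'⟩)
      · exact Or.inr (Or.inl h')
      · rcases Nat.lt_or_ge t r with h3 | h3
        · obtain rfl : r = t + 1 := by omega
          rw [h] at h'
          exact Or.inl (congrArg Prod.snd (Option.some.inj h')).symm
        · exact Or.inr (Or.inr ⟨r, h3, c'', h'⟩)

theorem pair_lt_pow {X a b i j : ℕ} (ha : a < X ^ i) (hb : b < X ^ i) (hj : 2 * i = j) :
    Nat.pair a b < X ^ j := by
  refine (Nat.pair_lt_max_add_one_sq a b).trans_le ?_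
  rw [← hj, mul_comm, pow_mul]
  exact Nat.pow_le_pow_left (by omega) 2

theorem configCode_lt {k p : ℕ} (hk : ∀ q, st q < k) {c : A.Config} {u v : ℕ}
    (hL : tapeNumber c.Tape.left < (A.base + 1) ^ u)
    (hR : tapeNumber c.Tape.right₀ < (A.base + 1) ^ (v + 1)) (hp : u + v ≤ p) (hp1 : 1 ≤ p) :
    configCode st c u v + 2 ≤ ((A.base + 1 + k) ^ 34) ^ p := by
  have hb := A.two_le_base
  set X := (A.base + 1 + k) ^ (p + 1) with hX
  have h2X : 2 ≤ X := (by omega : 2 ≤ A.base + 1 + k).trans (Nat.le_self_pow (by omega) _)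
  have hle : ∀ j ≤ p + 1, (A.base + 1) ^ j ≤ X := fun j hj =>
    (Nat.pow_le_pow_left (by omega) j).trans (Nat.pow_le_pow_right (by omega) hj)
  have hpX : p + 1 < X := (p + 1).lt_two_pow_self.trans_le (Nat.pow_le_pow_left (by omega) _)
  have hkX : k ≤ X := (by omega : k ≤ A.base + 1 + k).trans (Nat.le_self_pow (by omega) _)
  have hXi : ∀ i, 1 ≤ i → X ≤ X ^ i := fun i hi => Nat.le_self_pow (by omega) X
  have h1 : Nat.pair u v < X ^ 2 :=
    pair_lt_pow (i := 1) (by rw [pow_one]; omega) (by rw [pow_one]; omega) rfl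
  have h2 : Nat.pair (tapeNumber c.Tape.right₀) (Nat.pair u v) < X ^ 4 :=
    pair_lt_pow ((hR.trans_le (hle _ (by omega))).trans_le (hXi 2 (by omega))) h1 rfl
  have h3 : Nat.pair (tapeNumber c.Tape.left) _ < X ^ 8 :=
    pair_lt_pow ((hL.trans_le (hle _ (by omega))).trans_le (hXi 4 (by omega))) h2 rfl
  have h4 : Nat.pair (st c.q) _ < X ^ 16 :=
    pair_lt_pow (((hk c.q).trans_le hkX).trans_le (hXi 8 (by omega))) h3 rfl
  -- Four nested pairings give the exponent `16`, and one more factor absorbs the summand `2`. Then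
  -- `17 * (p + 1) ≤ 34 * p`, as `p ≥ 1`.
  have h6 : X ^ 17 ≤ ((A.base + 1 + k) ^ 34) ^ p := by
    rw [hX, ← pow_mul, ← pow_mul]
    exact Nat.pow_le_pow_right (by omega) (by omega)
  have h7 := hXi 16 (by omega)
  have h8 : X ^ 17 = X ^ 16 * X := pow_succ _ _
  have h9 := Nat.mul_le_mul_left (X ^ 16) h2X
  rw [configCode]
  omega

/-- The codes of all configurations of a halting computation, and the input itself, are bounded by
`K ^ p` for the final space `p`. This is the link between space and size of numbers on which both
directions of the theorem rest. -/
theorem exists_simulation (A : Algorithm) : ∃ e K, ∀ x,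
    (∀ y ∈ A.eval x, ∃ t p : ℕ, A.space x = p ∧ 1 ≤ p ∧
      (∀ i < t, machAction e ((machStep e)^[i] (machInit e x)) ≠ 0) ∧
      machAction e ((machStep e)^[t] (machInit e x)) = 0 ∧
      machOut e ((machStep e)^[t] (machInit e x)) = y ∧
      machSpace ((machStep e)^[t] (machInit e x)) = p ∧ x + 2 ≤ K ^ p ∧
      ∀ i ≤ t, (machStep e)^[i] (machInit e x) + 2 ≤ K ^ p) ∧
    (¬ (A.eval x).Dom → ∀ i, machAction e ((machStep e)^[i] (machInit e x)) ≠ 0) := by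
  obtain ⟨e, st, k, he, hk⟩ := exists_isCode A
  have hb := A.two_le_base
  refine ⟨e, (A.base + 1 + k) ^ 34, fun x => ⟨fun y hy => ?_, fun hd => ?_⟩⟩
  · obtain ⟨t, ⟨c, z⟩, ht, hn⟩ := A.exists_after_of_dom (Part.dom_iff_mem.2 ⟨y, hy⟩)
    obtain ⟨u, v, hW, hL, hR, hI⟩ := exists_configCode he ht
    have hval := A.eval_eq_of_after ht hn
    have hnone : ∀ r, t < r → A.after x r = none := by
      intro r hr
      by_contra h
      have := A.after_ne_none_of_le h hr
      rw [A.after_succ, ht] at this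
      exact this ((A.posStep_eq_none).2 hn)
    have hused : A.usedCells x = Set.Icc (z - u) (z + v) := by
      rw [hI, Algorithm.usedCells]
      congr 1
      ext y
      constructor
      · rintro ⟨r, c', h⟩
        refine ⟨r, ?_, c', h⟩
        by_contra hr
        rw [hnone r (by omega)] at h
        cases h
      · rintro ⟨r, -, c', h⟩
        exact ⟨r, c', h⟩
    have hlen : (A.input x).length ≤ u + v := by
      have h1 : (0 : ℤ) ∈ Set.Icc (z - u) (z + v) := hI ▸ Or.inl ⟨le_rfl, Int.natCast_nonneg _⟩
      have h2 : ((A.input x).length : ℤ) ∈ Set.Icc (z - u) (z + v) :=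
        hI ▸ Or.inl ⟨Int.natCast_nonneg _, le_rfl⟩
      have h3 := h1.1
      have h4 := h2.2
      omega
    have hlen1 : 1 ≤ (A.input x).length := by
      rw [Algorithm.input, List.length_map]
      exact List.length_pos_of_ne_nil (numeral_ne_nil _ _ _)
    have hcode : ∀ i ≤ t, ∃ c' z' u' v', A.after x i = some (c', z') ∧
        (machStep e)^[i] (machInit e x) = configCode st c' u' v' ∧
        tapeNumber c'.Tape.left < (A.base + 1) ^ u' ∧
        tapeNumber c'.Tape.right₀ < (A.base + 1) ^ (v' + 1) ∧ u' + v' ≤ u + v := by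
      intro i hi
      obtain ⟨⟨c', z'⟩, h⟩ := Option.ne_none_iff_exists'.1
        (A.after_ne_none_of_le (x := x) (t := i) (by rw [ht]; simp) hi)
      obtain ⟨u', v', hW', hL', hR', hI'⟩ := exists_configCode he h
      refine ⟨c', z', u', v', h, hW', hL', hR', ?_⟩
      -- The cells used up to time `i` are among those used in the end, so intermediate codes obey
      -- the bound for the final space.
      have hsub : Set.Icc (z' - u') (z' + v') ⊆ Set.Icc (z - u : ℤ) (z + v) := by
        rw [hI, hI']
        refine Set.union_subset_union_right _ ?_
        rintro y ⟨r, hr, c'', h⟩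
        exact ⟨r, hr.trans hi, c'', h⟩
      have := (Set.Icc_subset_Icc_iff (by omega)).1 hsub
      omega
    refine ⟨t, u + v, ?_, by omega, fun i hi => ?_, ?_, ?_, ?_, ?_, fun i hi => ?_⟩
    · rw [Algorithm.space, if_pos (Part.dom_iff_mem.2 ⟨y, hy⟩), hused]
      exact Algorithm.encard_Icc_sub_one _ _ _ (by push_cast; ring)
    · obtain ⟨c', z', u', v', h, hW', -⟩ := hcode i hi.le
      rw [hW', Ne, machAction_eq_zero he]
      intro h1
      have := A.after_ne_none_of_le (x := x) (t := i + 1) (by rw [ht]; simp) hi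
      rw [A.after_succ, h] at this
      exact this ((A.posStep_eq_none).2 h1)
    · rw [hW, machAction_eq_zero he]; exact hn
    · rw [hW, machOut, configCode]
      simp only [Nat.unpair_pair]
      rw [he.base, readNumber_eq_conv hb]
      rw [hval] at hy
      exact (Part.mem_some_iff.1 hy).symm
    · rw [hW, machSpace, configCode]
      simp only [Nat.unpair_pair]
    · obtain ⟨d, rest, h1, h2, -⟩ := exists_numeral A.base A.two_le_base x
      have h3 := wordValue_lt (dg := Fin.val) (fun a => a.2) (d :: rest)
      rw [wordValue_cons, ← h2, ← h1] at h3
      have h4 : x < A.base ^ (u + v) := h3.trans_le (Nat.pow_le_pow_right (by omega)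
        (by rw [Algorithm.input, List.length_map] at hlen; exact hlen))
      have h5 : A.base ^ (u + v) < (A.base + 1) ^ (u + v) := Nat.pow_lt_pow_left (by omega) (by omega)
      have h6 : (A.base + 1) ^ (u + v) ≤ ((A.base + 1 + k) ^ 34) ^ (u + v) :=
        Nat.pow_le_pow_left ((by omega : A.base + 1 ≤ A.base + 1 + k).trans
          (Nat.le_self_pow (by omega) _)) _
      omega
    · obtain ⟨c', z', u', v', h, hW', hL', hR', huv⟩ := hcode i hi
      rw [hW']
      exact configCode_lt hk hL' hR' huv (by omega)
  · have h1 : ∀ t, ∃ s, A.after x t = some s := by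
      intro t
      induction t with
      | zero => exact ⟨_, rfl⟩
      | succ t ih =>
        obtain ⟨s, hs⟩ := ih
        rw [A.after_succ, hs]
        refine Option.ne_none_iff_exists'.1 fun h => hd ?_
        rw [A.eval_eq_of_after hs (A.posStep_eq_none.1 h)]
        trivial
    intro i h
    obtain ⟨⟨c, z⟩, hs⟩ := h1 i
    obtain ⟨u, v, hW, -⟩ := exists_configCode he hs
    rw [hW, machAction_eq_zero he] at h
    apply hd
    rw [A.eval_eq_of_after hs h]
    trivial

end TuringSpace

/-! ### Bounded simulation, and approximation of recursive functions -/

namespace TuringSpace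

/-- The initial state of a simulation with configurations at most `N`: `0` stands for an overflow, and
`c + 1` for the configuration `c`. -/
def runInit (e x N : ℕ) : ℕ := if machInit e x ≤ N then machInit e x + 1 else 0

/-- A step of a simulation with configurations at most `N`. -/
def runStep (e N s : ℕ) : ℕ :=
  if s = 0 then 0 else if machAction e (s - 1) = 0 then s
  else if machStep e (s - 1) ≤ N then machStep e (s - 1) + 1 else 0

/-- The outcome of `N` steps of the machine with code `e` on the input `x`, as long as the
configurations do not exceed `N`: the output increased by one, or `0` if there is none. -/
def sim (e x N : ℕ) : ℕ :=
  if (runStep e N)^[N] (runInit e x N) = 0 then 0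
  else if machAction e ((runStep e N)^[N] (runInit e x N) - 1) = 0 then
    machOut e ((runStep e N)^[N] (runInit e x N) - 1) + 1 else 0

theorem runStep_le (e N s : ℕ) (hs : s ≤ N + 1) : runStep e N s ≤ N + 1 := by
  unfold runStep
  split_ifs <;> omega

theorem LinSpace.sim {f g h : (ℕ → ℕ) → ℕ} (hf : LinSpace f) (hg : LinSpace g) (hh : LinSpace h) :
    LinSpace fun σ => sim (f σ) (g σ) (h σ) := by
  refine comp₃ (F := TuringSpace.sim) ?_ hf hg hh
  have hi : LinSpace fun σ => runInit (σ 0) (σ 1) (σ 2) :=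
    ite_le ((var 0).machInit (var 1)) (var 2) ((var 0).machInit (var 1)).succ zero
  have hs : LinSpace fun σ => runStep (σ 1) (σ 3) (σ 0) :=
    ite_zero (var 0) zero (ite_zero ((var 1).machAction (var 0).pred) (var 0)
      (ite_le ((var 1).machStep (var 0).pred) (var 3) ((var 1).machStep (var 0).pred).succ zero))
  have hit : LinSpace fun σ => (runStep (σ 0) (σ 2))^[σ 2] (runInit (σ 0) (σ 1) (σ 2)) := by
    refine iterate (var 2) hi hs (var 2).succ fun σ t ht => ?_
    clear ht
    induction t with
    | zero => simp only [Function.iterate_zero, id, runInit]; split_ifs <;> omega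
    | succ t ih =>
      rw [Function.iterate_succ_apply']
      exact runStep_le _ _ _ ih
  exact ite_zero hit zero (ite_zero ((var 0).machAction hit.pred) ((var 0).machOut hit.pred).succ zero)

/-- A bound on the configurations also bounds the running time: a halting computation never repeats
a configuration, so it makes at most `N` steps if all its codes are at most `N`. -/
theorem sim_eq {e x N t : ℕ}
    (h1 : ∀ i < t, machAction e ((machStep e)^[i] (machInit e x)) ≠ 0)
    (h2 : machAction e ((machStep e)^[t] (machInit e x)) = 0)
    (h3 : ∀ i ≤ t, (machStep e)^[i] (machInit e x) ≤ N) :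
    sim e x N = machOut e ((machStep e)^[t] (machInit e x)) + 1 := by
  have hinj : ∀ i j, i < j → j ≤ t →
      (machStep e)^[i] (machInit e x) ≠ (machStep e)^[j] (machInit e x) := by
    intro i j hij hj h
    apply h1 (t - j + i) (by omega)
    rw [Function.iterate_add_apply, h, ← Function.iterate_add_apply, Nat.sub_add_cancel hj, h2]
  have ht : t ≤ N := by
    have := Finset.card_le_card_of_injOn (s := Finset.range (t + 1)) (t := Finset.range (N + 1))
      (fun i => (machStep e)^[i] (machInit e x))
      (fun i hi => by
        have := h3 i (by simpa [Nat.lt_succ_iff] using hi)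
        simpa [Nat.lt_succ_iff] using this)
      (fun i hi j hj h => by
        simp only [Finset.coe_range, Set.mem_Iio] at hi hj
        rcases lt_trichotomy i j with h4 | h4 | h4
        · exact absurd h (hinj i j h4 (by omega))
        · exact h4
        · exact absurd h.symm (hinj j i h4 (by omega)))
    simpa using this
  have key : ∀ i ≤ t, (runStep e N)^[i] (runInit e x N) = (machStep e)^[i] (machInit e x) + 1 := by
    intro i
    induction i with
    | zero => intro _; exact if_pos (h3 0 (by omega))
    | succ i ih =>
      intro hi
      have h4 := h3 (i + 1) hi
      rw [Function.iterate_succ_apply'] at h4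
      rw [Function.iterate_succ_apply', ih (by omega), Function.iterate_succ_apply', runStep,
        if_neg (by omega), Nat.add_sub_cancel, if_neg (h1 i (by omega)), if_pos h4]
  have hN : (runStep e N)^[N] (runInit e x N) = (machStep e)^[t] (machInit e x) + 1 := by
    obtain ⟨k, rfl⟩ := Nat.exists_eq_add_of_le' ht
    rw [Function.iterate_add_apply, key t le_rfl]
    apply Function.iterate_fixed
    rw [runStep, if_neg (by omega), Nat.add_sub_cancel, if_pos h2]
  rw [sim, hN, if_neg (by omega), Nat.add_sub_cancel, if_pos h2]

theorem exists_of_sim_ne_zero {e x N : ℕ} (h : sim e x N ≠ 0) :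
    ∃ t, (∀ i < t, machAction e ((machStep e)^[i] (machInit e x)) ≠ 0) ∧
      machAction e ((machStep e)^[t] (machInit e x)) = 0 ∧
      sim e x N = machOut e ((machStep e)^[t] (machInit e x)) + 1 := by
  have key : ∀ j, (runStep e N)^[j] (runInit e x N) = 0 ∨ ∃ t,
      (∀ i < t, machAction e ((machStep e)^[i] (machInit e x)) ≠ 0) ∧
      (runStep e N)^[j] (runInit e x N) = (machStep e)^[t] (machInit e x) + 1 := by
    intro j
    induction j with
    | zero =>
      simp only [Function.iterate_zero, id, runInit]
      split_ifs
      · exact Or.inr ⟨0, by simp, rfl⟩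
      · exact Or.inl rfl
    | succ j ih =>
      rw [Function.iterate_succ_apply']
      rcases ih with h1 | ⟨t, h1, h2⟩
      · left; rw [h1]; rfl
      · rw [h2, runStep, if_neg (by omega), Nat.add_sub_cancel]
        split_ifs with h3
        · exact Or.inr ⟨t, h1, rfl⟩
        · refine Or.inr ⟨t + 1, fun i hi => ?_, by rw [Function.iterate_succ_apply']⟩
          rcases Nat.lt_succ_iff_lt_or_eq.1 hi with h5 | rfl
          · exact h1 i h5
          · exact h3
        · exact Or.inl rfl
  unfold sim at h ⊢
  rcases key N with h1 | ⟨t, h1, h2⟩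
  · simp [h1] at h
  · rw [h2, if_neg (by omega), Nat.add_sub_cancel] at h ⊢
    by_cases h3 : machAction e ((machStep e)^[t] (machInit e x)) = 0
    · exact ⟨t, h1, h3, by rw [if_pos h3]⟩
    · rw [if_neg h3] at h; exact absurd rfl h

/-- A computation in space `p` is followed to its end at every stage from `2 ^ (C * p)` on, and at
no stage does the simulation give a wrong output. -/
theorem exists_sim (A : Algorithm) : ∃ e C,
    (∀ x, ∀ y ∈ A.eval x, ∃ p : ℕ, A.space x = p ∧ 1 ≤ p ∧ ∀ N ≥ 2 ^ (C * p), sim e x N = y + 1) ∧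
    ∀ x N, sim e x N ≠ 0 → ∃ y ∈ A.eval x, sim e x N = y + 1 := by
  obtain ⟨e, K, h⟩ := exists_simulation A
  refine ⟨e, K, fun x y hy => ?_, fun x N hs => ?_⟩
  · obtain ⟨t, p, h1, h2, h3, h4, h5, -, -, h6⟩ := (h x).1 y hy
    refine ⟨p, h1, h2, fun N hN => ?_⟩
    rw [sim_eq h3 h4 fun i hi => ?_, h5]
    have := h6 i hi
    have h7 : K ^ p ≤ 2 ^ (K * p) := by
      rw [pow_mul]; exact Nat.pow_le_pow_left K.lt_two_pow_self.le p
    omega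
  · obtain ⟨t, h1, h2, h3⟩ := exists_of_sim_ne_zero hs
    by_cases hd : (A.eval x).Dom
    · obtain ⟨y, hy⟩ := Part.dom_iff_mem.1 hd
      obtain ⟨t', p, -, -, h4, h5, h6, -⟩ := (h x).1 y hy
      obtain rfl : t = t' := by
        rcases lt_trichotomy t t' with h7 | h7 | h7
        · exact absurd h2 (h4 t h7)
        · exact h7
        · exact absurd h5 (h1 t' h7)
      exact ⟨y, hy, by rw [h3, h6]⟩
    · exact absurd h2 ((h x).2 hd t)

open Filter

/-- Primitive recursive functions may grow too fast for `LinSpace`, but their evaluation can be cut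
off: `0` means that the cap `N` was too small, and all other values are correct. Every single
argument is settled by a large cap. -/
theorem exists_capped_of_primrec {f : ℕ → ℕ} (hf : Nat.Primrec f) : ∃ h : ℕ → ℕ → ℕ,
    (LinSpace fun σ => h (σ 0) (σ 1)) ∧ (∀ x N, h x N = 0 ∨ h x N = f x + 1) ∧
      ∀ x, ∀ᶠ N in atTop, h x N = f x + 1 := by
  induction hf with
  | zero => exact ⟨fun _ _ => 1, .const 1, fun _ _ => Or.inr rfl, fun _ => .of_forall fun _ => rfl⟩
  | succ => exact ⟨fun x _ => x + 2, (LinSpace.var 0).succ.succ, fun _ _ => Or.inr rfl,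
      fun _ => .of_forall fun _ => rfl⟩
  | left => exact ⟨fun x _ => x.unpair.1 + 1, (LinSpace.var 0).fst.succ, fun _ _ => Or.inr rfl,
      fun _ => .of_forall fun _ => rfl⟩
  | right => exact ⟨fun x _ => x.unpair.2 + 1, (LinSpace.var 0).snd.succ, fun _ _ => Or.inr rfl,
      fun _ => .of_forall fun _ => rfl⟩
  | @pair f g _ _ ihf ihg =>
    obtain ⟨h, h1, h2, h3⟩ := ihf
    obtain ⟨k, k1, k2, k3⟩ := ihg
    refine ⟨fun x N => if h x N = 0 then 0 else if k x N = 0 then 0 else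
      Nat.pair (h x N - 1) (k x N - 1) + 1, ?_, fun x N => ?_, fun x => ?_⟩
    · exact .ite_zero h1 .zero (.ite_zero k1 .zero (h1.pred.pair k1.pred).succ)
    · rcases h2 x N with e | e <;> rcases k2 x N with e' | e' <;> simp [e, e']
    · filter_upwards [h3 x, k3 x] with N e e'
      simp [e, e']
  | @comp f g _ _ ihf ihg =>
    obtain ⟨h, h1, h2, h3⟩ := ihf
    obtain ⟨k, k1, k2, k3⟩ := ihg
    refine ⟨fun x N => if k x N = 0 then 0 else h (k x N - 1) N, ?_, fun x N => ?_, fun x => ?_⟩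
    · exact .ite_zero k1 .zero (LinSpace.comp₂ h1 k1.pred (.var 1))
    · rcases k2 x N with e | e
      · simp [e]
      · simpa [e] using h2 _ N
    · filter_upwards [h3 (g x), k3 x] with N e e'
      simp [e, e']
  | @prec f g _ _ ihf ihg =>
    obtain ⟨h, h1, h2, h3⟩ := ihf
    obtain ⟨k, k1, k2, k3⟩ := ihg
    -- The accumulator is discarded as soon as it exceeds `N`, which enforces the bound required of
    -- a recursion. In `s` the argument and the cap have indices `2` and `3`.
    let i : (ℕ → ℕ) → ℕ := fun σ => if h (σ 0).unpair.1 (σ 1) ≤ σ 1 then h (σ 0).unpair.1 (σ 1) else 0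
    let s : (ℕ → ℕ) → ℕ := fun σ => if σ 0 = 0 then 0 else
      if k (Nat.pair (σ 2).unpair.1 (Nat.pair (σ 1) (σ 0 - 1))) (σ 3) ≤ σ 3 then
        k (Nat.pair (σ 2).unpair.1 (Nat.pair (σ 1) (σ 0 - 1))) (σ 3) else 0
    have hi : LinSpace i := by
      have := LinSpace.comp₂ h1 (LinSpace.var 0).fst (.var 1)
      exact .ite_le this (.var 1) this .zero
    have hs : LinSpace s := by
      have := LinSpace.comp₂ k1 ((LinSpace.var 2).fst.pair ((LinSpace.var 1).pair (LinSpace.var 0).pred))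
        (.var 3)
      exact .ite_zero (.var 0) .zero (.ite_le this (.var 3) this .zero)
    have hsle : ∀ σ, s σ ≤ σ 3 := by
      intro σ
      simp only [s]
      split_ifs <;> omega
    have hle : ∀ σ t, primRec i s σ t ≤ σ 1 := by
      intro σ t
      cases t with
      | zero => simp only [primRec_zero, i]; split_ifs <;> omega
      | succ t =>
        rw [primRec_succ]
        exact hsle _
    have hprec := LinSpace.prec_of_le (LinSpace.var 0).snd hi hs (LinSpace.var 1) fun σ t _ => hle σ t
    let r : ℕ → ℕ → ℕ → ℕ := fun x N t => primRec i s (push x (push N 0)) t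
    have er : ∀ σ t, primRec i s σ t = r (σ 0) (σ 1) t := by
      intro σ t
      induction t with
      | zero => rfl
      | succ t ih =>
        simp only [r, primRec_succ] at ih ⊢
        rw [ih]
        rfl
    have r0 : ∀ x N, r x N 0 = if h x.unpair.1 N ≤ N then h x.unpair.1 N else 0 := fun _ _ => rfl
    have rs : ∀ x N t, r x N (t + 1) = if r x N t = 0 then 0 else
        if k (Nat.pair x.unpair.1 (Nat.pair t (r x N t - 1))) N ≤ N then
          k (Nat.pair x.unpair.1 (Nat.pair t (r x N t - 1))) N else 0 := fun _ _ _ => rfl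
    set F : ℕ → ℕ → ℕ := fun x t => Nat.rec (f x.unpair.1)
      (fun y IH => g (Nat.pair x.unpair.1 (Nat.pair y IH))) t with hF
    have h4 : ∀ x N t, r x N t = 0 ∨ r x N t = F x t + 1 := by
      intro x N t
      induction t with
      | zero =>
        rw [r0]
        split_ifs
        · exact h2 _ _
        · exact Or.inl rfl
      | succ t ih =>
        rw [rs]
        rcases ih with e | e
        · simp [e]
        · rw [e, if_neg (by omega), Nat.add_sub_cancel]
          split_ifs
          · exact k2 _ _
          · exact Or.inl rfl
    have h5 : ∀ x t, ∀ᶠ N in atTop, r x N t = F x t + 1 := by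
      intro x t
      induction t with
      | zero =>
        filter_upwards [h3 x.unpair.1, eventually_ge_atTop (F x 0 + 1)] with N e e'
        rw [r0, e]
        exact if_pos e'
      | succ t ih =>
        filter_upwards [ih, k3 (Nat.pair x.unpair.1 (Nat.pair t (F x t))),
          eventually_ge_atTop (F x (t + 1) + 1)] with N e e' e''
        rw [rs, e, if_neg (by omega), Nat.add_sub_cancel, e']
        exact if_pos e''
    exact ⟨fun x N => r x N x.unpair.2, hprec.of_eq fun σ => er σ _, fun x N => h4 x N _,
      fun x => h5 x _⟩

theorem firstValue_mono {F : ℕ → ℕ} {n m : ℕ} (hnm : n ≤ m) (h : firstValue F n ≠ 0) :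
    firstValue F m = firstValue F n := by
  obtain ⟨y, hy, h1, h2⟩ := exists_firstValue h
  rw [← h1]
  exact firstValue_eq (hy.trans_le hnm) (h1 ▸ h) h2

/-- Evaluation of a code of `F` for `k` steps is primitive recursive, hence has capped
approximations. Searching through the pairs of a number of steps and a cap below `N` finds the value
for large `N`. -/
theorem exists_approximation {F : ℕ → ℕ} (hF : Computable F) : ∃ Fs : ℕ → ℕ → ℕ,
    (LinSpace fun σ => Fs (σ 0) (σ 1)) ∧ (∀ x N, Fs x N = 0 ∨ Fs x N = F x + 1) ∧
      ∀ x, ∀ᶠ N in atTop, Fs x N ≠ 0 := by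
  obtain ⟨c, hc⟩ := Nat.Partrec.Code.exists_code.1 (Partrec.nat_iff.1 hF)
  let g : ℕ → ℕ := fun n => (Nat.Partrec.Code.evaln n.unpair.2 c n.unpair.1).elim 0 (· + 1)
  have hg : Primrec g := by
    refine Primrec.option_casesOn (g := fun _ y => y + 1) (Nat.Partrec.Code.primrec_evaln.comp
      ((((Primrec.snd.comp Primrec.unpair).pair (.const c))).pair (Primrec.fst.comp Primrec.unpair)))
      (.const 0) (Primrec.succ.comp Primrec.snd).to₂ |>.of_eq fun n => ?_
    simp only [g]
    cases Nat.Partrec.Code.evaln n.unpair.2 c n.unpair.1 <;> rfl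
  have hg1 : ∀ x k, g (Nat.pair x k) = 0 ∨ g (Nat.pair x k) = F x + 1 := by
    intro x k
    simp only [g, Nat.unpair_pair]
    cases h : Nat.Partrec.Code.evaln k c x with
    | none => simp
    | some y =>
      have := Nat.Partrec.Code.evaln_sound h
      rw [hc] at this
      simp at this
      simp [this]
  have hg2 : ∀ x, ∃ k, g (Nat.pair x k) = F x + 1 := by
    intro x
    have : F x ∈ c.eval x := by rw [hc]; simp
    obtain ⟨k, hk⟩ := Nat.Partrec.Code.evaln_complete.1 this
    refine ⟨k, ?_⟩
    simp only [g, Nat.unpair_pair]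
    rw [hk]
    rfl
  obtain ⟨h, h1, h2, h3⟩ := exists_capped_of_primrec (Primrec.nat_iff.1 hg)
  have h4 : ∀ x j : ℕ, h (Nat.pair x j.unpair.1) j.unpair.2 - 1 = 0 ∨
      h (Nat.pair x j.unpair.1) j.unpair.2 - 1 = F x + 1 := by
    intro x j
    rcases h2 (Nat.pair x j.unpair.1) j.unpair.2 with e | e
    · simp [e]
    · rw [e, Nat.add_sub_cancel]; exact hg1 x _
  -- Both layers mark success by adding one. Subtracting `1` removes the mark of the capped
  -- evaluation and keeps that of `evaln`.
  refine ⟨fun x N : ℕ => firstValue (fun j : ℕ => h (Nat.pair x j.unpair.1) j.unpair.2 - 1) N, ?_,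
    fun x N => ?_, fun x => ?_⟩
  · exact LinSpace.firstValue (.var 1) (F := fun σ (j : ℕ) => h (Nat.pair (σ 0) j.unpair.1) j.unpair.2 - 1)
      (LinSpace.comp₂ h1 ((LinSpace.var 1).pair (LinSpace.var 0).fst) (LinSpace.var 0).snd).pred
  · by_cases h0 : firstValue (fun j : ℕ => h (Nat.pair x j.unpair.1) j.unpair.2 - 1) N = 0
    · exact Or.inl h0
    · obtain ⟨y, -, h5, -⟩ := exists_firstValue h0
      rcases h4 x y with e | e
      · omega
      · right; dsimp only; omega
  · obtain ⟨k, hk⟩ := hg2 x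
    obtain ⟨N, hN⟩ := (h3 (Nat.pair x k)).exists
    filter_upwards [eventually_gt_atTop (Nat.pair k N)] with n hn h0
    have := firstValue_eq_zero.1 h0 _ hn
    simp only [Nat.unpair_pair] at this
    omega

end TuringSpace

/-! ### Prediction by the first machine that has not been refuted -/

namespace TuringSpace

open Filter

section Prediction

variable (Fs : ℕ → ℕ → ℕ)

/-- The values of an approximation found up to the stage `N`. -/
def stage (h : ℕ → ℕ → ℕ) (x N : ℕ) : ℕ := firstValue (h x) (N + 1)

variable {h : ℕ → ℕ → ℕ}

theorem stage_mono {x N N' : ℕ} (hN : N ≤ N') (h0 : stage h x N ≠ 0) : stage h x N' = stage h x N :=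
  firstValue_mono (by omega) h0

theorem exists_of_stage_ne_zero {x N : ℕ} (h0 : stage h x N ≠ 0) : ∃ N', h x N' = stage h x N := by
  obtain ⟨y, -, h1, -⟩ := exists_firstValue h0
  exact ⟨y, h1⟩

theorem stage_ne_zero {x N : ℕ} (h0 : h x N ≠ 0) : stage h x N ≠ 0 := fun h1 =>
  h0 (firstValue_eq_zero.1 h1 N (by omega))

/-- Up to the stage `N`, a disagreement between the machine with code `e` and the approximation `Fs`
has been found. -/
def refuted (e N : ℕ) : ℕ :=
  firstValue (fun y => if stage Fs y N = 0 then 0 else if stage (sim e) y N = 0 then 0 else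
    if stage (sim e) y N = stage Fs y N then 0 else 1) (N + 1)

/-- The prediction of the value at `x`, increased by one, by the first machine that has not been
refuted. -/
def vote (x N : ℕ) : ℕ :=
  firstValue (fun e => if refuted Fs e N = 0 then stage (sim e) x N else 0) (N + 1)

/-- The prediction at the stage `N` of the value at `x`. -/
def predict (x N : ℕ) : ℕ := if stage Fs x N = 0 then vote Fs x N - 1 else stage Fs x N - 1

variable {Fs}

theorem linSpace_predict (hFs : LinSpace fun σ => Fs (σ 0) (σ 1)) :
    LinSpace fun σ => predict Fs (σ 0) (σ 1) := by
  have h1 : LinSpace fun σ => stage Fs (σ 0) (σ 1) :=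
    LinSpace.firstValue (.succ (.var 1)) (F := fun σ j => Fs (σ 0) j) (LinSpace.comp₂ hFs (.var 1) (.var 0))
  have h2 : LinSpace fun σ => stage (sim (σ 0)) (σ 1) (σ 2) :=
    LinSpace.firstValue (.succ (.var 2)) (F := fun σ j => sim (σ 0) (σ 1) j)
      (LinSpace.sim (.var 1) (.var 2) (.var 0))
  have h3 : LinSpace fun σ => refuted Fs (σ 0) (σ 1) := by
    have a : LinSpace fun σ => stage Fs (σ 0) (σ 2) := LinSpace.comp₂ h1 (.var 0) (.var 2)
    have b : LinSpace fun σ => stage (sim (σ 1)) (σ 0) (σ 2) :=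
      LinSpace.comp₃ (F := fun a b c => stage (sim a) b c) h2 (.var 1) (.var 0) (.var 2)
    exact LinSpace.firstValue (.succ (.var 1)) (F := fun σ y => if stage Fs y (σ 1) = 0 then 0 else
      if stage (sim (σ 0)) y (σ 1) = 0 then 0 else
      if stage (sim (σ 0)) y (σ 1) = stage Fs y (σ 1) then 0 else 1)
      (.ite_zero a .zero (.ite_zero b .zero (.ite_eq b a .zero (.const 1))))
  have h4 : LinSpace fun σ => vote Fs (σ 0) (σ 1) := by
    have a : LinSpace fun σ => refuted Fs (σ 0) (σ 2) := LinSpace.comp₂ h3 (.var 0) (.var 2)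
    have b : LinSpace fun σ => stage (sim (σ 0)) (σ 1) (σ 2) := h2
    exact LinSpace.firstValue (.succ (.var 1))
      (F := fun σ e => if refuted Fs e (σ 1) = 0 then stage (sim e) (σ 0) (σ 1) else 0)
      (.ite_zero a b .zero)
  exact .ite_zero h1 h4.pred h1.pred

theorem stage_eq {F : ℕ → ℕ} (hF : ∀ x N, h x N = 0 ∨ h x N = F x + 1) {x N : ℕ}
    (h0 : stage h x N ≠ 0) : stage h x N = F x + 1 := by
  obtain ⟨N', hN⟩ := exists_of_stage_ne_zero h0
  rw [← hN] at h0 ⊢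
  exact (hF x N').resolve_left h0

theorem predict_eq_of_stage_ne_zero {F : ℕ → ℕ} (hF : ∀ x N, Fs x N = 0 ∨ Fs x N = F x + 1)
    {x N : ℕ} (h0 : stage Fs x N ≠ 0) : predict Fs x N = F x := by
  rw [predict, if_neg h0, stage_eq hF h0, Nat.add_sub_cancel]

/-- A machine that gives a wrong value is refuted at all late stages. -/
theorem eventually_refuted {F : ℕ → ℕ} (hF : ∀ x N, Fs x N = 0 ∨ Fs x N = F x + 1)
    (hF' : ∀ x, ∀ᶠ N in atTop, Fs x N ≠ 0) {e y M : ℕ} (h0 : stage (sim e) y M ≠ 0)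
    (h1 : stage (sim e) y M ≠ F y + 1) : ∀ᶠ N in atTop, refuted Fs e N ≠ 0 := by
  filter_upwards [hF' y, eventually_ge_atTop M, eventually_ge_atTop y] with N h2 h3 h4 h5
  have h6 := firstValue_eq_zero.1 h5 y (by omega)
  have h7 := stage_ne_zero h2
  have h8 := stage_mono h3 h0
  have h9 := stage_eq hF h7
  rw [if_neg h7, if_neg (by rwa [h8]), if_neg (by rwa [h8, h9])] at h6
  exact one_ne_zero h6

theorem refuted_eq_zero {F : ℕ → ℕ} (hF : ∀ x N, Fs x N = 0 ∨ Fs x N = F x + 1) {e : ℕ}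
    (he : ∀ x N, sim e x N = 0 ∨ sim e x N = F x + 1) (N : ℕ) : refuted Fs e N = 0 := by
  refine firstValue_eq_zero.2 fun y _ => ?_
  split_ifs with h1 h2 h3 <;> try rfl
  exact absurd ((stage_eq he h2).trans (stage_eq hF h1).symm) h3

/-- The predictions are correct as soon as they can simulate an algorithm for the function. -/
theorem predict_eq {F : ℕ → ℕ} (hF : ∀ x N, Fs x N = 0 ∨ Fs x N = F x + 1)
    (hF' : ∀ x, ∀ᶠ N in atTop, Fs x N ≠ 0) {e : ℕ}
    (he : ∀ x N, sim e x N = 0 ∨ sim e x N = F x + 1) :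
    ∃ B, ∀ x N, B ≤ N → sim e x N ≠ 0 → predict Fs x N = F x := by
  have h1 : ∀ i, ∀ᶠ N in atTop, (∃ y M, stage (sim i) y M ≠ 0 ∧ stage (sim i) y M ≠ F y + 1) →
      refuted Fs i N ≠ 0 := by
    intro i
    by_cases hi : ∃ y M, stage (sim i) y M ≠ 0 ∧ stage (sim i) y M ≠ F y + 1
    · obtain ⟨y, M, h1, h2⟩ := hi
      filter_upwards [eventually_refuted hF hF' h1 h2] with N h _ using h
    · exact .of_forall fun N h => absurd h hi
  -- Only finitely many machines precede `e`, so one stage refutes all of them that ever err. It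
  -- does not depend on `x`, and it cannot be computed from `F`.
  have h2 : ∀ᶠ N in atTop, ∀ i ∈ Finset.range (e + 1),
      (∃ y M, stage (sim i) y M ≠ 0 ∧ stage (sim i) y M ≠ F y + 1) → refuted Fs i N ≠ 0 :=
    (Finset.range (e + 1)).eventually_all.2 fun i _ => h1 i
  obtain ⟨B, hB⟩ := eventually_atTop.1 h2
  -- The summand `e` makes the search in `vote` reach the machine `e`.
  refine ⟨B + e, fun x N hN h3 => ?_⟩
  by_cases h4 : stage Fs x N = 0
  swap
  · exact predict_eq_of_stage_ne_zero hF h4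
  rw [predict, if_pos h4]
  have h5 : vote Fs x N ≠ 0 := fun h5 => by
    have := firstValue_eq_zero.1 h5 e (by omega)
    rw [if_pos (refuted_eq_zero hF he N)] at this
    exact stage_ne_zero h3 this
  obtain ⟨i, -, h6, h7⟩ := exists_firstValue h5
  -- Machine `e` is never refuted and has a value at `x` by now, so the vote is decided by it or by
  -- an earlier machine.
  have h8 : i ≤ e := by
    by_contra h8
    have := h7 e (by omega)
    rw [if_pos (refuted_eq_zero hF he N)] at this
    exact stage_ne_zero h3 this
  change _ = vote Fs x N at h6
  rw [← h6] at h5 ⊢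
  split_ifs at h5 ⊢ with h9
  -- Not being refuted after stage `B` means never to err, so the value of machine `i` is right,
  -- even if it is not an algorithm for `F` everywhere.
  · have := mt (hB N (by omega) i (Finset.mem_range.2 (by omega))) (by simpa using h9)
    push Not at this
    rw [this x N h5, Nat.add_sub_cancel]
  · exact absurd rfl h5

end Prediction

end TuringSpace

/-! ### The threshold function `G` -/

namespace TuringSpace

open Filter

/-- The least number `s ≤ k` such that `f` is zero between `s` and `k`. -/
def lastNonzero (f : ℕ → ℕ) : ℕ → ℕ
  | 0 => 0
  | k + 1 => if f k = 0 then lastNonzero f k else k + 1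

theorem eq_zero_of_lastNonzero_le {f : ℕ → ℕ} {k s : ℕ} (h : lastNonzero f k ≤ s) (hs : s < k) :
    f s = 0 := by
  induction k with
  | zero => omega
  | succ k ih =>
    rw [lastNonzero] at h
    split_ifs at h with h1
    · rcases Nat.lt_succ_iff_lt_or_eq.1 hs with h2 | rfl
      · exact ih h h2
      · exact h1
    · omega

theorem lastNonzero_le {f : ℕ → ℕ} {s : ℕ} (h : ∀ i ≥ s, f i = 0) (k : ℕ) :
    lastNonzero f k ≤ s := by
  induction k with
  | zero => exact Nat.zero_le _
  | succ k ih =>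
    rw [lastNonzero]
    split_ifs with h1
    · exact ih
    · by_contra h2
      exact h1 (h k (by omega))

theorem computable_find {f : ℕ → ℕ → ℕ} (hf : Computable₂ f) (h : ∀ x, ∃ n, f x n ≠ 0) :
    Computable fun x => Nat.find (h x) := by
  have h1 : Computable₂ fun x n => !decide (f x n = 0) :=
    Primrec.not.to_comp.comp
      ((Primrec.eq.decide.comp .id (.const 0)).to_comp.comp hf)
  refine (Partrec.rfind h1.partrec₂).of_eq fun x => Part.eq_some_iff.2 (Nat.mem_rfind.2 ⟨?_, ?_⟩)
  · simpa using Nat.find_spec (h x)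
  · intro m hm
    simpa using Nat.find_min (h x) hm

/-- Here `G x` is the last `s` for which the prediction at stage `2 ^ s` fails, plus one, or `0` if
there is none. The function `Q` is the predictor; it does not depend on the algorithm `A`, which
only influences the constant `C`. -/
theorem exists_threshold {F : ℕ → ℕ} (hF : Computable F) : ∃ (Q : ℕ → ℕ → ℕ) (G : ℕ → ℕ),
    (LinSpace fun σ => Q (σ 0) (σ 1)) ∧ Computable G ∧ (∀ x s, G x ≤ s → Q x (2 ^ s) = F x) ∧
      ∀ A : Algorithm, (∀ x, ∀ y ∈ A.eval x, y = F x) →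
        ∃ C, ∀ x (p : ℕ), A.space x = p → G x ≤ C * p := by
  obtain ⟨Fs, hFs, h1, h2⟩ := exists_approximation hF
  have hP := linSpace_predict hFs
  have hex : ∀ x, ∃ n, Fs x n ≠ 0 := fun x => (h2 x).exists
  let d : ℕ → ℕ → ℕ := fun x s => if predict Fs x (2 ^ s) = F x then 0 else 1
  have hd : ∀ x s, d x s = 0 ↔ predict Fs x (2 ^ s) = F x := fun x s => by simp [d]
  have hpair : ∀ {f : ℕ → ℕ → ℕ}, (LinSpace fun σ => f (σ 0) (σ 1)) → Primrec₂ f := fun {f} hf =>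
    (LinSpace.primrec hf (g := fun i p => if i = 0 then p.1 else p.2) fun i => by
      by_cases hi : i = 0
      · simpa [hi] using Primrec.fst
      · simpa [hi] using Primrec.snd).of_eq fun p => by simp
  have hpow : Primrec fun s : ℕ => 2 ^ s :=
    (Primrec.nat_rec₁ 1 (f := fun _ y => 2 * y)
      (Primrec.nat_mul.comp (.const 2) .snd).to₂).of_eq fun s => by
        induction s with
        | zero => rfl
        | succ s ih => simp only [pow_succ, ← ih]; ring
  have hdc : Computable₂ d := by
    have : Computable fun p : ℕ × ℕ => decide (predict Fs p.1 (2 ^ p.2) = F p.1) :=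
      Primrec.eq.decide.to_comp.comp
        ((hpair hP).to_comp.comp .fst (hpow.to_comp.comp .snd)) (hF.comp .fst)
    exact (Computable.cond this (.const 0) (.const 1)).of_eq fun p => by
      by_cases h : predict Fs p.1 (2 ^ p.2) = F p.1 <;> simp [d, h]
  have hlc : Computable₂ fun x k => lastNonzero (d x) k := by
    have h4 : Computable fun q : (ℕ × ℕ) × (ℕ × ℕ) => decide (d q.1.1 q.2.1 = 0) :=
      Primrec.eq.decide.to_comp.comp (hdc.comp (Computable.fst.comp .fst)
        (Computable.fst.comp .snd)) (.const 0)
    have h5 : Computable₂ fun (p : ℕ × ℕ) (q : ℕ × ℕ) => bif decide (d p.1 q.1 = 0) then q.2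
        else q.1 + 1 :=
      Computable.cond h4 (Computable.snd.comp .snd)
        (Computable.succ.comp (Computable.fst.comp .snd))
    refine (Computable.nat_rec (f := fun p : ℕ × ℕ => p.2) (g := fun _ => 0) .snd (.const 0)
      h5).of_eq fun p => ?_
    obtain ⟨x, k⟩ := p
    induction k with
    | zero => rfl
    | succ k ih =>
      simp only at ih ⊢
      rw [lastNonzero, ← ih]
      by_cases h : d x k = 0 <;> simp [h]
  -- Once the approximation has found `F x`, failures are impossible. The last failure is therefore
  -- found by a search up to a computable bound, which makes `G` computable.
  have hlate : ∀ x s, Nat.find (hex x) ≤ s → predict Fs x (2 ^ s) = F x := by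
    intro x s hs
    have h3 : stage Fs x (Nat.find (hex x)) ≠ 0 := stage_ne_zero (Nat.find_spec (hex x))
    refine predict_eq_of_stage_ne_zero h1 ?_
    rw [stage_mono (hs.trans Nat.lt_two_pow_self.le) h3]
    exact h3
  refine ⟨predict Fs, fun x => lastNonzero (d x) (Nat.find (hex x)), hP,
    hlc.comp .id (computable_find (hpair hFs).to_comp hex), fun x s hs => ?_, fun A hA => ?_⟩
  · rcases lt_or_ge s (Nat.find (hex x)) with h | h
    · exact (hd x s).1 (eq_zero_of_lastNonzero_le hs h)
    · exact hlate x s h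
  · obtain ⟨e, C, h3, h4⟩ := exists_sim A
    obtain ⟨B, hB⟩ := predict_eq h1 h2 (e := e) fun x N => by
      by_cases h : sim e x N = 0
      · exact Or.inl h
      · obtain ⟨y, hy, h5⟩ := h4 x N h
        exact Or.inr (hA x y hy ▸ h5)
    -- A stage `2 ^ s` with `s ≥ C * p` simulates `A` at `x`. As `p ≥ 1`, the additional `B * p`
    -- brings the stage beyond `B` as well.
    refine ⟨C + B, fun x p hp => lastNonzero_le (fun s hs => (hd x s).2 ?_) _⟩
    have hdom : (A.eval x).Dom := by
      by_contra h
      rw [Algorithm.space, if_neg h] at hp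
      exact ENat.top_ne_natCast p hp
    obtain ⟨y, hy⟩ := Part.dom_iff_mem.1 hdom
    obtain ⟨q, hq, hq1, h5⟩ := h3 x y hy
    obtain rfl : p = q := by exact_mod_cast hp.symm.trans hq
    have h6 : (C + B) * p = C * p + B * p := add_mul _ _ _
    have h7 : B ≤ B * p := Nat.le_mul_of_pos_right _ hq1
    refine hB x (2 ^ s) ?_ ?_
    · exact le_trans (by omega) (Nat.lt_two_pow_self (n := s)).le
    · rw [h5 _ (Nat.pow_le_pow_right (by omega) (by omega))]
      omega

end TuringSpace

/-! ### Simple spaces: both directions of the theorem -/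

namespace TuringSpace

theorem Algorithm.space_eq_top {A : Algorithm} {x : ℕ} (h : ¬ (A.eval x).Dom) : A.space x = ⊤ :=
  if_neg h

/-- The space of an algorithm is computed by an algorithm in the same space. -/
theorem isSimple_space (A : Algorithm) : IsSimple A.space := by
  obtain ⟨e, K, h⟩ := exists_simulation A
  -- `T` simulates `A` and keeps track of its used space, which serves both as the output and as the
  -- prescribed space.
  obtain ⟨T, hT⟩ := exists_algorithm (ini := machInit e) (stp := machStep e) (flag := machAction e)
    (out := machSpace) (tot := machSpace) ((LinSpace.const e).machInit (.var 0))
    ((LinSpace.const e).machStep (.var 0)) ((LinSpace.const e).machAction (.var 0))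
    (LinSpace.machSpace (.var 0)) (LinSpace.machSpace (.var 0)) K
  have hdom : ∀ x, (A.eval x).Dom → ∃ p : ℕ, A.space x = p ∧ T.eval x = Part.some p ∧
      T.space x = p := by
    intro x hx
    obtain ⟨y, hy⟩ := Part.dom_iff_mem.1 hx
    obtain ⟨t, p, h1, h2, h3, h4, -, rfl, h6, h7⟩ := (h x).1 y hy
    exact ⟨_, h1, (hT x).1 t (K ^ machSpace ((machStep e)^[t] (machInit e x)) - 2) h3 h4 h2
      (by omega) (fun i hi => by have := h7 i hi; omega) (by omega)⟩
  refine ⟨T, fun x y => ?_, fun x => ?_⟩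
  · by_cases hx : (A.eval x).Dom
    · obtain ⟨p, h1, h2, -⟩ := hdom x hx
      rw [h1, h2, Part.mem_some_iff]
      exact ⟨fun h => by rw [h], fun h => by exact_mod_cast h.symm⟩
    · rw [Algorithm.space_eq_top hx]
      exact ⟨fun hy => absurd (Part.dom_iff_mem.2 ⟨y, hy⟩) ((hT x).2 ((h x).2 hx)),
        fun hy => absurd hy (ENat.top_ne_natCast y)⟩
  · by_cases hx : (A.eval x).Dom
    · obtain ⟨p, h1, -, h2⟩ := hdom x hx
      rw [h1, h2]
    · rw [Algorithm.space_eq_top hx]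
      exact le_top

/-- The states of the computation of a function at `x` with a space computed by a machine: first
the machine is run, and then a counter `j` is increased. -/
def clockState (x c j : ℕ) : ℕ := Nat.pair x (Nat.pair c (Nat.pair j (2 ^ j)))

/-- A step of the computation of a function with a space computed by the machine with code `e`. -/
def clockStep (e s : ℕ) : ℕ :=
  Nat.pair s.unpair.1 (if machAction e s.unpair.2.unpair.1 = 0 then
    Nat.pair s.unpair.2.unpair.1
      (Nat.pair (s.unpair.2.unpair.2.unpair.1 + 1) (s.unpair.2.unpair.2.unpair.2 * 2))
    else Nat.pair (machStep e s.unpair.2.unpair.1) s.unpair.2.unpair.2)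

/-- The computation goes on until the counter reaches `C` times the output of the machine. -/
def clockFlag (e C s : ℕ) : ℕ :=
  if machAction e s.unpair.2.unpair.1 = 0 then
    C * machOut e s.unpair.2.unpair.1 - s.unpair.2.unpair.2.unpair.1 else 1

theorem clockStep_clockState (e x c j : ℕ) : clockStep e (clockState x c j) =
    if machAction e c = 0 then clockState x c (j + 1) else clockState x (machStep e c) j := by
  simp only [clockStep, clockState, Nat.unpair_pair, pow_succ]
  split_ifs <;> rfl

theorem clockFlag_clockState (e C x c j : ℕ) : clockFlag e C (clockState x c j) =
    if machAction e c = 0 then C * machOut e c - j else 1 := by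
  simp only [clockFlag, clockState, Nat.unpair_pair]

theorem iterate_clockStep_run {e x c t : ℕ} (h : ∀ i < t, machAction e ((machStep e)^[i] c) ≠ 0) :
    (clockStep e)^[t] (clockState x c 0) = clockState x ((machStep e)^[t] c) 0 := by
  induction t with
  | zero => rfl
  | succ t ih =>
    rw [Function.iterate_succ_apply', ih fun i hi => h i (by omega), clockStep_clockState,
      if_neg (h t (by omega)), Function.iterate_succ_apply']

theorem iterate_clockStep_count {e x c : ℕ} (h : machAction e c = 0) (i : ℕ) :
    (clockStep e)^[i] (clockState x c 0) = clockState x c i := by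
  induction i with
  | zero => rfl
  | succ i ih => rw [Function.iterate_succ_apply', ih, clockStep_clockState, if_pos h]

/-- Each of the three nested pairings doubles the exponent. -/
theorem clockState_lt {x c j X q : ℕ} (hx : x < X ^ q) (hc : c < X ^ q) (hj : 2 ^ j < X ^ q) :
    clockState x c j < X ^ (8 * q) := by
  have hX : 0 < X := by
    rcases X.eq_zero_or_pos with rfl | h
    · rcases q.eq_zero_or_pos with rfl | hq
      · have := Nat.one_le_two_pow (n := j); omega
      · simp [hq.ne'] at hx
    · exact h
  have h1 := pair_lt_pow (Nat.lt_two_pow_self.trans hj) hj (j := 2 * q) rfl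
  have h2 := pair_lt_pow (hc.trans_le (Nat.pow_le_pow_right hX (by omega : q ≤ 2 * q))) h1
    (j := 4 * q) (by omega)
  exact pair_lt_pow (hx.trans_le (Nat.pow_le_pow_right hX (by omega : q ≤ 4 * q))) h2 (by omega)

/-- An algorithm that runs for every input `x` with a space `p x`, computed within itself, and
outputs `Q x (2 ^ (C * p x))`. -/
theorem exists_algorithm_of_isSimple {Q : ℕ → ℕ → ℕ} (hQ : LinSpace fun σ => Q (σ 0) (σ 1)) (C : ℕ)
    {p : ℕ → ℕ∞} (hp : IsSimple p) : ∃ T : Algorithm, T.space = p ∧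
      ∀ x, ∀ y ∈ T.eval x, ∃ q : ℕ, p x = q ∧ y = Q x (2 ^ (C * q)) := by
  obtain ⟨A, hA, hAp⟩ := hp
  obtain ⟨e, K, h⟩ := exists_simulation A
  have hc : LinSpace fun σ => (σ 0).unpair.2.unpair.1 := (LinSpace.var 0).snd.fst
  have ha := (LinSpace.const e).machAction hc
  have ho := (LinSpace.const e).machOut hc
  have hj := (LinSpace.var 0).snd.snd
  -- `X ^ q` dominates the codes of configurations, which are bounded by `K ^ r` with `r ≤ q`, and
  -- the powers `2 ^ j` with `j ≤ C * q`; the exponent `C + 1` makes the latter strict.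
  obtain ⟨X, hX⟩ : ∃ X, X = (K + 1) * 2 ^ (C + 1) := ⟨_, rfl⟩
  have hX0 : 0 < X := by rw [hX]; positivity
  -- Exponentiation is not in `LinSpace`. The number `2 ^ (C * q)` is instead built up by doubling
  -- inside the loop, after the simulated machine has found `q`.
  obtain ⟨T, hT⟩ := exists_algorithm (ini := fun x => clockState x (machInit e x) 0)
    (stp := clockStep e) (flag := clockFlag e C)
    (out := fun s => Q s.unpair.1 s.unpair.2.unpair.2.unpair.2)
    (tot := fun s => machOut e s.unpair.2.unpair.1)
    ((LinSpace.var 0).pair (((LinSpace.const e).machInit (.var 0)).pair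
      ((LinSpace.const 0).pair (.const 1))))
    ((LinSpace.var 0).fst.pair (.ite_zero ha (hc.pair (hj.fst.succ.pair (hj.snd.mul (.const 2))))
      (((LinSpace.const e).machStep hc).pair hj)))
    (.ite_zero ha (((LinSpace.const C).mul ho).sub hj.fst) (.const 1))
    (.comp₂ hQ (LinSpace.var 0).fst hj.snd) ho (X ^ 8 * 3)
  have hdom : ∀ x (q : ℕ), p x = q → T.eval x = Part.some (Q x (2 ^ (C * q))) ∧ T.space x = q := by
    intro x q hq
    obtain ⟨t, r, h1, h2, h3, h4, h5, -, h6, h7⟩ := (h x).1 q ((hA x q).2 hq)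
    -- The machine for `p` may use less space than `p x`. Its output `q`, not its space `r`, is
    -- prescribed to `T`.
    have hr : r ≤ q := by exact_mod_cast h1 ▸ hq ▸ hAp x
    set d := (machStep e)^[t] (machInit e x) with hd
    have hKX : K ^ r ≤ X ^ q := by
      calc K ^ r ≤ (K + 1) ^ r := Nat.pow_le_pow_left (by omega) _
        _ ≤ (K + 1) ^ q := Nat.pow_le_pow_right (by omega) hr
        _ ≤ X ^ q := Nat.pow_le_pow_left (hX ▸ Nat.le_mul_of_pos_right _ (by positivity)) _
    have hjX : ∀ j ≤ C * q, 2 ^ j < X ^ q := by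
      intro j hj
      calc 2 ^ j ≤ 2 ^ (C * q) := Nat.pow_le_pow_right (by omega) hj
        _ < 2 ^ ((C + 1) * q) := Nat.pow_lt_pow_right (by omega) (by rw [add_mul]; omega)
        _ = (2 ^ (C + 1)) ^ q := pow_mul _ _ _
        _ ≤ X ^ q := Nat.pow_le_pow_left (hX ▸ Nat.le_mul_of_pos_left _ (by omega)) _
    have hrun : ∀ i ≤ t, (clockStep e)^[i] (clockState x (machInit e x) 0) =
        clockState x ((machStep e)^[i] (machInit e x)) 0 := fun i hi =>
      iterate_clockStep_run fun j hj => h3 j (by omega)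
    have hcount : ∀ i, (clockStep e)^[i + t] (clockState x (machInit e x) 0) =
        clockState x d i := fun i => by
      rw [Function.iterate_add_apply, hrun t le_rfl, iterate_clockStep_count h4]
    have hout : Q ((clockState x d (C * q)).unpair.1)
        ((clockState x d (C * q)).unpair.2.unpair.2.unpair.2) = Q x (2 ^ (C * q)) := by
      simp only [clockState, Nat.unpair_pair]
    have htot : machOut e ((clockState x d (C * q)).unpair.2.unpair.1) = q := by
      simp only [clockState, Nat.unpair_pair, h5]
    have hb1 : ∀ i < C * q + t,
        clockFlag e C ((clockStep e)^[i] (clockState x (machInit e x) 0)) ≠ 0 := by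
      intro i hi
      rcases lt_or_ge i t with hit | hit
      · rw [hrun i hit.le, clockFlag_clockState, if_neg (h3 i hit)]
        exact one_ne_zero
      · obtain ⟨k, rfl⟩ := Nat.exists_eq_add_of_le' hit
        rw [hcount, clockFlag_clockState, if_pos h4, h5]
        omega
    have hb2 : clockFlag e C ((clockStep e)^[C * q + t] (clockState x (machInit e x) 0)) = 0 := by
      rw [hcount, clockFlag_clockState, if_pos h4, h5, Nat.sub_self]
    have hx : x ≤ X ^ (8 * q) := by
      have : X ^ q ≤ X ^ (8 * q) := Nat.pow_le_pow_right hX0 (by omega)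
      omega
    have hb3 : ∀ i ≤ C * q + t,
        (clockStep e)^[i] (clockState x (machInit e x) 0) ≤ X ^ (8 * q) := by
      intro i hi
      rcases le_or_gt i t with hit | hit
      · rw [hrun i hit]
        have := h7 i hit
        exact (clockState_lt (by omega) (by omega) (hjX 0 (Nat.zero_le _))).le
      · obtain ⟨k, rfl⟩ := Nat.exists_eq_add_of_le' hit.le
        rw [hcount]
        have := h7 t le_rfl
        exact (clockState_lt (by omega) (by omega) (hjX k (by omega))).le
    have hb4 : X ^ (8 * q) + 2 ≤ (X ^ 8 * 3) ^ q := by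
      rw [mul_pow, ← pow_mul]
      have h8 : 1 ≤ X ^ (8 * q) := Nat.one_le_pow _ _ hX0
      have h9 : 3 ^ 1 ≤ 3 ^ q := Nat.pow_le_pow_right (by omega) (by omega)
      nlinarith
    have key := (hT x).1 (C * q + t) (X ^ (8 * q)) hb1 hb2
    rw [hcount, htot, hout] at key
    exact key (by omega) hx hb3 hb4
  have htop : ∀ x, p x = ⊤ → ¬ (T.eval x).Dom := by
    intro x hx
    have h1 : ¬ (A.eval x).Dom := fun hd => by
      obtain ⟨y, hy⟩ := Part.dom_iff_mem.1 hd
      exact ENat.top_ne_natCast y (hx ▸ (hA x y).1 hy)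
    have h2 := (h x).2 h1
    -- Where `p x` is infinite the simulated machine does not halt, so the first phase of the loop
    -- never ends.
    refine (hT x).2 fun i => ?_
    rw [iterate_clockStep_run fun j _ => h2 j, clockFlag_clockState, if_neg (h2 i)]
    exact one_ne_zero
  refine ⟨T, funext fun x => ?_, fun x y hy => ?_⟩
  · by_cases hx : p x = ⊤
    · rw [Algorithm.space_eq_top (htop x hx), hx]
    · obtain ⟨q, hq⟩ := ENat.ne_top_iff_exists.1 hx
      rw [(hdom x q hq.symm).2, hq]
  · have hx : p x ≠ ⊤ := fun hx => htop x hx (Part.dom_iff_mem.2 ⟨y, hy⟩)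
    obtain ⟨q, hq⟩ := ENat.ne_top_iff_exists.1 hx
    rw [(hdom x q hq.symm).1, Part.mem_some_iff] at hy
    exact ⟨q, hq.symm, hy⟩

end TuringSpace


theorem theorem2 (F : ℕ → ℕ) (hF : Computable F) :
    ∃ G : ℕ → ℕ, Computable G ∧
      ∀ p : ℕ → ℕ∞, TuringSpace.ComputableInSpace (F : ℕ →. ℕ) p ↔
        TuringSpace.IsSimple p ∧ TuringSpace.Prec (fun x => (G x : ℕ∞)) p := by
  obtain ⟨Q, G, hQ, hG, h1, h2⟩ := TuringSpace.exists_threshold hF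
  refine ⟨G, hG, fun p => ⟨?_, ?_⟩⟩
  · rintro ⟨A, hA, rfl⟩
    refine ⟨TuringSpace.isSimple_space A, ?_⟩
    obtain ⟨C, hC⟩ := h2 A fun x y hy => hA x y hy (F x) (Part.mem_some _)
    -- The constant must not be `0`, because `0 * ⊤ = 0` in `ℕ∞`.
    refine ⟨C + 1, fun x => ?_⟩
    by_cases hx : A.space x = ⊤
    · rw [hx, ENat.mul_top (by simp)]
      exact le_top
    · obtain ⟨q, hq⟩ := ENat.ne_top_iff_exists.1 hx
      have h3 := hC x q hq.symm
      rw [← hq]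
      change (G x : ℕ∞) ≤ _
      exact_mod_cast h3.trans (Nat.mul_le_mul_right q (Nat.le_succ C))
  · rintro ⟨hp, C, hC⟩
    obtain ⟨T, hT, h3⟩ := TuringSpace.exists_algorithm_of_isSimple hQ C hp
    refine ⟨T, fun x y hy z hz => ?_, hT⟩
    obtain ⟨q, hq, rfl⟩ := h3 x y hy
    have h4 : (G x : ℕ∞) ≤ C * p x := hC x
    rw [hq] at h4
    -- The prediction at stage `2 ^ (C * q)` is correct because `G x ≤ C * q`.
    rw [h1 x (C * q) (by exact_mod_cast h4)]
    exact (Part.mem_some_iff.1 hz).symm
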